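/- **Setting.** Let $k\in\{1,2,3\}$, $d\ge 1$. For $k=1$ let $D=(0,b)$ with $b>0$ and $G_D(x,y)=x\wedge y-\frac{xy}{b}$. For $k=2,3$ let $D\subset\mathbb R^k$ be a bounded domain with regular boundary (the Dirichlet problem on $D$ is solvable for all continuous boundary values), and let $G_D(x,y)=\Gamma(|x-y|)-h_y(x)$ be its Green function, where $\Gamma(r)=-\frac1{2\pi}\log r$ for $k=2$, $\Gamma(r)=\frac1{4\pi r}$ for $k=3$, and $h_y$ is harmonic in $D$, continuous on $\overline D$, and equal to $\Gamma(|\cdot-y|)$ on $\partial D$ (equivalently $h_y(x)=\mathbb E_x\,\Gamma(|B_\tau-y|)$, with $B_\tau$ the point where Brownian motion started from $x$ first hits $\partial D$). Write $\|\cdot\|$ and $\langle\cdot,\cdot\rangle$ for the norm and inner product of $L^2(D;\mathbb R^d)$. Let $W=(W^1,\dots,W^d)$ be a $d$-dimensional white noise on $\mathbb R^k$, $\sigma=(\sigma_{ij})$ a non-singular real $d\times d$ matrix, $f:\mathbb R^d\to\mathbb R^d$ and $g:D\to\mathbb R^d$. Let $u=\{u(x),x\in D\}$ be a mild solution of $-\Delta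 u^i+f^i(u)=g^i+\sum_j\sigma_{ij}\dot W^j$ in $D$, $u|_{\partial D}=0$: a process whose sample paths are a.s. continuous on $\overline D$ and zero on $\partial D$, such that for all $x\in D$, a.s., for $i=1,\dots,d$, $$u^i(x)+\int_D G_D(x,y)f^i(u(y))\,dy=\int_D G_D(x,y)g^i(y)\,dy+\sum_{j=1}^d\sigma_{ij}\int_D G_D(x,y)\,W^j(dy).$$ **Hypotheses.** (i) $g\in L^2(D;\mathbb R^d)$. (ii) $F(v)=f\circ v$ defines an operator $F:L^2(D;\mathbb R^d)\to L^2(D;\mathbb R^d)$ that is continuous in norm and bounded (it maps bounded sets to bounded sets). Moreover $F=F_1+F_2$, where $F_j(v)=f_j\circ v$ ($f_j:\mathbb R^d\to\mathbb R^d$) are operators on $L^2(D;\mathbb R^d)$ such that $F_1$ is bounded with $\langle v-w,F_1(v)-F_1(w)\rangle\ge0$ for all $v,w$, and, for some $L>0$ and all $v\in L^2(D;\mathbb R^d)$, $|F_2(v)(z_1)-F_2(v)(z_2)|\le L|v(z_1)-v(z_2)|$ for almost all $z_1,z_2\in D$. (iii) $L<a\wedge\bigl(K|D|^{1/2}\bigr)^{-1}$,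 where $K=\sup_{x\in D}\|G_D(x,\cdot)\|_{L^2(D)}$, $|D|$ is the Lebesgue measure of $D$, and $a>0$ is a constant such that $\bigl\langle\int_D G_D(\cdot,y)\varphi(y)\,dy,\varphi\bigr\rangle\ge a\bigl\|\int_D G_D(\cdot,y)\varphi(y)\,dy\bigr\|^2$ for all $\varphi\in L^2(D;\mathbb R^d)$. **Conclusion.** Let $A$ be an open ball $B_r(c)$ with $\overline{B_r(c)}\subset D$; if $k=1$, also $A=D$ is allowed. For $\gamma\in(0,1)$ put $\xi=1$ if $k=1$, $\xi=1-\gamma$ if $k=2$, $\xi=\frac12$ if $k=3$. Then for every $\gamma\in(0,1)$ and every real $p\ge2$ there is a constant $C>0$ such that $$\mathbb E\bigl[|u(x_1)-u(x_2)|^p\bigr]\le C|x_1-x_2|^{p\xi}\qquad\text{for all }x_1,x_2\in A.$$ Moreover, for almost all $\omega$, the sample path $x\mapsto u(x)(\omega)$ is Hölder continuous on $A$ of every order $\alpha\in(0,1)$ if $k=1,2$, and of every order $\alpha\in(0,\frac12)$ if $k=3$. -/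

import Mathlib

open MeasureTheory ProbabilityTheory Set Metric InnerProductSpace
open scoped ENNReal NNReal RealInnerProductSpace

noncomputable section

namespace EllipticSPDE

/-- `ℝⁿ` with its Euclidean norm. -/
abbrev Euc (n : ℕ) : Type := EuclideanSpace ℝ (Fin n)

/-- The Hilbert space `L²(D; ℝᵈ)`. -/
abbrev L2 {k : ℕ} (D : Set (Euc k)) (d : ℕ) : Type := Lp (Euc d) 2 (volume.restrict D)

/-! ### Green functions of the Dirichlet Laplacian -/

/-- `h` is a classical solution of the Dirichlet problem on `D` with boundary values `φ`: it is
harmonic in `D`, continuous on the closure, and equal to `φ` on the boundary. -/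
def IsDirichletSolution {k : ℕ} (D : Set (Euc k)) (φ h : Euc k → ℝ) : Prop :=
  HarmonicOnNhd h D ∧ ContinuousOn h (closure D) ∧ EqOn h φ (frontier D)

/-- `D` has a regular boundary: the Dirichlet problem is solvable for all continuous boundary
values. -/
def HasRegularBoundary {k : ℕ} (D : Set (Euc k)) : Prop :=
  ∀ φ : Euc k → ℝ, ContinuousOn φ (frontier D) → ∃ h, IsDirichletSolution D φ h

open Classical in
/-- The solution of the Dirichlet problem (unique on `closure D` when `D` is bounded and open);
at `x ∈ D` it is the expectation of `φ` at the point where Brownian motion started from `x` first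
hits the boundary. -/
def dirichletSolution {k : ℕ} (D : Set (Euc k)) (φ : Euc k → ℝ) : Euc k → ℝ :=
  if h : ∃ h, IsDirichletSolution D φ h then h.choose else 0

/-- The fundamental solution of `-Δ` in the plane, as a function of the distance. -/
def fundSol2 (r : ℝ) : ℝ := -(1 / (2 * Real.pi)) * Real.log r

/-- The fundamental solution of `-Δ` in space, as a function of the distance. -/
def fundSol3 (r : ℝ) : ℝ := 1 / (4 * Real.pi) * r⁻¹

/-- The Green function of `D` obtained from the fundamental solution `Γ`:
`G(x, y) = Γ(|x - y|) - h_y(x)`, with `h_y` harmonic in `D` and equal to `Γ(|· - y|)` on the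
boundary of `D`. -/
def greenFunction {k : ℕ} (Γ : ℝ → ℝ) (D : Set (Euc k)) (x y : Euc k) : ℝ :=
  Γ ‖x - y‖ - dirichletSolution D (fun z => Γ ‖z - y‖) x

/-- The Green function of the interval `(0, b)`. -/
def greenInterval (b : ℝ) (x y : Euc 1) : ℝ := min (x 0) (y 0) - x 0 * y 0 / b

/-- The admissible domains `D ⊂ ℝᵏ`, `k = 1, 2, 3`, together with their Green function `G`:
the intervals `(0, b)` for `k = 1`, and the bounded domains with regular boundary for
`k = 2, 3`. -/
inductive IsDomainWithGreen :
    (k : ℕ) → (D : Set (Euc k)) → (G : Euc k → Euc k → ℝ) → Prop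
  | dim1 (b : ℝ) (hb : 0 < b) :
      IsDomainWithGreen 1 {x | 0 < x 0 ∧ x 0 < b} (greenInterval b)
  | dim2 (D : Set (Euc 2)) (hopen : IsOpen D) (hconn : IsConnected D)
      (hbdd : Bornology.IsBounded D) (hreg : HasRegularBoundary D) :
      IsDomainWithGreen 2 D (greenFunction fundSol2 D)
  | dim3 (D : Set (Euc 3)) (hopen : IsOpen D) (hconn : IsConnected D)
      (hbdd : Bornology.IsBounded D) (hreg : HasRegularBoundary D) :
      IsDomainWithGreen 3 D (greenFunction fundSol3 D)

/-- `K = sup_{x ∈ D} ‖G(x, ·)‖_{L²(D)}`. -/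
def greenSup {k : ℕ} (D : Set (Euc k)) (G : Euc k → Euc k → ℝ) : ℝ≥0∞ :=
  ⨆ x ∈ D, eLpNorm (G x) 2 (volume.restrict D)

/-- `a` is a constant for which the Poincaré-type inequality
`⟨Gφ, φ⟩ ≥ a ‖Gφ‖²` holds for all `φ ∈ L²(D; ℝᵈ)`, with `Gφ(x) = ∫_D G(x, y) φ(y) dy`. -/
def IsPoincareConst {k : ℕ} (D : Set (Euc k)) (G : Euc k → Euc k → ℝ) (d : ℕ) (a : ℝ) : Prop :=
  0 < a ∧ ∀ φ : L2 D d,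
    a * ∫ x in D, ‖∫ y in D, G x y • φ y‖ ^ 2 ≤ ∫ x in D, ⟪∫ y in D, G x y • φ y, φ x⟫

/-! ### Assumptions on the nonlinearity -/

/-- `F : L²(D; ℝᵈ) → L²(D; ℝᵈ)` is the Nemytskii operator `F(v)(y) = f(v(y))`. -/
def IsNemytskii {k d : ℕ} (D : Set (Euc k)) (f : Euc d → Euc d) (F : L2 D d → L2 D d) : Prop :=
  ∀ v : L2 D d, ∀ᵐ y ∂(volume.restrict D), F v y = f (v y)

/-- A (nonlinear) operator is bounded if it maps bounded sets to bounded sets. -/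
def IsBoundedOperator {k d : ℕ} {D : Set (Euc k)} (F : L2 D d → L2 D d) : Prop :=
  ∀ s : Set (L2 D d), Bornology.IsBounded s → Bornology.IsBounded (F '' s)

/-- Condition (C): `F` is continuous in norm, and bounded. -/
def CondC {k d : ℕ} {D : Set (Euc k)} (F : L2 D d → L2 D d) : Prop :=
  Continuous F ∧ IsBoundedOperator F

/-- The monotonicity condition with constant `L`: `F = F₁ + F₂` with `F₁`, `F₂` the Nemytskii
operators of functions `f₁`, `f₂`, `F₁` bounded and monotone, and `F₂` Lipschitz in the pointwise
sense with constant `L`. -/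
def CondMbar {k d : ℕ} (D : Set (Euc k)) (F : L2 D d → L2 D d) (L : ℝ) : Prop :=
  0 < L ∧ ∃ (f₁ f₂ : Euc d → Euc d) (F₁ F₂ : L2 D d → L2 D d),
    IsNemytskii D f₁ F₁ ∧ IsNemytskii D f₂ F₂ ∧
    (∀ v, F v = F₁ v + F₂ v) ∧
    IsBoundedOperator F₁ ∧
    (∀ v w : L2 D d, 0 ≤ ⟪v - w, F₁ v - F₁ w⟫) ∧
    ∀ v : L2 D d, ∀ᵐ z₁ ∂(volume.restrict D), ∀ᵐ z₂ ∂(volume.restrict D),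
      ‖F₂ v z₁ - F₂ v z₂‖ ≤ L * ‖v z₁ - v z₂‖

/-! ### White noise and mild solutions -/

/-- A `d`-dimensional white noise on `ℝᵏ`: a centred Gaussian family `W^j(φ)`, `φ ∈ L²(ℝᵏ)`,
`1 ≤ j ≤ d`, with `E[W^i(φ) W^j(ψ)] = δ_{ij} ⟨φ, ψ⟩`. -/
structure IsWhiteNoise {Ω : Type*} [MeasurableSpace Ω] (P : Measure Ω) (k d : ℕ)
    (W : Fin d → Lp ℝ 2 (volume : Measure (Euc k)) → Ω → ℝ) : Prop where
  gaussian : IsGaussianProcess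
    (fun q : Fin d × Lp ℝ 2 (volume : Measure (Euc k)) => W q.1 q.2) P
  centred : ∀ j φ, ∫ ω, W j φ ω ∂P = 0
  covariance : ∀ i j φ ψ, ∫ ω, W i φ ω * W j ψ ω ∂P = if i = j then ⟪φ, ψ⟫ else 0

open Classical in
/-- The Wiener integral `∫_D h(y) W(dy) = W(1_D h)` of a function that is square integrable
on `D`. -/
def wienerIntegral {Ω : Type*} {k : ℕ} (W : Lp ℝ 2 (volume : Measure (Euc k)) → Ω → ℝ)
    (D : Set (Euc k)) (h : Euc k → ℝ) : Ω → ℝ :=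
  if hh : MemLp (D.indicator h) 2 (volume : Measure (Euc k)) then W (hh.toLp _) else 0

/-- `u` is a mild solution, with sample paths in the space of continuous functions on `closure D`
that vanish on the boundary, of
`-Δ uⁱ + fⁱ(u) = gⁱ + ∑ⱼ σᵢⱼ Ẇʲ` in `D`, `u = 0` on the boundary. -/
structure IsMildSolution {Ω : Type*} [MeasurableSpace Ω] (P : Measure Ω) {k d : ℕ}
    (D : Set (Euc k)) (G : Euc k → Euc k → ℝ) (f : Euc d → Euc d) (g : Euc k → Euc d)
    (σ : Matrix (Fin d) (Fin d) ℝ) (W : Fin d → Lp ℝ 2 (volume : Measure (Euc k)) → Ω → ℝ)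
    (u : Euc k → Ω → Euc d) : Prop where
  measurable : ∀ x ∈ D, Measurable (u x)
  paths : ∀ᵐ ω ∂P, ContinuousOn (fun x => u x ω) (closure D) ∧ ∀ x ∈ frontier D, u x ω = 0
  equation : ∀ x ∈ D, ∀ᵐ ω ∂P, ∀ i : Fin d,
    u x ω i + ∫ y in D, G x y * f (u y ω) i =
      (∫ y in D, G x y * g y i) + ∑ j, σ i j * wienerIntegral (W j) D (G x) ω

/-! ### Hölder exponents -/

/-- The exponent `ξ`: `1` for `k = 1`, `1 - γ` for `k = 2`, `1/2` for `k = 3`. -/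
def momentExponent (k : ℕ) (γ : ℝ) : ℝ := if k = 1 then 1 else if k = 2 then 1 - γ else 1 / 2

/-- The bound for the Hölder exponents of the paths: `1` for `k = 1, 2`, `1/2` for `k = 3`. -/
def pathExponent (k : ℕ) : ℝ := if k = 3 then 1 / 2 else 1

end EllipticSPDE

end

/-! Subtracting the mild equation at two points writes u(x₁) - u(x₂) as three terms: the
convolutions of f(u) and of g with G(x₁,·) - G(x₂,·), and the Wiener integral of that same
difference. Cauchy–Schwarz bounds the first two by ‖G(x₁,·) - G(x₂,·)‖ times ‖f(u)‖ and ‖g‖. The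
third is Gaussian, so each of its moment norms is at most a constant times ‖G(x₁,·) - G(x₂,·)‖. The
moment bound thus rests on two facts.

First, ‖G(x₁,·) - G(x₂,·)‖ ≤ C|x₁ - x₂|^ξ on A. On the interval G is Lipschitz in x uniformly in y.
For k = 2, 3 write G = Γ - h. The singular part is handled by integrating pointwise bounds for (Γ(a)
- Γ(b))². The harmonic part, after subtracting a lower bound of Γ, is nonnegative and harmonic in x,
so a Harnack-type argument from the mean value property makes it Lipschitz on the ball with constant
proportional to its value at the centre c; that value is square integrable in the pole because Γ and
G are (`greenFunction_holder`).

Second, ‖f(u)‖ has moments of all orders (`IsGoodVersion.exists_dominating`). A bounded Nemytskii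
operator on L² comes from a function of linear growth. With z = u + Gf(u), the Poincaré-type
inequality gives a‖z - u‖² ≤ ⟨z - u, F(u)⟩, while monotonicity up to L gives -L‖z - u‖² ≤ ⟨z - u,
F(z) - F(u)⟩; their sum yields (a - L)‖z - u‖ ≤ ‖F(z)‖. Hence ‖F(u)‖ ≤ B(1 + ‖z‖)
(`exists_apriori_bound`), and z = Gg + noise has moments bounded uniformly in x.

Path regularity follows from the moments by an argument of Garsia–Rodemich–Rumsey type
(`exists_holder_of_lintegral`): Fubini makes the double integral of |u(a) - u(b)|^p / |a - b|^(pξ)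
almost surely finite, and a continuous function for which it is finite is Hölder of order ξ - 2k/p.
Then p tends to infinity and γ to 0. -/

noncomputable section

namespace EllipticSPDE

/-! ### The mean value property and the maximum principle -/

/-- The radial weight `(1 - |y|²)₊` used in the mean value property. -/
def bump {k : ℕ} (y : Euc k) : ℝ := max 0 (1 - ‖y‖ ^ 2)

lemma bump_nonneg {k : ℕ} (y : Euc k) : 0 ≤ bump y := le_max_left _ _

lemma continuous_bump {k : ℕ} : Continuous (bump (k := k)) := by
  unfold bump; fun_prop

lemma bump_eq_zero {k : ℕ} {y : Euc k} (hy : 1 ≤ ‖y‖) : bump y = 0 := by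
  unfold bump; rw [max_eq_left]; nlinarith

lemma bump_pos {k : ℕ} {y : Euc k} (hy : ‖y‖ < 1) : 0 < bump y :=
  lt_max_of_lt_right (by nlinarith [norm_nonneg y])

/-- Squaring removes the kink of the positive part at 0, so the square of `bump` is differentiable
everywhere and can be integrated by parts over the whole space with no boundary term. -/
lemma hasDerivAt_max_zero_sq (s : ℝ) : HasDerivAt (fun s : ℝ => (max 0 s) ^ 2) (2 * max 0 s) s := by
  rcases lt_trichotomy s 0 with hs | hs | hs
  · rw [max_eq_left hs.le, mul_zero]
    refine (hasDerivAt_const s (0 : ℝ)).congr_of_eventuallyEq ?_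
    filter_upwards [Iio_mem_nhds hs] with x hx
    simp [max_eq_left (le_of_lt (mem_Iio.mp hx))]
  · subst hs
    rw [max_self, mul_zero, hasDerivAt_iff_isLittleO]
    simp only [sub_zero, max_self, smul_zero]
    have h1 : (fun x : ℝ => max 0 x ^ 2 - 0 ^ 2) =O[nhds 0] fun x : ℝ => x ^ 2 := by
      refine Asymptotics.IsBigO.of_bound 1 (Filter.Eventually.of_forall fun x => ?_)
      rcases le_total x 0 with hx | hx
      · simp [max_eq_left hx, sq_nonneg]
      · simp [max_eq_right hx]
    refine h1.trans_isLittleO ?_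
    exact Asymptotics.isLittleO_pow_id one_lt_two
  · rw [max_eq_right hs.le]
    have := (hasDerivAt_pow 2 s)
    simp only [Nat.cast_ofNat, Nat.add_one_sub_one, pow_one] at this
    refine this.congr_of_eventuallyEq ?_
    filter_upwards [Ioi_mem_nhds hs] with x hx
    simp [max_eq_right (le_of_lt (mem_Ioi.mp hx))]

/-- This identity is the reason for the choice of weight: the field bump(y)·y is -1/4 times the
gradient of a compactly supported function, so a radial derivative weighted by `bump` turns into an
integral of the Laplacian. -/
lemma hasFDerivAt_bump_sq {k : ℕ} (y : Euc k) :
    HasFDerivAt (fun y : Euc k => bump y ^ 2) (-(4 * bump y) • innerSL ℝ y) y := by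
  have h1 : HasFDerivAt (fun y : Euc k => 1 - ‖y‖ ^ 2) (-(2 • innerSL ℝ y)) y := by
    simpa using ((hasFDerivAt_id y).norm_sq).const_sub 1
  have h2 := (hasDerivAt_max_zero_sq (1 - ‖y‖ ^ 2)).comp_hasFDerivAt y h1
  refine h2.congr_fderiv ?_
  ext v
  simp only [bump, smul_apply, neg_apply, smul_eq_mul,
    nsmul_eq_mul, Nat.cast_ofNat]
  ring

lemma integrable_mul_bump {k : ℕ} {g : Euc k → ℝ} (hg : ContinuousOn g (closedBall 0 1)) :
    Integrable (fun y => g y * bump y) := by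
  have h1 : IntegrableOn (fun y => g y * bump y) (closedBall (0 : Euc k) 1) :=
    (hg.mul continuous_bump.continuousOn).integrableOn_compact (isCompact_closedBall _ _)
  rwa [integrableOn_iff_integrable_of_support_subset] at h1
  intro y hy
  by_contra hy'
  refine hy ?_
  simp only [mem_closedBall, dist_zero_right, not_le] at hy'
  simp [bump_eq_zero hy'.le]

lemma integral_bump_pos (k : ℕ) : 0 < ∫ y : Euc k, bump y := by
  have hi : Integrable (bump (k := k)) := by
    simpa using integrable_mul_bump (k := k) (g := fun _ => 1) continuousOn_const
  refine (integral_pos_iff_support_of_nonneg bump_nonneg hi).2 ?_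
  refine lt_of_lt_of_le (measure_ball_pos volume (0 : Euc k) one_pos) (measure_mono ?_)
  intro y hy
  exact (bump_pos (by simpa using hy)).ne'

lemma add_smul_mem_closedBall {k : ℕ} {x y : Euc k} {R t : ℝ} (ht : |t| ≤ R) (hy : ‖y‖ ≤ 1) :
    x + t • y ∈ closedBall x R := by
  rw [mem_closedBall, dist_eq_norm, add_sub_cancel_left, norm_smul, Real.norm_eq_abs]
  calc |t| * ‖y‖ ≤ |t| * 1 := by gcongr
    _ ≤ R := by simpa using ht

lemma tsupport_bump_sq {k : ℕ} {y : Euc k} (hy : y ∈ tsupport (fun y : Euc k => bump y ^ 2)) :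
    ‖y‖ ≤ 1 := by
  have : tsupport (fun y : Euc k => bump y ^ 2) ⊆ closedBall 0 1 := by
    refine closure_minimal ?_ isClosed_closedBall
    intro y hy
    by_contra hy'
    simp only [mem_closedBall, dist_zero_right, not_le] at hy'
    exact hy (by simp [bump_eq_zero hy'.le])
  simpa using this hy

/-- The derivative of the weighted average of a harmonic function over a ball with respect to the
radius vanishes. -/
lemma integral_fderiv_radial_eq_zero {k : ℕ} {h : Euc k → ℝ} {x : Euc k} {R t : ℝ}
    (hh : HarmonicOnNhd h (closedBall x R)) (ht : |t| ≤ R) :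
    ∫ y, fderiv ℝ h (x + t • y) y * bump y = 0 := by
  set e := EuclideanSpace.basisFun (Fin k) ℝ with he
  have hmem : ∀ y : Euc k, ‖y‖ ≤ 1 → HarmonicAt h (x + t • y) := fun y hy =>
    hh _ (add_smul_mem_closedBall ht hy)
  have hD : ∀ y : Euc k, ‖y‖ ≤ 1 → ContDiffAt ℝ 1 (fderiv ℝ h) (x + t • y) := fun y hy =>
    (hmem y hy).1.fderiv_right (by norm_num)
  have hlin : ∀ y : Euc k, HasFDerivAt (fun y : Euc k => x + t • y)
      (t • ContinuousLinearMap.id ℝ (Euc k)) y := fun y =>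
    ((hasFDerivAt_id y).const_smul t).const_add x
  have hg : ∀ i, ∀ y : Euc k, ‖y‖ ≤ 1 →
      ContDiffAt ℝ 1 (fun y => fderiv ℝ h (x + t • y) (e i)) y := by
    intro i y hy
    have h1 : ContDiffAt ℝ 1 (fun y : Euc k => fderiv ℝ h (x + t • y)) y :=
      (hD y hy).comp y (by fun_prop)
    exact h1.clm_apply contDiffAt_const
  have hg' : ∀ i, ∀ y : Euc k, ‖y‖ ≤ 1 →
      fderiv ℝ (fun y => fderiv ℝ h (x + t • y) (e i)) y (e i)
        = t * iteratedFDeriv ℝ 2 h (x + t • y) ![e i, e i] := by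
    intro i y hy
    have h1 : HasFDerivAt (fun y : Euc k => fderiv ℝ h (x + t • y))
        ((fderiv ℝ (fderiv ℝ h) (x + t • y)).comp (t • ContinuousLinearMap.id ℝ (Euc k))) y :=
      HasFDerivAt.comp y ((hD y hy).differentiableAt one_ne_zero).hasFDerivAt (hlin y)
    rw [(h1.clm_apply (hasFDerivAt_const (e i) y)).fderiv, iteratedFDeriv_two_apply]
    simp
  have hgc : ∀ i, ContinuousOn (fun y => fderiv ℝ h (x + t • y) (e i)) (closedBall 0 1) :=
    fun i y hy => (hg i y (by simpa using hy)).continuousAt.continuousWithinAt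
  have hgc' : ∀ i, ContinuousOn (fun y => fderiv ℝ (fun y => fderiv ℝ h (x + t • y) (e i)) y (e i))
      (closedBall 0 1) := by
    intro i y hy
    have := (hg i y (by simpa using hy)).fderiv_right (m := 0) (by norm_num)
    exact (this.continuousAt.clm_apply continuousAt_const).continuousWithinAt
  have hinner : ∀ (i : Fin k) (y : Euc k), ⟪y, e i⟫ = y i := by
    intro i y
    rw [real_inner_comm, ← e.repr_apply_apply]; simp [he]
  -- Integration by parts in the i-th direction, with ∂ᵢ(bump²) = -4·bump·yᵢ.
  have hibp : ∀ i, ∫ y : Euc k, bump y ^ 2 * fderiv ℝ (fun y => fderiv ℝ h (x + t • y) (e i)) y (e i)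
      = 4 * ∫ y : Euc k, (y i * fderiv ℝ h (x + t • y) (e i)) * bump y := by
    intro i
    have hfd : ∀ y : Euc k, fderiv ℝ (fun y : Euc k => bump y ^ 2) y (e i) = -(4 * bump y) * y i := by
      intro y
      rw [(hasFDerivAt_bump_sq y).fderiv]
      simp [hinner]
    rw [integral_mul_fderiv_eq_neg_fderiv_mul_of_integrable]
    · simp_rw [hfd]
      rw [← integral_neg, ← integral_const_mul]
      congr 1; ext y; ring
    · simp_rw [hfd]
      have := integrable_mul_bump (k := k)
        (g := fun y => -4 * (y i * fderiv ℝ h (x + t • y) (e i))) ?_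
      · refine this.congr (Filter.Eventually.of_forall fun y => ?_)
        simp only; ring
      · exact continuousOn_const.mul ((by fun_prop : Continuous fun y : Euc k => y i).continuousOn.mul
          (hgc i))
    · have := integrable_mul_bump (k := k)
        (g := fun y => bump y * fderiv ℝ (fun y => fderiv ℝ h (x + t • y) (e i)) y (e i)) ?_
      · refine this.congr (Filter.Eventually.of_forall fun y => ?_)
        simp only; ring
      · exact continuous_bump.continuousOn.mul (hgc' i)
    · have := integrable_mul_bump (k := k)
        (g := fun y => bump y * fderiv ℝ h (x + t • y) (e i)) ?_
      · refine this.congr (Filter.Eventually.of_forall fun y => ?_)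
        simp only; ring
      · exact continuous_bump.continuousOn.mul (hgc i)
    · intro y _
      exact (hasFDerivAt_bump_sq y).differentiableAt
    · intro y hy
      exact (hg i y (tsupport_bump_sq hy)).differentiableAt one_ne_zero
  have hsum : ∀ y : Euc k, fderiv ℝ h (x + t • y) y * bump y
      = ∑ i, (y i * fderiv ℝ h (x + t • y) (e i)) * bump y := by
    intro y
    rw [← Finset.sum_mul]
    congr 1
    conv_lhs => rw [← e.sum_repr y]
    simp only [map_sum, map_smul, smul_eq_mul]
    rw [e.sum_repr y]
    simp [he]
  have hint : ∀ i, Integrable (fun y : Euc k => (y i * fderiv ℝ h (x + t • y) (e i)) * bump y) :=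
    fun i => integrable_mul_bump ((by fun_prop : Continuous fun y : Euc k => y i).continuousOn.mul
          (hgc i))
  have hint' : ∀ i, Integrable (fun y : Euc k =>
      bump y ^ 2 * fderiv ℝ (fun y => fderiv ℝ h (x + t • y) (e i)) y (e i)) := by
    intro i
    have := integrable_mul_bump (k := k)
      (g := fun y => bump y * fderiv ℝ (fun y => fderiv ℝ h (x + t • y) (e i)) y (e i)) ?_
    · refine this.congr (Filter.Eventually.of_forall fun y => ?_)
      simp only; ring
    · exact continuous_bump.continuousOn.mul (hgc' i)
  simp_rw [hsum]
  rw [integral_finsetSum _ fun i _ => hint i]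
  -- Summed over i, the left sides of `hibp` become t times the integral of bump² against the
  -- Laplacian of h at x + t·y, which is zero.
  have : (4 : ℝ) * ∑ i, ∫ y : Euc k, (y i * fderiv ℝ h (x + t • y) (e i)) * bump y = 0 := by
    rw [Finset.mul_sum]
    simp_rw [← hibp]
    rw [← integral_finsetSum _ fun i _ => hint' i]
    refine integral_eq_zero_of_ae (Filter.Eventually.of_forall fun y => ?_)
    simp only [Pi.zero_apply]
    rcases le_or_gt ‖y‖ 1 with hy | hy
    · simp_rw [hg' _ y hy]
      rw [← Finset.mul_sum, ← Finset.mul_sum]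
      have := (hmem y hy).2.self_of_nhds
      rw [laplacian_eq_iteratedFDeriv_orthonormalBasis h e] at this
      simp only [Pi.zero_apply] at this
      rw [this]; simp
    · simp [bump_eq_zero hy.le]
  linarith

/-- The mean value property for the weight `bump`. -/
lemma mean_value_bump {k : ℕ} {h : Euc k → ℝ} {x : Euc k} {R t : ℝ}
    (hh : HarmonicOnNhd h (closedBall x R)) (ht0 : 0 ≤ t) (ht : t < R) :
    ∫ y, h (x + t • y) * bump y = h x * ∫ y : Euc k, bump y := by
  have hmem : ∀ s : ℝ, |s| ≤ R → ∀ y : Euc k, ‖y‖ ≤ 1 → HarmonicAt h (x + s • y) :=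
    fun s hs y hy => hh _ (add_smul_mem_closedBall hs hy)
  have hD : ContinuousOn (fderiv ℝ h) (closedBall x R) := fun z hz =>
    ((hh z hz).1.fderiv_right (m := 1) (by norm_num)).continuousAt.continuousWithinAt
  obtain ⟨C, hC⟩ := (isCompact_closedBall x R).exists_bound_of_continuousOn hD
  have hcont : ∀ s : ℝ, |s| ≤ R → ContinuousOn (fun y => h (x + s • y)) (closedBall 0 1) := by
    intro s hs y hy
    have h1 : ContinuousAt h (x + s • y) := (hmem s hs y (by simpa using hy)).1.continuousAt
    exact (ContinuousAt.comp (f := fun y : Euc k => x + s • y) h1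
      (by fun_prop)).continuousWithinAt
  have hder : ∀ s : ℝ, |s| < R → HasDerivAt (fun s => ∫ y, h (x + s • y) * bump y) 0 s := by
    intro s hs
    have hab : ∀ r ∈ Ioo (-R) R, |r| ≤ R := fun r hr => abs_le.2 ⟨hr.1.le, hr.2.le⟩
    have hsI : Ioo (-R) R ∈ nhds s := Ioo_mem_nhds (abs_lt.1 hs).1 (abs_lt.1 hs).2
    rw [← integral_fderiv_radial_eq_zero hh hs.le]
    refine (hasDerivAt_integral_of_dominated_loc_of_deriv_le (bound := fun y => C * bump y)
      (F' := fun s y => fderiv ℝ h (x + s • y) y * bump y) hsI ?_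
      (integrable_mul_bump (hcont s hs.le)) ?_ ?_ ?_ ?_).2
    · filter_upwards [hsI] with r hr
      exact (integrable_mul_bump (hcont r (hab r hr))).aestronglyMeasurable
    · refine (integrable_mul_bump ?_).aestronglyMeasurable
      refine ContinuousOn.clm_apply (hD.comp (by fun_prop) ?_) continuousOn_id
      intro y hy
      exact add_smul_mem_closedBall hs.le (by simpa using hy)
    · refine Filter.Eventually.of_forall fun y r hr => ?_
      rcases le_or_gt ‖y‖ 1 with hy | hy
      · rw [norm_mul, Real.norm_of_nonneg (bump_nonneg y)]
        refine mul_le_mul_of_nonneg_right ?_ (bump_nonneg y)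
        have hc := hC _ (add_smul_mem_closedBall (x := x) (hab r hr) hy)
        calc ‖fderiv ℝ h (x + r • y) y‖ ≤ ‖fderiv ℝ h (x + r • y)‖ * ‖y‖ :=
              ContinuousLinearMap.le_opNorm _ _
          _ ≤ C * 1 := mul_le_mul hc hy (norm_nonneg _) ((norm_nonneg _).trans hc)
          _ = C := mul_one C
      · simp [bump_eq_zero hy.le]
    · exact integrable_mul_bump continuousOn_const
    · refine Filter.Eventually.of_forall fun y r hr => ?_
      rcases le_or_gt ‖y‖ 1 with hy | hy
      · have h1 : HasFDerivAt h (fderiv ℝ h (x + r • y)) (x + r • y) :=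
          ((hmem r (hab r hr) y hy).1.differentiableAt two_ne_zero).hasFDerivAt
        have h2 : HasDerivAt (fun r : ℝ => x + r • y) y r := by
          simpa using ((hasDerivAt_id r).smul_const y).const_add x
        exact (h1.comp_hasDerivAt r h2).mul_const _
      · simpa [bump_eq_zero hy.le] using hasDerivAt_const r (0 : ℝ)
  -- The weighted average is constant in the radius, and at radius 0 it is h(x) times the mass of
  -- the weight.
  have hconst := constant_of_has_deriv_right_zero
    (f := fun s => ∫ y, h (x + s • y) * bump y) (a := 0) (b := t)
    (fun s hs => (hder s (abs_lt.2 ⟨by linarith [hs.1], by linarith [hs.2]⟩)).continuousAt.continuousWithinAt)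
    (fun s hs => (hder s (abs_lt.2 ⟨by linarith [hs.1], by linarith [hs.2]⟩)).hasDerivWithinAt)
    t ⟨ht0, le_rfl⟩
  simp only [zero_smul, add_zero] at hconst
  rw [hconst, integral_const_mul]

/-- The weak maximum principle. -/
lemma le_of_le_on_frontier {k : ℕ} (hk : 0 < k) {D : Set (Euc k)} (hD : IsOpen D)
    (hb : Bornology.IsBounded D) {h : Euc k → ℝ} (hh : HarmonicOnNhd h D)
    (hc : ContinuousOn h (closure D)) {M : ℝ} (hM : ∀ z ∈ frontier D, h z ≤ M) :
    ∀ x ∈ D, h x ≤ M := by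
  intro x hx
  have hcomp : IsCompact (closure D) := hb.isCompact_closure
  obtain ⟨xm, hxm, hmax⟩ := hcomp.exists_isMaxOn ⟨x, subset_closure hx⟩ hc
  have hSc : IsCompact (closure D ∩ h ⁻¹' {h xm}) :=
    hcomp.of_isClosed_subset (hc.preimage_isClosed_of_isClosed isClosed_closure isClosed_singleton)
      inter_subset_left
  -- Among the maximum points in the closure, take one of largest norm. If it were interior, the
  -- mean value property would make h maximal on a whole ball around it, and that ball contains
  -- points of larger norm. No connectedness is needed.
  obtain ⟨x₀, hx₀, hnorm⟩ := hSc.exists_isMaxOn ⟨xm, hxm, rfl⟩ continuous_norm.continuousOn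
  have hx₀m : h x₀ = h xm := hx₀.2
  have hle : h x ≤ h x₀ := hx₀m ▸ hmax (subset_closure hx)
  refine hle.trans ?_
  by_cases hfr : x₀ ∈ D
  swap
  · exact hM x₀ ⟨hx₀.1, by rwa [hD.interior_eq]⟩
  exfalso
  obtain ⟨R, hR, hball⟩ := Metric.nhds_basis_closedBall.mem_iff.1 (hD.mem_nhds hfr)
  set t := R / 2 with htdef
  have ht : 0 < t := by positivity
  have htR : t < R := by linarith
  have hmv := mean_value_bump (hh.mono hball) ht.le htR
  have hmv1 := mean_value_bump (h := fun _ : Euc k => h x₀) (x := x₀) (R := R)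
    (harmonicOnNhd_const _) ht.le htR
  have hab : |t| ≤ R := by rw [abs_of_pos ht]; exact htR.le
  have hcont : ContinuousOn (fun y => h (x₀ + t • y)) (closedBall 0 1) := by
    refine (hc.mono (hball.trans subset_closure)).comp (by fun_prop) ?_
    intro y hy
    exact add_smul_mem_closedBall hab (by simpa using hy)
  have hzero : ∫ y, (h x₀ - h (x₀ + t • y)) * bump y = 0 := by
    simp_rw [sub_mul]
    rw [integral_sub (integrable_mul_bump continuousOn_const) (integrable_mul_bump hcont), hmv, hmv1,
      sub_self]
  have hnn : 0 ≤ fun y => (h x₀ - h (x₀ + t • y)) * bump y := by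
    intro y
    rcases le_or_gt ‖y‖ 1 with hy | hy
    · refine mul_nonneg (sub_nonneg.2 ?_) (bump_nonneg y)
      rw [hx₀m]
      exact hmax (subset_closure (hball (add_smul_mem_closedBall hab hy)))
    · simp [bump_eq_zero hy.le]
  rw [integral_eq_zero_iff_of_nonneg hnn
    (integrable_mul_bump (continuousOn_const.sub hcont))] at hzero
  -- The integrand vanishes almost everywhere, hence on a dense set; this set meets the nonempty
  -- open set of directions y that increase the norm.
  have hdense := Measure.dense_of_ae hzero
  have hopen : IsOpen {y : Euc k | ‖y‖ < 1 ∧ ‖x₀‖ < ‖x₀ + t • y‖} :=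
    (isOpen_lt continuous_norm continuous_const).and
      (isOpen_lt continuous_const (by fun_prop))
  have hne : {y : Euc k | ‖y‖ < 1 ∧ ‖x₀‖ < ‖x₀ + t • y‖}.Nonempty := by
    by_cases h0 : x₀ = 0
    · refine ⟨(1 / 2 : ℝ) • EuclideanSpace.single (⟨0, hk⟩ : Fin k) (1 : ℝ), ?_, ?_⟩
      · rw [norm_smul]; simp; norm_num
      · rw [h0, norm_zero, zero_add, norm_pos_iff]
        simp [ht.ne']
    · have hn : 0 < ‖x₀‖ := norm_pos_iff.2 h0
      refine ⟨(1 / 2 * ‖x₀‖⁻¹ : ℝ) • x₀, ?_, ?_⟩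
      · rw [norm_smul, Real.norm_of_nonneg (by positivity), mul_assoc, inv_mul_cancel₀ hn.ne']
        norm_num
      · have : x₀ + t • (1 / 2 * ‖x₀‖⁻¹ : ℝ) • x₀ = (1 + t * (1 / 2 * ‖x₀‖⁻¹)) • x₀ := by
          rw [smul_smul, add_smul, one_smul]
        rw [this, norm_smul, Real.norm_of_nonneg (by positivity)]
        have : 0 < t * (1 / 2 * ‖x₀‖⁻¹) := by positivity
        nlinarith
  obtain ⟨y, hy, hyz⟩ := hdense.inter_open_nonempty _ hopen hne
  have hyz' : (h x₀ - h (x₀ + t • y)) * bump y = 0 := hyz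
  have heq : h (x₀ + t • y) = h xm := by
    have := (mul_eq_zero.1 hyz').resolve_right (bump_pos hy.1).ne'
    linarith
  have := hnorm (a := x₀ + t • y)
    ⟨subset_closure (hball (add_smul_mem_closedBall hab hy.1.le)), heq⟩
  exact absurd hy.2 (not_lt.2 this)

/-! ### Interior Lipschitz estimate for nonnegative harmonic functions -/

/-- The substitution z = x + t·y puts averages around different centres and with different radii
over the same variable, so that their weights can be compared pointwise. -/
lemma mean_value_bump_scaled {k : ℕ} {h : Euc k → ℝ} {x : Euc k} {R t : ℝ}
    (hh : HarmonicOnNhd h (closedBall x R)) (ht0 : 0 < t) (ht : t < R) :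
    Integrable (fun z => h z * bump (t⁻¹ • (z - x))) ∧
    ∫ z, h z * bump (t⁻¹ • (z - x)) = t ^ k * (h x * ∫ y : Euc k, bump y) := by
  have hfun : (fun z => h z * bump (t⁻¹ • (z - x))) =
      fun z => (fun y => h (x + t • y) * bump y) (t⁻¹ • (z - x)) := by
    ext z; simp [smul_smul, ht0.ne']
  have hcont : ContinuousOn (fun y => h (x + t • y)) (closedBall 0 1) := by
    refine hh.continuousOn.comp (by fun_prop) ?_
    intro y hy
    exact add_smul_mem_closedBall (by rw [abs_of_pos ht0]; exact ht.le) (by simpa using hy)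
  constructor
  · rw [hfun]
    exact ((integrable_mul_bump hcont).comp_smul (inv_ne_zero ht0.ne')).comp_sub_right x
  · rw [hfun, integral_sub_right_eq_self
      (fun z => (fun y => h (x + t • y) * bump y) (t⁻¹ • z)) x,
      Measure.integral_comp_smul volume (fun y => h (x + t • y) * bump y),
      mean_value_bump hh ht0.le ht, finrank_euclideanSpace_fin, inv_pow, inv_inv,
      abs_of_pos (pow_pos ht0 k), smul_eq_mul]

lemma abs_bump_sub_le {k : ℕ} (a b : Euc k) : |bump a - bump b| ≤ 2 * ‖a - b‖ := by
  have key : ∀ y : Euc k, bump y = 1 - (min ‖y‖ 1) ^ 2 := by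
    intro y
    rcases le_total ‖y‖ 1 with hy | hy
    · rw [bump, min_eq_left hy, max_eq_right]
      nlinarith [norm_nonneg y]
    · rw [bump_eq_zero hy, min_eq_right hy]; norm_num
  have h1 : |min ‖a‖ 1 - min ‖b‖ 1| ≤ ‖a - b‖ := by
    refine (abs_min_sub_min_le_max ‖a‖ 1 ‖b‖ 1).trans ?_
    simpa using abs_norm_sub_norm_le a b
  have ha0 : 0 ≤ min ‖a‖ 1 := le_min (norm_nonneg _) zero_le_one
  have hb0 : 0 ≤ min ‖b‖ 1 := le_min (norm_nonneg _) zero_le_one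
  have ha1 : min ‖a‖ 1 ≤ 1 := min_le_right _ _
  have hb1 : min ‖b‖ 1 ≤ 1 := min_le_right _ _
  rw [key a, key b]
  have h2 : (1 - min ‖a‖ 1 ^ 2) - (1 - min ‖b‖ 1 ^ 2)
      = -(min ‖a‖ 1 - min ‖b‖ 1) * (min ‖a‖ 1 + min ‖b‖ 1) := by ring
  rw [h2, abs_mul, abs_neg, abs_of_nonneg (add_nonneg ha0 hb0)]
  nlinarith [abs_nonneg (min ‖a‖ 1 - min ‖b‖ 1)]

/-- A nonnegative harmonic function is Lipschitz on smaller balls, with a constant proportional to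
its value at the centre. -/
lemma exists_lipschitz_of_nonneg_harmonic {k : ℕ} (c : Euc k) {r ρ : ℝ} (hr : 0 < r)
    (hρ : 0 < ρ) : ∃ C : ℝ, 0 ≤ C ∧ ∀ h : Euc k → ℝ, HarmonicOnNhd h (closedBall c (r + 3 * ρ)) →
      (∀ z ∈ closedBall c (r + 3 * ρ), 0 ≤ h z) → ∀ x₁ ∈ ball c r, ∀ x₂ ∈ ball c r,
      |h x₁ - h x₂| ≤ C * ‖x₁ - x₂‖ * h c := by
  -- The weights of radius ρ centred in B(c, r) are supported in the closed ball of radius r + ρ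
  -- around c. There the weight of the larger radius T centred at c is at least κ > 0.
  set T := r + 2 * ρ with hT
  have hTpos : 0 < T := by positivity
  set κ := 1 - ((r + ρ) / T) ^ 2 with hκ
  have hκpos : 0 < κ := by
    have h1 : (r + ρ) / T < 1 := (div_lt_one hTpos).2 (by linarith)
    have h2 : 0 ≤ (r + ρ) / T := by positivity
    rw [hκ]; nlinarith
  refine ⟨2 / ρ / κ * T ^ k / ρ ^ k, by positivity, fun h hh hnn x₁ hx₁ x₂ hx₂ => ?_⟩
  have hsub : ∀ x ∈ ball c r, closedBall x (2 * ρ) ⊆ closedBall c (r + 3 * ρ) := by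
    intro x hx
    refine closedBall_subset_closedBall' ?_
    have := mem_ball.1 hx
    linarith
  obtain ⟨i1, e1⟩ := mean_value_bump_scaled (hh.mono (hsub x₁ hx₁)) hρ (by linarith : ρ < 2 * ρ)
  obtain ⟨i2, e2⟩ := mean_value_bump_scaled (hh.mono (hsub x₂ hx₂)) hρ (by linarith : ρ < 2 * ρ)
  obtain ⟨i3, e3⟩ := mean_value_bump_scaled hh hTpos (by linarith : T < r + 3 * ρ)
  have hIpos := integral_bump_pos k
  set I := ∫ y : Euc k, bump y
  have hout : ∀ x ∈ ball c r, ∀ z, z ∉ closedBall c (r + ρ) → bump (ρ⁻¹ • (z - x)) = 0 := by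
    intro x hx z hz
    refine bump_eq_zero ?_
    rw [norm_smul, norm_inv, Real.norm_of_nonneg hρ.le, ← div_eq_inv_mul, le_div_iff₀ hρ, one_mul]
    simp only [mem_closedBall, not_le] at hz
    have h3 := mem_ball.1 hx
    have h4 := dist_triangle z x c
    rw [dist_eq_norm z x] at h4
    linarith
  -- Since h ≥ 0, the difference of the two small weights can be dominated by the large weight at c,
  -- whose integral against h is a multiple of h(c) by the mean value property.
  have hpt : ∀ z, |h z * bump (ρ⁻¹ • (z - x₁)) - h z * bump (ρ⁻¹ • (z - x₂))| ≤
      2 / ρ * ‖x₁ - x₂‖ / κ * (h z * bump (T⁻¹ • (z - c))) := by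
    intro z
    by_cases hz : z ∈ closedBall c (r + ρ)
    · have hz0 : 0 ≤ h z := hnn z (closedBall_subset_closedBall (by linarith) hz)
      have hb : κ ≤ bump (T⁻¹ • (z - c)) := by
        refine le_trans ?_ (le_max_right _ _)
        rw [norm_smul, norm_inv, Real.norm_of_nonneg hTpos.le, ← div_eq_inv_mul, hκ]
        have : ‖z - c‖ ≤ r + ρ := by simpa [dist_eq_norm] using hz
        gcongr
      have hl := abs_bump_sub_le (ρ⁻¹ • (z - x₁)) (ρ⁻¹ • (z - x₂))
      have hl2 : ‖ρ⁻¹ • (z - x₁) - ρ⁻¹ • (z - x₂)‖ = ρ⁻¹ * ‖x₁ - x₂‖ := by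
        rw [← smul_sub, norm_smul, norm_inv, Real.norm_of_nonneg hρ.le, sub_sub_sub_cancel_left,
          norm_sub_rev]
      rw [hl2] at hl
      rw [← mul_sub, abs_mul, abs_of_nonneg hz0]
      calc h z * |bump (ρ⁻¹ • (z - x₁)) - bump (ρ⁻¹ • (z - x₂))|
          ≤ h z * (2 * (ρ⁻¹ * ‖x₁ - x₂‖)) := by gcongr
        _ = 2 / ρ * ‖x₁ - x₂‖ / κ * (h z * κ) := by field_simp
        _ ≤ _ := by gcongr
    · rw [hout x₁ hx₁ z hz, hout x₂ hx₂ z hz, mul_zero, sub_zero, abs_zero]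
      refine mul_nonneg (by positivity) ?_
      by_cases hz' : z ∈ closedBall c (r + 3 * ρ)
      · exact mul_nonneg (hnn z hz') (bump_nonneg _)
      · rw [bump_eq_zero, mul_zero]
        rw [norm_smul, norm_inv, Real.norm_of_nonneg hTpos.le, ← div_eq_inv_mul,
          le_div_iff₀ hTpos, one_mul]
        simp only [mem_closedBall, not_le, dist_eq_norm] at hz'
        linarith
  have hmain : |ρ ^ k * (h x₁ * I) - ρ ^ k * (h x₂ * I)| ≤
      2 / ρ * ‖x₁ - x₂‖ / κ * (T ^ k * (h c * I)) := by
    rw [← e1, ← e2, ← e3, ← integral_sub i1 i2, ← integral_const_mul]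
    refine (abs_integral_le_integral_abs).trans ?_
    exact integral_mono (i1.sub i2).abs (i3.const_mul _) hpt
  have heq : |ρ ^ k * (h x₁ * I) - ρ ^ k * (h x₂ * I)| = ρ ^ k * I * |h x₁ - h x₂| := by
    rw [show ρ ^ k * (h x₁ * I) - ρ ^ k * (h x₂ * I) = ρ ^ k * I * (h x₁ - h x₂) by ring, abs_mul,
      abs_of_pos (by positivity)]
  rw [heq] at hmain
  have hpos : 0 < ρ ^ k * I := by positivity
  refine le_of_mul_le_mul_left (hmain.trans (le_of_eq ?_)) hpos
  field_simp

/-! ### The harmonic part of the Green function -/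

lemma dirichletSolution_spec {k : ℕ} {D : Set (Euc k)} (hD : HasRegularBoundary D)
    {φ : Euc k → ℝ} (hφ : ContinuousOn φ (frontier D)) :
    IsDirichletSolution D φ (dirichletSolution D φ) := by
  have h := hD φ hφ
  rw [dirichletSolution, dif_pos h]
  exact h.choose_spec

lemma norm_sub_pos_of_mem_frontier {k : ℕ} {D : Set (Euc k)} (hD : IsOpen D) {y z : Euc k}
    (hy : y ∈ D) (hz : z ∈ frontier D) : 0 < ‖z - y‖ := by
  rw [norm_pos_iff, sub_ne_zero]
  rintro rfl
  rw [hD.frontier_eq] at hz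
  exact hz.2 hy

lemma continuousOn_radial_frontier {k : ℕ} {D : Set (Euc k)} (hD : IsOpen D) {Γ : ℝ → ℝ}
    (hΓ : ContinuousOn Γ (Ioi 0)) {y : Euc k} (hy : y ∈ D) :
    ContinuousOn (fun z => Γ ‖z - y‖) (frontier D) :=
  hΓ.comp (by fun_prop) fun _ hz => norm_sub_pos_of_mem_frontier hD hy hz

/-- The harmonic part `h_y(x)` of the Green function depends continuously on `y`. -/
lemma continuousOn_dirichletSolution_pole {k : ℕ} (hk : 0 < k) {D : Set (Euc k)} (hD : IsOpen D)
    (hb : Bornology.IsBounded D) (hreg : HasRegularBoundary D) {Γ : ℝ → ℝ}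
    (hΓ : ContinuousOn Γ (Ioi 0)) {x : Euc k} (hx : x ∈ D) :
    ContinuousOn (fun y => dirichletSolution D (fun z => Γ ‖z - y‖) x) D := by
  intro y₀ hy₀
  refine ContinuousAt.continuousWithinAt ?_
  rw [Metric.continuousAt_iff']
  intro ε hε
  have hcpt : IsCompact (frontier D) :=
    hb.isCompact_closure.of_isClosed_subset isClosed_frontier frontier_subset_closure
  -- Moving the pole slightly changes the boundary values uniformly, the boundary being compact and
  -- at positive distance from the pole; the maximum principle carries this bound inside.
  have hev : ∀ᶠ y in nhds y₀, ∀ z ∈ frontier D, |Γ ‖z - y‖ - Γ ‖z - y₀‖| < ε / 2 := by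
    refine hcpt.eventually_forall_of_forall_eventually fun z hz => ?_
    have hpos := norm_sub_pos_of_mem_frontier hD hy₀ hz
    have h0 : ContinuousAt Γ ‖z - y₀‖ := hΓ.continuousAt (Ioi_mem_nhds hpos)
    have hc1 : ContinuousAt (fun q : Euc k × Euc k => Γ ‖q.2 - q.1‖) (y₀, z) :=
      ContinuousAt.comp (f := fun q : Euc k × Euc k => ‖q.2 - q.1‖) h0 (by fun_prop)
    have hc2 : ContinuousAt (fun q : Euc k × Euc k => Γ ‖q.2 - y₀‖) (y₀, z) :=
      ContinuousAt.comp (f := fun q : Euc k × Euc k => ‖q.2 - y₀‖) h0 (by fun_prop)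
    have hc := (hc1.sub hc2).abs
    have : |Γ ‖z - y₀‖ - Γ ‖z - y₀‖| < ε / 2 := by simpa using hε
    exact hc.eventually_lt_const this
  filter_upwards [hev, hD.mem_nhds hy₀] with y hy hyD
  obtain ⟨h1, c1, e1⟩ := dirichletSolution_spec hreg (continuousOn_radial_frontier hD hΓ hyD)
  obtain ⟨h2, c2, e2⟩ := dirichletSolution_spec hreg (continuousOn_radial_frontier hD hΓ hy₀)
  have l1 := le_of_le_on_frontier hk hD hb (h1.sub h2) (c1.sub c2) (M := ε / 2) (fun z hz => by
    simp only [Pi.sub_apply]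
    rw [e1 hz, e2 hz]
    exact ((abs_lt.1 (hy z hz)).2).le) x hx
  have l2 := le_of_le_on_frontier hk hD hb (h2.sub h1) (c2.sub c1) (M := ε / 2) (fun z hz => by
    simp only [Pi.sub_apply]
    rw [e1 hz, e2 hz]
    linarith [(abs_lt.1 (hy z hz)).1]) x hx
  simp only [Pi.sub_apply] at l1 l2
  rw [Real.dist_eq, abs_lt]
  constructor <;> linarith

lemma le_dirichletSolution {k : ℕ} (hk : 0 < k) {D : Set (Euc k)} (hD : IsOpen D)
    (hb : Bornology.IsBounded D) (hreg : HasRegularBoundary D) {φ : Euc k → ℝ}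
    (hφ : ContinuousOn φ (frontier D)) {m : ℝ} (hm : ∀ z ∈ frontier D, m ≤ φ z) {x : Euc k}
    (hx : x ∈ D) : m ≤ dirichletSolution D φ x := by
  obtain ⟨h1, c1, e1⟩ := dirichletSolution_spec hreg hφ
  have := le_of_le_on_frontier hk hD hb h1.neg c1.neg (M := -m) (fun z hz => by
    simp only [Pi.neg_apply]
    rw [e1 hz]
    exact neg_le_neg (hm z hz)) x hx
  simp only [Pi.neg_apply] at this
  linarith

/-- If the Green function and its singular part are square integrable, then the Green function is
Hölder continuous in `L²(D)`, locally in the first variable, as soon as its singular part is. -/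
lemma greenFunction_holder {k : ℕ} (hk : 0 < k) {D : Set (Euc k)} (hD : IsOpen D)
    (hb : Bornology.IsBounded D) (hreg : HasRegularBoundary D) {Γ : ℝ → ℝ}
    (hΓ : ContinuousOn Γ (Ioi 0)) {m : ℝ} (hm : ∀ y ∈ D, ∀ z ∈ frontier D, m ≤ Γ ‖z - y‖)
    (hΓ2 : ∀ x ∈ D, MemLp (fun y => Γ ‖x - y‖) 2 (volume.restrict D))
    (hG2 : ∀ x ∈ D, eLpNorm (greenFunction Γ D x) 2 (volume.restrict D) < ∞)
    {ξ : ℝ} (hξ1 : ξ ≤ 1) {C₀ : ℝ} (hC₀ : 0 ≤ C₀)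
    (hΓH : ∀ x₁ ∈ D, ∀ x₂ ∈ D, eLpNorm (fun y => Γ ‖x₁ - y‖ - Γ ‖x₂ - y‖) 2 (volume.restrict D) ≤
      ENNReal.ofReal (C₀ * ‖x₁ - x₂‖ ^ ξ)) :
    (∀ x ∈ D, MemLp (greenFunction Γ D x) 2 (volume.restrict D)) ∧
    ∀ (c : Euc k) (r : ℝ), 0 < r → closedBall c r ⊆ D → ∃ C : ℝ, 0 ≤ C ∧
      ∀ x₁ ∈ ball c r, ∀ x₂ ∈ ball c r,
        eLpNorm (greenFunction Γ D x₁ - greenFunction Γ D x₂) 2 (volume.restrict D) ≤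
          ENNReal.ofReal (C * ‖x₁ - x₂‖ ^ ξ) := by
  set H : Euc k → Euc k → ℝ := fun x y => dirichletSolution D (fun z => Γ ‖z - y‖) x with hH
  have hGH : ∀ x, greenFunction Γ D x = fun y => Γ ‖x - y‖ - H x y := fun x => rfl
  have hHm : ∀ x ∈ D, AEStronglyMeasurable (H x) (volume.restrict D) := fun x hx =>
    (continuousOn_dirichletSolution_pole hk hD hb hreg hΓ hx).aestronglyMeasurable
      hD.measurableSet
  have hGm : ∀ x ∈ D, MemLp (greenFunction Γ D x) 2 (volume.restrict D) := fun x hx =>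
    ⟨(hΓ2 x hx).aestronglyMeasurable.sub (hHm x hx), hG2 x hx⟩
  refine ⟨hGm, fun c r hr hball => ?_⟩
  have hcD : c ∈ D := hball (mem_closedBall_self hr.le)
  -- The harmonic part is the difference Γ - G of two square integrable functions.
  have hH2 : MemLp (H c) 2 (volume.restrict D) := by
    have := (hΓ2 c hcD).sub (hGm c hcD)
    refine this.congr_norm (hHm c hcD) (Filter.Eventually.of_forall fun y => ?_)
    simp [hGH]
  have : IsFiniteMeasure (volume.restrict D) := ⟨by
    rw [Measure.restrict_apply_univ]; exact hb.measure_lt_top⟩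
  -- Subtracting the lower bound m makes the harmonic part nonnegative without changing its
  -- increments in x; the constant is square integrable because D has finite measure.
  have hH2' : MemLp (fun y => H c y - m) 2 (volume.restrict D) := hH2.sub (memLp_const m)
  obtain ⟨ρ, hρ, hsub⟩ : ∃ ρ : ℝ, 0 < ρ ∧ closedBall c (r + 3 * ρ) ⊆ D := by
    obtain ⟨δ, hδ, hδD⟩ := (isCompact_closedBall c r).exists_cthickening_subset_open hD hball
    refine ⟨δ / 3, by positivity, ?_⟩
    rw [cthickening_closedBall hδ.le hr.le] at hδD
    rwa [show r + 3 * (δ / 3) = δ + r by ring]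
  obtain ⟨CL, hCL0, hCL⟩ := exists_lipschitz_of_nonneg_harmonic c hr hρ
  have hLip : ∀ y ∈ D, ∀ x₁ ∈ ball c r, ∀ x₂ ∈ ball c r,
      |H x₁ y - H x₂ y| ≤ CL * ‖x₁ - x₂‖ * (H c y - m) := by
    intro y hy x₁ hx₁ x₂ hx₂
    have hφ := continuousOn_radial_frontier hD hΓ hy
    have hspec := dirichletSolution_spec hreg hφ
    have := hCL (fun x => H x y - m) ((hspec.1.mono hsub).sub (harmonicOnNhd_const m))
      (fun z hz => sub_nonneg.2 (le_dirichletSolution hk hD hb hreg hφ (hm y hy) (hsub hz)))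
      x₁ hx₁ x₂ hx₂
    simpa using this
  set N := (eLpNorm (fun y => H c y - m) 2 (volume.restrict D)).toReal with hN
  have hNe : eLpNorm (fun y => H c y - m) 2 (volume.restrict D) = ENNReal.ofReal N :=
    (ENNReal.ofReal_toReal hH2'.eLpNorm_ne_top).symm
  refine ⟨C₀ + CL * N * (2 * r) ^ (1 - ξ), by positivity, fun x₁ hx₁ x₂ hx₂ => ?_⟩
  have hx₁D : x₁ ∈ D := hball (ball_subset_closedBall hx₁)
  have hx₂D : x₂ ∈ D := hball (ball_subset_closedBall hx₂)
  have hdec : greenFunction Γ D x₁ - greenFunction Γ D x₂ =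
      (fun y => Γ ‖x₁ - y‖ - Γ ‖x₂ - y‖) - (fun y => H x₁ y - H x₂ y) := by
    ext y; simp only [hGH, Pi.sub_apply]; ring
  have hHpart : eLpNorm (fun y => H x₁ y - H x₂ y) 2 (volume.restrict D) ≤
      ENNReal.ofReal (CL * ‖x₁ - x₂‖ * N) := by
    rw [ENNReal.ofReal_mul (by positivity), ← hNe]
    refine eLpNorm_le_mul_eLpNorm_of_ae_le_mul ?_ 2
    filter_upwards [ae_restrict_mem hD.measurableSet] with y hy
    refine (hLip y hy x₁ hx₁ x₂ hx₂).trans ?_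
    gcongr
    exact le_abs_self _
  -- On a ball of diameter 2r a Lipschitz bound is a Hölder bound of every order ξ ≤ 1.
  have hdist : ‖x₁ - x₂‖ ≤ (2 * r) ^ (1 - ξ) * ‖x₁ - x₂‖ ^ ξ := by
    rcases (norm_nonneg (x₁ - x₂)).eq_or_lt with h0 | h0
    · rw [← h0]; positivity
    · have h1 : ‖x₁ - x₂‖ ≤ 2 * r := by
        rw [← dist_eq_norm]
        have a1 := mem_ball.1 hx₁
        have a2 := mem_ball.1 hx₂
        have := dist_triangle_right x₁ x₂ c
        linarith
      calc ‖x₁ - x₂‖ = ‖x₁ - x₂‖ ^ (1 - ξ) * ‖x₁ - x₂‖ ^ ξ := by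
            rw [← Real.rpow_add h0]; simp
        _ ≤ _ := by
            gcongr
  rw [hdec]
  refine (eLpNorm_sub_le ((hΓ2 x₁ hx₁D).sub (hΓ2 x₂ hx₂D)).aestronglyMeasurable
    ((hHm x₁ hx₁D).sub (hHm x₂ hx₂D)) one_le_two).trans ?_
  refine (add_le_add (hΓH x₁ hx₁D x₂ hx₂D) hHpart).trans ?_
  rw [← ENNReal.ofReal_add (by positivity) (by positivity)]
  refine ENNReal.ofReal_le_ofReal ?_
  have : CL * ‖x₁ - x₂‖ * N ≤ CL * N * ((2 * r) ^ (1 - ξ) * ‖x₁ - x₂‖ ^ ξ) := by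
    rw [mul_right_comm]; gcongr
  nlinarith

/-! ### The singular part of the Green function -/

/-- An `L²` bound for the increments of a radial function from a pointwise bound. -/
lemma eLpNorm_radial_sub_le {k : ℕ} (hk : 0 < k) {D : Set (Euc k)} (hDm : MeasurableSet D) {R : ℝ}
    (hR : ∀ x ∈ D, ∀ y ∈ D, ‖x - y‖ < R) {Γ m : ℝ → ℝ} {B : ℝ} (hB : 0 ≤ B) (hmm : Measurable m)
    (hm : ∫⁻ y in ball (0 : Euc k) R, ENNReal.ofReal (m ‖y‖) ≤ ENNReal.ofReal B)
    {x₁ x₂ : Euc k} (hx₁ : x₁ ∈ D) (hx₂ : x₂ ∈ D)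
    (h : ∀ a b : ℝ, 0 < a → 0 < b → |a - b| ≤ ‖x₁ - x₂‖ → (Γ a - Γ b) ^ 2 ≤ m a + m b) :
    eLpNorm (fun y => Γ ‖x₁ - y‖ - Γ ‖x₂ - y‖) 2 (volume.restrict D) ≤
      ENNReal.ofReal (√(2 * B)) := by
  have : Nonempty (Fin k) := ⟨⟨0, hk⟩⟩
  -- Seen from any x in D, the set D lies in the ball of radius R around x, so by translation the
  -- bound does not depend on x.
  have hI : ∀ x ∈ D, ∫⁻ y in D, ENNReal.ofReal (m ‖x - y‖) ≤ ENNReal.ofReal B := by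
    intro x hx
    refine le_trans ?_ hm
    rw [← lintegral_indicator hDm, ← lintegral_indicator measurableSet_ball]
    rw [← lintegral_sub_left_eq_self
      (fun y => (ball (0 : Euc k) R).indicator (fun y => ENNReal.ofReal (m ‖y‖)) y) x]
    refine lintegral_mono fun y => ?_
    by_cases hy : y ∈ D
    · rw [indicator_of_mem hy, indicator_of_mem (by simpa using hR x hx y hy)]
    · rw [indicator_of_notMem hy]; exact zero_le
  rw [eLpNorm_eq_lintegral_rpow_enorm_toReal two_ne_zero ENNReal.ofNat_ne_top]
  have hsq : ∫⁻ y in D, ‖Γ ‖x₁ - y‖ - Γ ‖x₂ - y‖‖ₑ ^ (2 : ℝ) ≤ ENNReal.ofReal (2 * B) := by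
    calc ∫⁻ y in D, ‖Γ ‖x₁ - y‖ - Γ ‖x₂ - y‖‖ₑ ^ (2 : ℝ)
        ≤ ∫⁻ y in D, (ENNReal.ofReal (m ‖x₁ - y‖) + ENNReal.ofReal (m ‖x₂ - y‖)) := by
          refine lintegral_mono_ae ?_
          have a1 : ∀ᵐ y ∂(volume.restrict D), y ≠ x₁ := ae_restrict_of_ae (Measure.ae_ne volume x₁)
          have a2 : ∀ᵐ y ∂(volume.restrict D), y ≠ x₂ := ae_restrict_of_ae (Measure.ae_ne volume x₂)
          filter_upwards [a1, a2] with y h1 h2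
          have hle := h ‖x₁ - y‖ ‖x₂ - y‖ (norm_pos_iff.2 (sub_ne_zero.2 h1.symm))
            (norm_pos_iff.2 (sub_ne_zero.2 h2.symm)) (by
              simpa using abs_norm_sub_norm_le (x₁ - y) (x₂ - y))
          rw [← ofReal_norm, ENNReal.ofReal_rpow_of_nonneg (norm_nonneg _) zero_le_two,
            Real.rpow_two, Real.norm_eq_abs, sq_abs]
          exact (ENNReal.ofReal_le_ofReal hle).trans ENNReal.ofReal_add_le
      _ = (∫⁻ y in D, ENNReal.ofReal (m ‖x₁ - y‖)) + ∫⁻ y in D, ENNReal.ofReal (m ‖x₂ - y‖) := by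
          refine lintegral_add_left ?_ _
          exact (hmm.comp (by fun_prop : Measurable fun y : Euc k => ‖x₁ - y‖)).ennreal_ofReal
      _ ≤ ENNReal.ofReal B + ENNReal.ofReal B := add_le_add (hI x₁ hx₁) (hI x₂ hx₂)
      _ = ENNReal.ofReal (2 * B) := by rw [← ENNReal.ofReal_add hB hB, two_mul]
  simp only [ENNReal.toReal_ofNat]
  calc (∫⁻ y in D, ‖Γ ‖x₁ - y‖ - Γ ‖x₂ - y‖‖ₑ ^ (2 : ℝ)) ^ (1 / 2 : ℝ)
      ≤ ENNReal.ofReal (2 * B) ^ (1 / 2 : ℝ) := by gcongr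
    _ = ENNReal.ofReal (√(2 * B)) := by
      rw [ENNReal.ofReal_rpow_of_nonneg (by positivity) (by norm_num), Real.sqrt_eq_rpow]

/-- Radial functions of moderate growth at the origin are square integrable on bounded sets. -/
lemma memLp_radial {k : ℕ} (hk : 0 < k) {D : Set (Euc k)} {R : ℝ}
    {Γ : ℝ → ℝ} (hΓ : Measurable Γ) {C α : ℝ} (hα : α < k)
    (h : ∀ a, 0 < a → a < R → Γ a ^ 2 ≤ C * a ^ (-α)) {x : Euc k} (hR : ∀ y ∈ D, ‖x - y‖ < R) :
    MemLp (fun y => Γ ‖x - y‖) 2 (volume.restrict D) := by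
  have : Nonempty (Fin k) := ⟨⟨0, hk⟩⟩
  have hmeas : Measurable fun y : Euc k => Γ ‖x - y‖ := hΓ.comp (by fun_prop)
  rw [memLp_two_iff_integrable_sq hmeas.aestronglyMeasurable]
  have h1 : IntegrableOn (fun y : Euc k => Γ ‖y‖ ^ 2) (ball 0 R) := by
    refine integrableOn_ball_of_norm_le_rpow (C := C) (α := α) (by simpa using Nat.succ_le_of_lt hk)
      (by simpa using hα) ?_ ((hΓ.comp measurable_norm).pow_const 2).aestronglyMeasurable
    filter_upwards [ae_restrict_mem measurableSet_ball,
      ae_restrict_of_ae (Measure.ae_ne volume (0 : Euc k))] with y hy hy0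
    rw [Real.norm_of_nonneg (sq_nonneg _)]
    exact h _ (norm_pos_iff.2 hy0) (by simpa using hy)
  rw [← integrable_indicator_iff measurableSet_ball] at h1
  have h2 := (h1.comp_sub_left x).integrableOn (s := ball x R)
  refine IntegrableOn.mono_set (t := ball x R) ?_ ?_
  · refine h2.congr_fun (fun y hy => ?_) measurableSet_ball
    refine indicator_of_mem (s := ball (0 : Euc k) R) ?_ _
    simpa [dist_eq_norm, norm_sub_rev] using hy
  · intro y hy
    rw [mem_ball, dist_eq_norm, norm_sub_rev]
    exact hR y hy

/-! ### The logarithm and the inverse: scalar inequalities and increments in L² -/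

lemma log_one_add_le_rpow {t s : ℝ} (ht : 0 ≤ t) (hs : 0 < s) (hs1 : s ≤ 1) :
    Real.log (1 + t) ≤ t ^ s / s := by
  rw [le_div_iff₀ hs, mul_comm, ← Real.log_rpow (by positivity)]
  have h1 : (1 + t) ^ s ≤ 1 ^ s + t ^ s := Real.rpow_add_le_add_rpow zero_le_one ht hs.le hs1
  rw [Real.one_rpow] at h1
  have h2 := Real.log_le_sub_one_of_pos (x := (1 + t) ^ s) (by positivity)
  linarith

/-- For a ≤ b one has log(b/a) = log(1 + (b - a)/a) ≤ (δ/a)^s / s. Taking the sum over a and b makes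
the bound symmetric, so it integrates without deciding which pole is closer. -/
lemma log_sub_log_sq_le {a b δ s : ℝ} (ha : 0 < a) (hb : 0 < b) (hδ : |a - b| ≤ δ) (hs : 0 < s)
    (hs1 : s ≤ 1) :
    (Real.log a - Real.log b) ^ 2 ≤
      δ ^ (2 * s) / s ^ 2 * a ^ (-(2 * s)) + δ ^ (2 * s) / s ^ 2 * b ^ (-(2 * s)) := by
  wlog hab : a ≤ b generalizing a b
  · have := this hb ha (by rwa [abs_sub_comm]) (le_of_not_ge hab)
    nlinarith
  have hδ0 : 0 ≤ δ := (abs_nonneg _).trans hδ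
  have h0 : 0 ≤ Real.log b - Real.log a := sub_nonneg.2 (Real.log_le_log ha hab)
  have h1 : Real.log b - Real.log a ≤ (δ / a) ^ s / s := by
    rw [← Real.log_div hb.ne' ha.ne', show b / a = 1 + (b - a) / a by field_simp; ring]
    refine (log_one_add_le_rpow (div_nonneg (by linarith) ha.le) hs hs1).trans ?_
    have : b - a ≤ δ := by rw [abs_sub_comm] at hδ; exact (le_abs_self _).trans hδ
    have h' : 0 ≤ b - a := by linarith
    gcongr
  have h2 : ((δ / a) ^ s / s) ^ 2 = δ ^ (2 * s) / s ^ 2 * a ^ (-(2 * s)) := by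
    rw [div_pow, ← Real.rpow_natCast, ← Real.rpow_mul (by positivity), Real.div_rpow hδ0 ha.le,
      Real.rpow_neg ha.le]
    push_cast
    rw [mul_comm s 2]
    field_simp
  calc (Real.log a - Real.log b) ^ 2 = (Real.log b - Real.log a) ^ 2 := by ring
    _ ≤ ((δ / a) ^ s / s) ^ 2 := by gcongr
    _ ≤ _ := by rw [h2]; exact le_add_of_nonneg_right (by positivity)

/-- The first entry of each minimum serves near the pole, where the increment is no smaller than the
singularity allows. The second is the mean value bound δ·a⁻², useful far from the pole, where it
improves the decay. -/
lemma inv_sub_inv_sq_le {a b δ : ℝ} (ha : 0 < a) (hb : 0 < b) (hδ : |a - b| ≤ δ) :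
    (a⁻¹ - b⁻¹) ^ 2 ≤ min (a⁻¹ ^ 2) (δ ^ 2 * a⁻¹ ^ 4) + min (b⁻¹ ^ 2) (δ ^ 2 * b⁻¹ ^ 4) := by
  wlog hab : a ≤ b generalizing a b
  · have := this hb ha (by rwa [abs_sub_comm]) (le_of_not_ge hab)
    nlinarith
  have hba : b⁻¹ ≤ a⁻¹ := inv_anti₀ ha hab
  have hb0 : 0 < b⁻¹ := inv_pos.2 hb
  have ha0 : 0 < a⁻¹ := inv_pos.2 ha
  have hδ' : b - a ≤ δ := by rw [abs_sub_comm] at hδ; exact (le_abs_self _).trans hδ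
  refine le_add_of_le_of_nonneg (le_min ?_ ?_) (by positivity)
  · nlinarith
  · have h1 : a⁻¹ - b⁻¹ ≤ δ * a⁻¹ ^ 2 := by
      have : a⁻¹ - b⁻¹ = (b - a) * (a⁻¹ * b⁻¹) := by field_simp
      rw [this, sq]
      have h0 : 0 ≤ b - a := by linarith
      have hδ0 : 0 ≤ δ := h0.trans hδ'
      gcongr
    calc (a⁻¹ - b⁻¹) ^ 2 ≤ (δ * a⁻¹ ^ 2) ^ 2 := by
          have : 0 ≤ a⁻¹ - b⁻¹ := by linarith
          gcongr
      _ = δ ^ 2 * a⁻¹ ^ 4 := by ring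

lemma abs_log_le_rpow {a R : ℝ} (ha : 0 < a) (haR : a < R) :
    |Real.log a| ≤ 2 * (1 + R) * a ^ (-(1 / 2) : ℝ) := by
  have hR : 0 < R := ha.trans haR
  have h1 : Real.log a ≤ a ^ (1 / 2 : ℝ) / (1 / 2) := Real.log_le_rpow_div ha.le (by norm_num)
  have h2 : Real.log a⁻¹ ≤ a⁻¹ ^ (1 / 2 : ℝ) / (1 / 2) :=
    Real.log_le_rpow_div (inv_pos.2 ha).le (by norm_num)
  rw [Real.log_inv, Real.inv_rpow ha.le, ← Real.rpow_neg ha.le] at h2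
  have h3 : a ^ (1 / 2 : ℝ) = a * a ^ (-(1 / 2) : ℝ) := by
    nth_rewrite 2 [← Real.rpow_one a]
    rw [← Real.rpow_add ha]; norm_num
  have h4 : 0 < a ^ (-(1 / 2) : ℝ) := Real.rpow_pos_of_pos ha _
  rw [h3] at h1
  rw [abs_le]
  constructor <;> nlinarith

lemma exists_forall_norm_sub_lt {k : ℕ} {D : Set (Euc k)} (hb : Bornology.IsBounded D) :
    ∃ R : ℝ, 0 < R ∧ ∀ x ∈ closure D, ∀ y ∈ closure D, ‖x - y‖ < R := by
  obtain ⟨M, hM⟩ := hb.closure.exists_norm_le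
  refine ⟨2 * |M| + 1, by positivity, fun x hx y hy => ?_⟩
  have h1 := hM x hx
  have h2 := hM y hy
  have h3 := norm_sub_le x y
  have h4 := le_abs_self M
  linarith

lemma continuousOn_fundSol2 : ContinuousOn fundSol2 (Ioi 0) := by
  unfold fundSol2
  exact continuousOn_const.mul (Real.continuousOn_log.mono fun x hx => (ne_of_gt hx))

lemma continuousOn_fundSol3 : ContinuousOn fundSol3 (Ioi 0) := by
  unfold fundSol3
  exact continuousOn_const.mul (continuousOn_inv₀.mono fun x hx => (ne_of_gt hx))

/-- The bound δ^(2s)·|y|^(-2s) for the squared increment is integrable near the origin of the plane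
exactly when s < 1, which is why every order below 1 is reached. -/
lemma fundSol2_holder {D : Set (Euc 2)} (hDm : MeasurableSet D) {R : ℝ}
    (hR : ∀ x ∈ D, ∀ y ∈ D, ‖x - y‖ < R) {s : ℝ} (hs : 0 < s) (hs1 : s < 1) :
    ∃ C : ℝ, 0 ≤ C ∧ ∀ x₁ ∈ D, ∀ x₂ ∈ D,
      eLpNorm (fun y => fundSol2 ‖x₁ - y‖ - fundSol2 ‖x₂ - y‖) 2 (volume.restrict D) ≤
        ENNReal.ofReal (C * ‖x₁ - x₂‖ ^ s) := by
  have hint : IntegrableOn (fun y : Euc 2 => ‖y‖ ^ (-(2 * s))) (ball 0 R) := by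
    refine integrableOn_ball_of_norm_le_rpow (C := 1) (α := 2 * s) (by simp)
      (by simp; linarith) (Filter.Eventually.of_forall fun y => ?_)
      ((measurable_norm.pow_const _).aestronglyMeasurable)
    rw [Real.norm_of_nonneg (by positivity), one_mul]
  obtain ⟨J, hJ⟩ : ∃ J : ℝ, J = ∫ y in ball (0 : Euc 2) R, ‖y‖ ^ (-(2 * s)) := ⟨_, rfl⟩
  have hJ0 : 0 ≤ J := hJ ▸ integral_nonneg fun y => Real.rpow_nonneg (norm_nonneg y) _
  obtain ⟨c, hc⟩ : ∃ c : ℝ, c = (1 / (2 * Real.pi)) ^ 2 / s ^ 2 := ⟨_, rfl⟩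
  have hc0 : 0 ≤ c := hc ▸ by positivity
  refine ⟨√(2 * (c * J)), Real.sqrt_nonneg _, fun x₁ hx₁ x₂ hx₂ => ?_⟩
  obtain ⟨δ, hδ⟩ : ∃ δ : ℝ, δ = ‖x₁ - x₂‖ := ⟨_, rfl⟩
  rw [← hδ]
  have hδ0 : 0 ≤ δ := hδ ▸ norm_nonneg _
  have := eLpNorm_radial_sub_le two_pos hDm hR (Γ := fundSol2)
    (m := fun a => c * δ ^ (2 * s) * a ^ (-(2 * s))) (B := c * δ ^ (2 * s) * J) (by positivity)
    (by fun_prop) (by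
      rw [← ofReal_integral_eq_lintegral_ofReal (hint.const_mul _)
        (Filter.Eventually.of_forall fun y => by simp only [Pi.zero_apply]; positivity),
        integral_const_mul, hJ]) hx₁ hx₂ (fun a b ha hb hab => by
      rw [← hδ] at hab
      have h1 := log_sub_log_sq_le ha hb hab hs hs1.le
      have h2 : (fundSol2 a - fundSol2 b) ^ 2 =
          (1 / (2 * Real.pi)) ^ 2 * (Real.log a - Real.log b) ^ 2 := by
        unfold fundSol2; ring
      rw [h2]
      refine (mul_le_mul_of_nonneg_left h1 (sq_nonneg _)).trans (le_of_eq ?_)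
      rw [hc]; ring)
  refine this.trans (le_of_eq ?_)
  congr 1
  have h3 : δ ^ (2 * s) = (δ ^ s) ^ 2 := by
    rw [← Real.rpow_natCast, ← Real.rpow_mul hδ0]; push_cast; rw [mul_comm]
  rw [show 2 * (c * δ ^ (2 * s) * J) = 2 * (c * J) * (δ ^ s) ^ 2 by rw [h3]; ring,
    Real.sqrt_mul (by positivity), Real.sqrt_sq (by positivity)]

/-- In polar coordinates the radial density x²·min(x⁻², x⁻⁴) is at most 2/(1 + x²): both it and its
product with x² are at most 1. -/
lemma integrable_min_inv_pow : Integrable fun y : Euc 3 => min (‖y‖⁻¹ ^ 2) (‖y‖⁻¹ ^ 4) := by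
  have h := integrable_fun_norm_addHaar (volume : Measure (Euc 3))
    (f := fun a : ℝ => min (a⁻¹ ^ 2) (a⁻¹ ^ 4))
  rw [h]
  have h2 : IntegrableOn (fun x : ℝ => 2 * (1 + x ^ 2)⁻¹) (Ioi 0) :=
    (integrable_inv_one_add_sq.const_mul 2).integrableOn
  refine Integrable.mono' h2 ?_ ?_
  · refine Measurable.aestronglyMeasurable ?_
    simp only [smul_eq_mul]
    fun_prop
  · filter_upwards [ae_restrict_mem measurableSet_Ioi] with x hx
    have hx0 : 0 < x := hx
    simp only [finrank_euclideanSpace_fin, smul_eq_mul]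
    rw [Real.norm_of_nonneg (by positivity), ← div_eq_mul_inv, le_div_iff₀ (by positivity)]
    have e1 : x ^ 2 * x⁻¹ ^ 2 = 1 := by field_simp
    have e2 : x ^ 2 * (x ^ 2 * x⁻¹ ^ 4) = 1 := by field_simp
    have l1 := min_le_left (x⁻¹ ^ 2) (x⁻¹ ^ 4)
    have l2 := min_le_right (x⁻¹ ^ 2) (x⁻¹ ^ 4)
    have hx2 : 0 < x ^ 2 := by positivity
    have m1 := mul_le_mul_of_nonneg_left l1 hx2.le
    have m2 := mul_le_mul_of_nonneg_left (mul_le_mul_of_nonneg_left l2 hx2.le) hx2.le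
    simp only [Nat.add_one_sub_one]
    nlinarith

/-- Scaling fixes the order 1/2: min(|y|⁻², δ²|y|⁻⁴) is δ⁻² times a fixed function of y/δ, so its
integral is δ⁻²·δ³ = δ times a constant, and the L² norm takes a square root. -/
lemma fundSol3_holder {D : Set (Euc 3)} (hDm : MeasurableSet D) {R : ℝ}
    (hR : ∀ x ∈ D, ∀ y ∈ D, ‖x - y‖ < R) :
    ∃ C : ℝ, 0 ≤ C ∧ ∀ x₁ ∈ D, ∀ x₂ ∈ D,
      eLpNorm (fun y => fundSol3 ‖x₁ - y‖ - fundSol3 ‖x₂ - y‖) 2 (volume.restrict D) ≤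
        ENNReal.ofReal (C * ‖x₁ - x₂‖ ^ (1 / 2 : ℝ)) := by
  obtain ⟨J, hJ⟩ : ∃ J : ℝ, J = ∫ y : Euc 3, min (‖y‖⁻¹ ^ 2) (‖y‖⁻¹ ^ 4) := ⟨_, rfl⟩
  have hJ0 : 0 ≤ J := hJ ▸ integral_nonneg fun y => by simp only [Pi.zero_apply]; positivity
  obtain ⟨c, hc⟩ : ∃ c : ℝ, c = (1 / (4 * Real.pi)) ^ 2 := ⟨_, rfl⟩
  have hc0 : 0 ≤ c := hc ▸ by positivity
  refine ⟨√(2 * (c * J)), Real.sqrt_nonneg _, fun x₁ hx₁ x₂ hx₂ => ?_⟩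
  rcases eq_or_ne x₁ x₂ with rfl | hne
  · simp
  obtain ⟨δ, hδ⟩ : ∃ δ : ℝ, δ = ‖x₁ - x₂‖ := ⟨_, rfl⟩
  rw [← hδ]
  have hδ0 : 0 < δ := hδ ▸ norm_pos_iff.2 (sub_ne_zero.2 hne)
  have hscale : ∀ y : Euc 3, c * min (‖y‖⁻¹ ^ 2) (δ ^ 2 * ‖y‖⁻¹ ^ 4) =
      c * δ⁻¹ ^ 2 * min (‖δ⁻¹ • y‖⁻¹ ^ 2) (‖δ⁻¹ • y‖⁻¹ ^ 4) := by
    intro y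
    rw [norm_smul, norm_inv, Real.norm_of_nonneg hδ0.le, mul_assoc,
      mul_min_of_nonneg _ _ (by positivity : (0 : ℝ) ≤ δ⁻¹ ^ 2)]
    congr 2
    · rw [mul_inv, inv_inv]; field_simp
    · rw [mul_inv, inv_inv]; field_simp
  have hint : Integrable fun y : Euc 3 => c * min (‖y‖⁻¹ ^ 2) (δ ^ 2 * ‖y‖⁻¹ ^ 4) := by
    simp_rw [hscale]
    exact (integrable_min_inv_pow.comp_smul (inv_ne_zero hδ0.ne')).const_mul _
  have hval : ∫ y : Euc 3, c * min (‖y‖⁻¹ ^ 2) (δ ^ 2 * ‖y‖⁻¹ ^ 4) = c * δ * J := by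
    simp_rw [hscale]
    rw [integral_const_mul, Measure.integral_comp_smul volume
      (fun y : Euc 3 => min (‖y‖⁻¹ ^ 2) (‖y‖⁻¹ ^ 4)), finrank_euclideanSpace_fin, smul_eq_mul,
      ← hJ, abs_of_pos (by positivity)]
    field_simp
  have := eLpNorm_radial_sub_le three_pos hDm hR (Γ := fundSol3)
    (m := fun a => c * min (a⁻¹ ^ 2) (δ ^ 2 * a⁻¹ ^ 4)) (B := c * δ * J) (by positivity)
    (by fun_prop) (by
      refine (setLIntegral_le_lintegral _ _).trans ?_
      rw [← ofReal_integral_eq_lintegral_ofReal hint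
        (Filter.Eventually.of_forall fun y => by simp only [Pi.zero_apply]; positivity), hval])
      hx₁ hx₂ (fun a b ha hb hab => by
      rw [← hδ] at hab
      have h1 := inv_sub_inv_sq_le ha hb hab
      have h2 : (fundSol3 a - fundSol3 b) ^ 2 = c * (a⁻¹ - b⁻¹) ^ 2 := by
        unfold fundSol3; rw [hc]; ring
      rw [h2, ← mul_add]
      exact mul_le_mul_of_nonneg_left h1 hc0)
  refine this.trans (le_of_eq ?_)
  congr 1
  rw [show 2 * (c * δ * J) = 2 * (c * J) * δ by ring, Real.sqrt_mul (by positivity),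
    Real.sqrt_eq_rpow δ]

/-! ### Regions, and the Green function bounds in dimensions one, two and three -/

/-- The regions on which the regularity of the solution is studied. -/
def IsRegion {k : ℕ} (D A : Set (Euc k)) : Prop :=
  (k = 1 ∧ A = D) ∨ ∃ (c : Euc k) (r : ℝ), 0 < r ∧ closedBall c r ⊆ D ∧ A = ball c r

/-- The properties of the Green function that are used below. -/
structure GreenProps {k : ℕ} (D : Set (Euc k)) (G : Euc k → Euc k → ℝ) : Prop where
  pos : 0 < k
  isOpen : IsOpen D
  bounded : Bornology.IsBounded D
  nonempty : D.Nonempty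
  memLp : ∀ x ∈ D, MemLp (G x) 2 (volume.restrict D)
  holder : ∀ A, IsRegion D A → ∀ γ : ℝ, 0 < γ → γ < 1 → ∃ C : ℝ, 0 ≤ C ∧ ∀ x₁ ∈ A, ∀ x₂ ∈ A,
    eLpNorm (G x₁ - G x₂) 2 (volume.restrict D) ≤
      ENNReal.ofReal (C * ‖x₁ - x₂‖ ^ momentExponent k γ)

lemma norm_euc_one (x : Euc 1) : ‖x‖ = |x 0| := by
  rw [EuclideanSpace.norm_eq]
  simp [Real.sqrt_sq_eq_abs]

/-- The two summands min(x, y) and xy/b are each 1-Lipschitz in x for every y in the interval. This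
holds up to the end points, so A may be all of D. -/
lemma greenProps_interval {b : ℝ} (hb : 0 < b) :
    GreenProps {x : Euc 1 | 0 < x 0 ∧ x 0 < b} (greenInterval b) := by
  set D := {x : Euc 1 | 0 < x 0 ∧ x 0 < b} with hD
  have hopen : IsOpen D :=
    (isOpen_lt continuous_const (by fun_prop)).and (isOpen_lt (by fun_prop) continuous_const)
  have hbdd : Bornology.IsBounded D := by
    refine isBounded_iff_forall_norm_le.2 ⟨b, fun x hx => ?_⟩
    rw [norm_euc_one, abs_of_pos hx.1]; exact hx.2.le
  have hfin : IsFiniteMeasure (volume.restrict D) := ⟨by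
    rw [Measure.restrict_apply_univ]; exact hbdd.measure_lt_top⟩
  have hmeas : ∀ x, Measurable (greenInterval b x) := by
    intro x; unfold greenInterval; fun_prop
  refine ⟨one_pos, hopen, hbdd, ⟨EuclideanSpace.single 0 (b / 2), ?_⟩, fun x hx => ?_, ?_⟩
  · simp only [hD, mem_ofPred_eq, PiLp.single_apply, ite_true]
    constructor <;> linarith
  · refine MemLp.of_bound (hmeas x).aestronglyMeasurable (2 * b) ?_
    filter_upwards [ae_restrict_mem hopen.measurableSet] with y hy
    have h1 : 0 ≤ x 0 * y 0 / b := div_nonneg (mul_nonneg hx.1.le hy.1.le) hb.le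
    have h2 : x 0 * y 0 / b ≤ b := by
      rw [div_le_iff₀ hb]; exact mul_le_mul hx.2.le hy.2.le hy.1.le hb.le
    have h3 : 0 < min (x 0) (y 0) := lt_min hx.1 hy.1
    have h4 : min (x 0) (y 0) ≤ b := (min_le_left _ _).trans hx.2.le
    rw [greenInterval, Real.norm_eq_abs, abs_le]
    constructor <;> linarith
  · intro A hA γ _ _
    have hAD : A ⊆ D := by
      rcases hA with ⟨_, rfl⟩ | ⟨c, r, _, hs, rfl⟩
      · exact subset_rfl
      · exact ball_subset_closedBall.trans hs
    set N := (eLpNorm (fun _ : Euc 1 => (1 : ℝ)) 2 (volume.restrict D)).toReal with hN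
    have hNe : eLpNorm (fun _ : Euc 1 => (1 : ℝ)) 2 (volume.restrict D) = ENNReal.ofReal N :=
      (ENNReal.ofReal_toReal (memLp_const (1 : ℝ)).eLpNorm_ne_top).symm
    refine ⟨2 * N, by positivity, fun x₁ hx₁ x₂ hx₂ => ?_⟩
    have hξ : momentExponent 1 γ = 1 := by simp [momentExponent]
    rw [hξ, Real.rpow_one, show 2 * N * ‖x₁ - x₂‖ = 2 * ‖x₁ - x₂‖ * N by ring,
      ENNReal.ofReal_mul (by positivity), ← hNe]
    refine eLpNorm_le_mul_eLpNorm_of_ae_le_mul ?_ 2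
    filter_upwards [ae_restrict_mem hopen.measurableSet] with y hy
    rw [norm_euc_one, norm_one, mul_one, PiLp.sub_apply]
    have h1 : |min (x₁ 0) (y 0) - min (x₂ 0) (y 0)| ≤ |x₁ 0 - x₂ 0| := by
      simpa using abs_min_sub_min_le_max (x₁ 0) (y 0) (x₂ 0) (y 0)
    have h2 : |(x₁ 0 - x₂ 0) * (y 0 / b)| ≤ |x₁ 0 - x₂ 0| := by
      rw [abs_mul, abs_of_nonneg (div_nonneg hy.1.le hb.le)]
      exact mul_le_of_le_one_right (abs_nonneg _) ((div_le_one hb).2 hy.2.le)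
    have h3 : (greenInterval b x₁ - greenInterval b x₂) y =
        (min (x₁ 0) (y 0) - min (x₂ 0) (y 0)) - (x₁ 0 - x₂ 0) * (y 0 / b) := by
      simp only [Pi.sub_apply, greenInterval]; ring
    rw [h3, Real.norm_eq_abs]
    exact (abs_sub _ _).trans (by linarith)

lemma eLpNorm_lt_top_of_greenSup {k : ℕ} {D : Set (Euc k)} {G : Euc k → Euc k → ℝ}
    (hK : greenSup D G ≠ ∞) : ∀ x ∈ D, eLpNorm (G x) 2 (volume.restrict D) < ∞ := fun x hx =>
  lt_of_le_of_lt (le_iSup₂ (f := fun x _ => eLpNorm (G x) 2 (volume.restrict D)) x hx) hK.lt_top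

theorem greenProps_of_isDomainWithGreen {k : ℕ} {D : Set (Euc k)} {G : Euc k → Euc k → ℝ}
    (hG : IsDomainWithGreen k D G) (hK : greenSup D G ≠ ∞) : GreenProps D G := by
  have hG2 := eLpNorm_lt_top_of_greenSup hK
  cases hG with
  | dim1 b hb => exact greenProps_interval hb
  | dim2 D hopen hconn hbdd hreg =>
    obtain ⟨R, hR0, hR⟩ := exists_forall_norm_sub_lt hbdd
    have hRD : ∀ x ∈ D, ∀ y ∈ D, ‖x - y‖ < R := fun x hx y hy =>
      hR x (subset_closure hx) y (subset_closure hy)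
    -- The planar fundamental solution decreases in the distance and may be negative, so its lower
    -- bound on the boundary is the value at the diameter bound R.
    have hm : ∀ y ∈ D, ∀ z ∈ frontier D, fundSol2 R ≤ fundSol2 ‖z - y‖ := by
      intro y hy z hz
      have h1 := Real.log_le_log (norm_sub_pos_of_mem_frontier hopen hy hz)
        (hR z (frontier_subset_closure hz) y (subset_closure hy)).le
      unfold fundSol2
      have : 0 ≤ 1 / (2 * Real.pi) := by positivity
      nlinarith
    have hΓ2 : ∀ x ∈ D, MemLp (fun y => fundSol2 ‖x - y‖) 2 (volume.restrict D) := by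
      intro x hx
      refine memLp_radial two_pos (R := R) (C := (1 / (2 * Real.pi)) ^ 2 * (2 * (1 + R)) ^ 2)
        (α := 1) (by unfold fundSol2; fun_prop) (by norm_num) ?_ (hRD x hx)
      intro a ha haR
      have h1 := abs_log_le_rpow ha haR
      have h2 : Real.log a ^ 2 ≤ (2 * (1 + R)) ^ 2 * a ^ (-1 : ℝ) := by
        rw [← sq_abs]
        calc |Real.log a| ^ 2 ≤ (2 * (1 + R) * a ^ (-(1 / 2) : ℝ)) ^ 2 := by gcongr
          _ = _ := by
            rw [mul_pow, ← Real.rpow_natCast (a ^ (-(1 / 2) : ℝ)), ← Real.rpow_mul ha.le]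
            norm_num
      unfold fundSol2
      rw [mul_pow, neg_sq, mul_assoc]
      gcongr
    -- The exponent 1/2 is arbitrary here; only the square integrability is kept.
    have hmem : ∀ x ∈ D, MemLp (greenFunction fundSol2 D x) 2 (volume.restrict D) := by
      obtain ⟨C₀, hC₀, hH⟩ := fundSol2_holder hopen.measurableSet hRD
        (by norm_num : (0 : ℝ) < 1 / 2) (by norm_num)
      exact (greenFunction_holder two_pos hopen hbdd hreg continuousOn_fundSol2 hm hΓ2 hG2
        (by norm_num) hC₀ hH).1
    refine ⟨two_pos, hopen, hbdd, hconn.nonempty, hmem, ?_⟩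
    rintro A (⟨h, _⟩ | ⟨c, r, hr, hs, rfl⟩) γ hγ0 hγ1
    · norm_num at h
    · have hξ : momentExponent 2 γ = 1 - γ := by simp [momentExponent]
      rw [hξ]
      obtain ⟨C₀, hC₀, hH⟩ := fundSol2_holder hopen.measurableSet hRD
        (by linarith : 0 < 1 - γ) (by linarith)
      exact (greenFunction_holder two_pos hopen hbdd hreg continuousOn_fundSol2 hm hΓ2 hG2
        (by linarith) hC₀ hH).2 c r hr hs
  | dim3 D hopen hconn hbdd hreg =>
    obtain ⟨R, hR0, hR⟩ := exists_forall_norm_sub_lt hbdd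
    have hRD : ∀ x ∈ D, ∀ y ∈ D, ‖x - y‖ < R := fun x hx y hy =>
      hR x (subset_closure hx) y (subset_closure hy)
    have hm : ∀ y ∈ D, ∀ z ∈ frontier D, 0 ≤ fundSol3 ‖z - y‖ := by
      intro y hy z hz
      unfold fundSol3
      positivity
    have hΓ2 : ∀ x ∈ D, MemLp (fun y => fundSol3 ‖x - y‖) 2 (volume.restrict D) := by
      intro x hx
      refine memLp_radial three_pos (R := R) (C := (1 / (4 * Real.pi)) ^ 2)
        (α := 2) (by unfold fundSol3; fun_prop) (by norm_num) ?_ (hRD x hx)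
      intro a ha haR
      unfold fundSol3
      rw [mul_pow, Real.rpow_neg ha.le, Real.rpow_two, inv_pow]
    obtain ⟨C₀, hC₀, hH⟩ := fundSol3_holder hopen.measurableSet hRD
    have hall := greenFunction_holder three_pos hopen hbdd hreg continuousOn_fundSol3 hm hΓ2 hG2
        (by norm_num) hC₀ hH
    refine ⟨three_pos, hopen, hbdd, hconn.nonempty, hall.1, ?_⟩
    rintro A (⟨h, _⟩ | ⟨c, r, hr, hs, rfl⟩) γ hγ0 hγ1
    · norm_num at h
    · have hξ : momentExponent 3 γ = 1 / 2 := by simp [momentExponent]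
      rw [hξ]
      exact hall.2 c r hr hs

/-! ### The nonlinearity -/

lemma isFiniteMeasure_restrict {k : ℕ} {D : Set (Euc k)} (hb : Bornology.IsBounded D) :
    IsFiniteMeasure (volume.restrict D) :=
  ⟨by rw [Measure.restrict_apply_univ]; exact hb.measure_lt_top⟩

/-- A Nemytskii operator that is continuous on `L²` comes from a continuous function. -/
lemma continuous_of_nemytskii {k d : ℕ} {D : Set (Euc k)} (hD : IsOpen D) (hne : D.Nonempty)
    (hb : Bornology.IsBounded D) {f : Euc d → Euc d} {F : L2 D d → L2 D d}
    (hF : IsNemytskii D f F) (hc : Continuous F) : Continuous f := by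
  have hfin := isFiniteMeasure_restrict hb
  have hpos : 0 < volume D := hD.measure_pos volume hne
  have hne0 : NeZero (volume.restrict D) := ⟨by
    rw [Ne, Measure.restrict_eq_zero]; exact hpos.ne'⟩
  -- On constant functions F acts as f, and constants embed in L² with norms multiplied by κ =
  -- |D|^(1/2); continuity of F therefore passes to f.
  have hFc : ∀ x, F (Lp.const 2 (volume.restrict D) x) = Lp.const 2 (volume.restrict D) (f x) := by
    intro x
    refine Lp.ext ?_
    filter_upwards [hF (Lp.const 2 (volume.restrict D) x),
      Lp.coeFn_const 2 (volume.restrict D) x, Lp.coeFn_const 2 (volume.restrict D) (f x)]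
      with y h1 h2 h3
    rw [h1, h2, h3]; rfl
  set κ := (volume.restrict D).real univ ^ (1 / (2 : ℝ≥0∞).toReal) with hκ
  have hκpos : 0 < κ := by
    refine Real.rpow_pos_of_pos ?_ _
    exact measureReal_univ_pos
  have hnorm : ∀ y : Euc d, ‖Lp.const 2 (volume.restrict D) y‖ = ‖y‖ * κ := fun y =>
    Lp.norm_const _ _ _ two_ne_zero
  have hcc : Continuous fun x : Euc d => F (Lp.const 2 (volume.restrict D) x) :=
    hc.comp (Lp.constL 2 (volume.restrict D) ℝ).continuous
  rw [continuous_iff_continuousAt]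
  intro x₀
  rw [ContinuousAt, tendsto_iff_norm_sub_tendsto_zero]
  have h1 := (tendsto_iff_norm_sub_tendsto_zero.1 (hcc.tendsto x₀)).mul_const κ⁻¹
  rw [zero_mul] at h1
  refine h1.congr fun x => ?_
  rw [hFc, hFc, ← map_sub, hnorm, mul_inv_cancel_right₀ hκpos.ne']

/-- A bounded Nemytskii operator on `L²` comes from a function of at most linear growth. -/
lemma linear_growth_of_nemytskii {k d : ℕ} (hk : 0 < k) {D : Set (Euc k)} (hD : IsOpen D)
    (hne : D.Nonempty) (hb : Bornology.IsBounded D) {f : Euc d → Euc d} {F : L2 D d → L2 D d}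
    (hF : IsNemytskii D f F) (hbd : IsBoundedOperator F) :
    ∃ M : ℝ, 0 ≤ M ∧ ∀ x, ‖f x‖ ≤ M * (1 + ‖x‖) := by
  have hfin := isFiniteMeasure_restrict hb
  have : Nonempty (Fin k) := ⟨⟨0, hk⟩⟩
  obtain ⟨c, hc⟩ := hne
  obtain ⟨r, hr, hrD⟩ := Metric.isOpen_iff.1 hD c hc
  set V := volume.real (ball c r) with hV
  have hVpos : 0 < V := ENNReal.toReal_pos (measure_ball_pos volume c hr).ne' measure_ball_lt_top.ne
  obtain ⟨M, hM⟩ := (hbd (closedBall 0 √V) isBounded_closedBall).exists_norm_le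
  refine ⟨|M| / √V, by positivity, fun x => ?_⟩
  -- Test F on x times the indicator of a ball of volume V/n², obtained by shrinking the radius by
  -- the factor n^(-2/k). These functions stay in the ball of radius √V of L² for all x, while F of
  -- them has norm at least ‖f(x)‖·√V/n.
  set n := max 1 ‖x‖ with hn
  have hn1 : 1 ≤ n := le_max_left _ _
  have hn0 : 0 < n := by linarith
  have hxn : ‖x‖ ≤ n := le_max_right _ _
  set ε := n ^ (-(2 / k) : ℝ) with hε
  have hε0 : 0 < ε := Real.rpow_pos_of_pos hn0 _
  have hε1 : ε ≤ 1 := Real.rpow_le_one_of_one_le_of_nonpos hn1 (by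
    rw [neg_nonpos]; positivity)
  have hεk : ε ^ k = (n ^ 2)⁻¹ := by
    rw [hε, ← Real.rpow_natCast, ← Real.rpow_mul hn0.le,
      show (-(2 / k) : ℝ) * k = -2 by field_simp, Real.rpow_neg hn0.le, Real.rpow_two]
  set E := ball c (ε * r) with hE
  have hED : E ⊆ D := (ball_subset_ball (by nlinarith)).trans hrD
  have hEv : (volume.restrict D).real E = V / n ^ 2 := by
    rw [measureReal_restrict_apply measurableSet_ball, inter_eq_left.2 hED, hV, measureReal_def,
      measureReal_def, Measure.addHaar_ball volume c (by positivity : 0 ≤ ε * r),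
      Measure.addHaar_ball volume c hr.le, finrank_euclideanSpace_fin, ENNReal.toReal_mul,
      ENNReal.toReal_mul, ENNReal.toReal_ofReal (by positivity), ENNReal.toReal_ofReal (by positivity),
      mul_pow, hεk]
    ring
  have hroot : ((volume.restrict D).real E) ^ (1 / (2 : ℝ≥0∞).toReal) = √V / n := by
    rw [hEv, ENNReal.toReal_ofNat, ← Real.sqrt_eq_rpow, Real.sqrt_div hVpos.le, Real.sqrt_sq hn0.le]
  have hnorm : ∀ y : Euc d, ‖indicatorConstLp 2 measurableSet_ball
      (measure_ne_top (volume.restrict D) E) y‖ = ‖y‖ * (√V / n) := by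
    intro y
    rw [norm_indicatorConstLp two_ne_zero ENNReal.ofNat_ne_top, hroot]
  set v : L2 D d := indicatorConstLp 2 measurableSet_ball (measure_ne_top (volume.restrict D) E) x
    with hv
  have hvle : ‖v‖ ≤ √V := by
    rw [hnorm]
    calc ‖x‖ * (√V / n) ≤ n * (√V / n) := by gcongr
      _ = √V := by field_simp
  have h1 : ‖F v‖ ≤ |M| :=
    (hM _ (mem_image_of_mem F (by simpa using hvle))).trans (le_abs_self M)
  have h2 : ‖f x‖ * (√V / n) ≤ ‖F v‖ := by
    rw [← hnorm]
    refine Lp.norm_le_norm_of_ae_le ?_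
    filter_upwards [hF v, indicatorConstLp_coeFn (p := 2) (hs := measurableSet_ball)
      (hμs := measure_ne_top (volume.restrict D) E) (c := x), indicatorConstLp_coeFn (p := 2)
      (hs := measurableSet_ball) (hμs := measure_ne_top (volume.restrict D) E) (c := f x)]
      with y e1 e2 e3
    rw [e1, e2, e3]
    by_cases hy : y ∈ E
    · rw [indicator_of_mem hy, indicator_of_mem hy]
    · rw [indicator_of_notMem hy, norm_zero]; exact norm_nonneg _
  have hVs : 0 < √V := Real.sqrt_pos.2 hVpos
  have hn2 : n ≤ 1 + ‖x‖ := max_le (by linarith [norm_nonneg x]) (by linarith)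
  have h3 : ‖f x‖ ≤ |M| / √V * n := by
    have := h2.trans h1
    rw [← mul_div_assoc, div_le_iff₀ hn0] at this
    rw [div_mul_eq_mul_div, le_div_iff₀ hVs]
    exact this
  exact h3.trans (by gcongr)

/-- The pointwise Lipschitz condition makes the operator Lipschitz in `L²`. -/
lemma norm_sub_le_of_pointwise {k d : ℕ} (hk : 0 < k) {D : Set (Euc k)} (hD : IsOpen D)
    (hne : D.Nonempty) (hb : Bornology.IsBounded D) {f : Euc d → Euc d} {F : L2 D d → L2 D d}
    (hF : IsNemytskii D f F) {L : ℝ}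
    (hL : ∀ v : L2 D d, ∀ᵐ z₁ ∂(volume.restrict D), ∀ᵐ z₂ ∂(volume.restrict D),
      ‖F v z₁ - F v z₂‖ ≤ L * ‖v z₁ - v z₂‖) (v w : L2 D d) :
    ‖F v - F w‖ ≤ L * ‖v - w‖ := by
  have hfin := isFiniteMeasure_restrict hb
  have : Nonempty (Fin k) := ⟨⟨0, hk⟩⟩
  have hf : ∀ x y, ‖f x - f y‖ ≤ L * ‖x - y‖ := by
    intro x y
    obtain ⟨c, hc⟩ := hne
    obtain ⟨r, hr, hrD⟩ := Metric.isOpen_iff.1 hD c hc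
    set E := ball c (r / 2) with hE
    have hED : E ⊆ D := (ball_subset_ball (by linarith)).trans hrD
    have hEpos : volume.restrict D E ≠ 0 := by
      rw [Measure.restrict_apply measurableSet_ball, inter_eq_left.2 hED]
      exact (measure_ball_pos volume c (by positivity)).ne'
    have hEc : volume.restrict D Eᶜ ≠ 0 := by
      rw [Measure.restrict_apply measurableSet_ball.compl]
      have hsub : ball c r ∩ (closedBall c (r / 2))ᶜ ⊆ Eᶜ ∩ D := fun z hz =>
        ⟨fun h => hz.2 (ball_subset_closedBall h), hrD hz.1⟩
      refine (lt_of_lt_of_le ?_ (measure_mono hsub)).ne'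
      refine (isOpen_ball.inter isClosed_closedBall.isOpen_compl).measure_pos volume ?_
      -- A point at distance 3r/4 from c shows that D outside E contains a nonempty open set, so
      -- both values of the test function below occur on positive measure.
      refine ⟨c + EuclideanSpace.single (⟨0, hk⟩ : Fin k) (3 / 4 * r), ?_, ?_⟩
      · simp [abs_of_pos hr]; linarith
      · simp [abs_of_pos hr]; linarith
    -- The function equal to x on E and to y off E turns the almost everywhere condition on F₂ into
    -- the Lipschitz bound for the pair x, y.
    set p : L2 D d := indicatorConstLp 2 measurableSet_ball
      (measure_ne_top (volume.restrict D) E) x + indicatorConstLp 2 measurableSet_ball.compl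
      (measure_ne_top (volume.restrict D) Eᶜ) y with hp
    have hpv : ∀ᵐ z ∂(volume.restrict D), F p z = f (p z) ∧ (z ∈ E → p z = x) ∧ (z ∉ E → p z = y) := by
      filter_upwards [hF p, Lp.coeFn_add (indicatorConstLp 2 measurableSet_ball
        (measure_ne_top (volume.restrict D) E) x) (indicatorConstLp 2 measurableSet_ball.compl
        (measure_ne_top (volume.restrict D) Eᶜ) y), indicatorConstLp_coeFn (p := 2)
        (hs := measurableSet_ball) (hμs := measure_ne_top (volume.restrict D) E) (c := x),
        indicatorConstLp_coeFn (p := 2)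
        (hs := measurableSet_ball.compl) (hμs := measure_ne_top (volume.restrict D) Eᶜ) (c := y)]
        with z e1 e2 e3 e4
      refine ⟨e1, fun hz => ?_, fun hz => ?_⟩
      · rw [hp, e2, Pi.add_apply, e3, e4, indicator_of_mem hz, indicator_of_notMem (notMem_compl_iff.2 hz),
          add_zero]
      · rw [hp, e2, Pi.add_apply, e3, e4, indicator_of_notMem hz, indicator_of_mem (mem_compl hz),
          zero_add]
    obtain ⟨z₁, hz₁, h1, h1'⟩ := Measure.exists_mem_of_measure_ne_zero_of_ae hEpos
      (ae_restrict_of_ae ((hL p).and hpv))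
    obtain ⟨z₂, hz₂, h2, h2'⟩ := Measure.exists_mem_of_measure_ne_zero_of_ae hEc
      (ae_restrict_of_ae (h1.and hpv))
    rw [h1'.1, h2'.1, h1'.2.1 hz₁, h2'.2.2 hz₂] at h2
    exact h2
  refine Lp.norm_le_mul_norm_of_ae_le_mul ?_
  filter_upwards [hF v, hF w, Lp.coeFn_sub v w, Lp.coeFn_sub (F v) (F w)] with z e1 e2 e3 e4
  rw [e3, e4, Pi.sub_apply, Pi.sub_apply, e1, e2]
  exact hf _ _

/-- The monotone part contributes a nonnegative term, and the Lipschitz part costs at most L‖v - w‖²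
by Cauchy–Schwarz. -/
lemma neg_le_inner_of_condMbar {k d : ℕ} (hk : 0 < k) {D : Set (Euc k)} (hD : IsOpen D)
    (hne : D.Nonempty) (hb : Bornology.IsBounded D) {F : L2 D d → L2 D d} {L : ℝ}
    (hM : CondMbar D F L) (v w : L2 D d) : -(L * ‖v - w‖ ^ 2) ≤ ⟪v - w, F v - F w⟫ := by
  obtain ⟨_, f₁, f₂, F₁, F₂, _, hF₂, hsum, _, hmono, hlip⟩ := hM
  have h1 := hmono v w
  have h2 := norm_sub_le_of_pointwise hk hD hne hb hF₂ hlip v w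
  have h3 := (abs_le.1 (abs_real_inner_le_norm (v - w) (F₂ v - F₂ w))).1
  have h4 : F v - F w = (F₁ v - F₁ w) + (F₂ v - F₂ w) := by rw [hsum, hsum]; abel
  rw [h4, inner_add_right]
  have h5 := mul_le_mul_of_nonneg_left h2 (norm_nonneg (v - w))
  nlinarith

/-- Boundedness on bounded sets alone would not control moments; the linear growth of f makes ‖F(v)‖
grow at most linearly in ‖v‖. -/
lemma exists_norm_nemytskii_le {k d : ℕ} {D : Set (Euc k)} (hb : Bornology.IsBounded D)
    {f : Euc d → Euc d} {F : L2 D d → L2 D d} (hF : IsNemytskii D f F) {M : ℝ} (hM0 : 0 ≤ M)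
    (hM : ∀ x, ‖f x‖ ≤ M * (1 + ‖x‖)) : ∃ B : ℝ, 0 ≤ B ∧ ∀ v : L2 D d, ‖F v‖ ≤ B * (1 + ‖v‖) := by
  have hfin := isFiniteMeasure_restrict hb
  set o : Lp ℝ 2 (volume.restrict D) := Lp.const 2 (volume.restrict D) 1 with ho
  refine ⟨M * max 1 ‖o‖, by positivity, fun v => ?_⟩
  have hn : MemLp (fun x => ‖v x‖) 2 (volume.restrict D) := (Lp.memLp v).norm
  have h1 : ‖F v‖ ≤ M * ‖o + hn.toLp _‖ := by
    refine Lp.norm_le_mul_norm_of_ae_le_mul ?_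
    filter_upwards [hF v, Lp.coeFn_add o (hn.toLp _), Lp.coeFn_const 2 (volume.restrict D) (1 : ℝ),
      hn.coeFn_toLp] with z e1 e2 e3 e4
    rw [e1, e2, Pi.add_apply, ho, e3, e4]
    refine (hM _).trans ?_
    gcongr
    exact le_abs_self _
  have h2 : ‖hn.toLp _‖ = ‖v‖ := by
    rw [Lp.norm_toLp, Lp.norm_def, eLpNorm_norm]
  have h3 : ‖o + hn.toLp _‖ ≤ ‖o‖ + ‖v‖ := (norm_add_le _ _).trans_eq (by rw [h2])
  have h4 : ‖o‖ + ‖v‖ ≤ max 1 ‖o‖ * (1 + ‖v‖) := by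
    have a1 := le_max_left 1 ‖o‖
    have a2 := le_max_right 1 ‖o‖
    nlinarith [norm_nonneg v]
  calc ‖F v‖ ≤ M * ‖o + hn.toLp _‖ := h1
    _ ≤ M * (max 1 ‖o‖ * (1 + ‖v‖)) := by gcongr; exact h3.trans h4
    _ = _ := by ring

/-- The a priori bound: if `u + ∫ G(·, y) F(u)(y) dy = z` then `F(u)` is controlled by `z`. -/
lemma exists_apriori_bound {k d : ℕ} (hk : 0 < k) {D : Set (Euc k)} (hD : IsOpen D)
    (hne : D.Nonempty) (hb : Bornology.IsBounded D) {G : Euc k → Euc k → ℝ}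
    {f : Euc d → Euc d} {F : L2 D d → L2 D d} (hF : IsNemytskii D f F) {L a : ℝ}
    (hbd : IsBoundedOperator F) (hM : CondMbar D F L) (ha : IsPoincareConst D G d a) (hLa : L < a) :
    ∃ B : ℝ, 0 ≤ B ∧ ∀ u z : L2 D d,
      (∀ᵐ x ∂(volume.restrict D), u x + ∫ y in D, G x y • F u y = z x) →
      ‖F u‖ ≤ B * (1 + ‖z‖) := by
  obtain ⟨M, hM0, hMf⟩ := linear_growth_of_nemytskii hk hD hne hb hF hbd
  obtain ⟨B, hB0, hB⟩ := exists_norm_nemytskii_le hb hF hM0 hMf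
  have hpos : 0 < a - L := sub_pos.2 hLa
  refine ⟨B * (1 + (1 + B / (a - L))), by positivity, fun u z huz => ?_⟩
  have hT : ∀ᵐ x ∂(volume.restrict D), (z - u : L2 D d) x = ∫ y in D, G x y • F u y := by
    filter_upwards [huz, Lp.coeFn_sub z u] with x h1 h2
    rw [h2, Pi.sub_apply, ← h1, add_sub_cancel_left]
  have h1 := ha.2 (F u)
  have e1 : ∫ x in D, ‖∫ y in D, G x y • F u y‖ ^ 2 = ‖z - u‖ ^ 2 := by
    rw [← real_inner_self_eq_norm_sq, L2.inner_def]
    refine integral_congr_ae ?_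
    filter_upwards [hT] with x hx
    rw [hx, real_inner_self_eq_norm_sq]
  have e2 : ∫ x in D, ⟪∫ y in D, G x y • F u y, F u x⟫ = ⟪z - u, F u⟫ := by
    rw [L2.inner_def]
    refine integral_congr_ae ?_
    filter_upwards [hT] with x hx
    rw [hx]
  rw [e1, e2] at h1
  -- Here `h1` reads a‖z - u‖² ≤ ⟨z - u, F(u)⟩. Adding the lower bound for ⟨z - u, F(z) - F(u)⟩
  -- eliminates F(u), and L < a leaves a positive multiple of ‖z - u‖².
  have h2 := neg_le_inner_of_condMbar hk hD hne hb hM z u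
  rw [inner_sub_right] at h2
  have h3 := real_inner_le_norm (z - u) (F z)
  have h4 : (a - L) * ‖z - u‖ ≤ ‖F z‖ := by
    rcases (norm_nonneg (z - u)).eq_or_lt with h0 | h0
    · rw [← h0, mul_zero]; exact norm_nonneg _
    · refine le_of_mul_le_mul_left ?_ h0
      nlinarith
  have h5 : ‖z - u‖ ≤ B / (a - L) * (1 + ‖z‖) := by
    rw [div_mul_eq_mul_div, le_div_iff₀ hpos, mul_comm]
    exact h4.trans (hB z)
  have h6 : ‖u‖ ≤ ‖z‖ + ‖z - u‖ := by
    have := norm_sub_le z (z - u)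
    rwa [sub_sub_cancel] at this
  calc ‖F u‖ ≤ B * (1 + ‖u‖) := hB u
    _ ≤ B * (1 + (1 + B / (a - L))) * (1 + ‖z‖) := by
        rw [mul_assoc]
        gcongr
        have : 0 ≤ ‖z‖ := norm_nonneg z
        nlinarith

/-! ### Moments of the noise -/

/-- A centred Gaussian of standard deviation s has the law of s times a standard one, so each moment
norm is a fixed multiple of s. -/
lemma eLpNorm_gaussian {Ω : Type*} [MeasurableSpace Ω] {P : Measure Ω} {X : Ω → ℝ}
    (hX : HasGaussianLaw X P) (h0 : ∫ ω, X ω ∂P = 0) {s : ℝ} (hs : 0 ≤ s)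
    (h2 : ∫ ω, X ω ^ 2 ∂P = s ^ 2) (p : ℝ≥0) :
    eLpNorm X p P = ENNReal.ofReal s * eLpNorm id p (gaussianReal 0 1) := by
  have hlaw := hX.map_eq_gaussianReal
  have hscale : gaussianReal 0 Var[X; P].toNNReal = (gaussianReal 0 1).map (fun x => s * x) := by
    rw [gaussianReal_map_const_mul, mul_zero, mul_one,
      variance_of_integral_eq_zero hX.aemeasurable h0, h2]
    congr 1
    exact Real.toNNReal_of_nonneg _
  rw [h0, hscale] at hlaw
  calc eLpNorm X p P = eLpNorm id p (P.map X) := by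
        rw [eLpNorm_map_measure aestronglyMeasurable_id hX.aemeasurable]; rfl
    _ = eLpNorm (fun x : ℝ => s * x) p (gaussianReal 0 1) := by
        rw [hlaw, eLpNorm_map_measure aestronglyMeasurable_id (by fun_prop)]; rfl
    _ = ‖s‖ₑ * eLpNorm id p (gaussianReal 0 1) := eLpNorm_const_smul s id p _
    _ = _ := by rw [← ofReal_norm, Real.norm_of_nonneg hs]

lemma IsWhiteNoise.eLpNorm_eval {Ω : Type*} [MeasurableSpace Ω] {P : Measure Ω} {k d : ℕ}
    {W : Fin d → Lp ℝ 2 (volume : Measure (Euc k)) → Ω → ℝ} (hW : IsWhiteNoise P k d W)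
    (j : Fin d) (φ : Lp ℝ 2 (volume : Measure (Euc k))) (p : ℝ≥0) :
    eLpNorm (W j φ) p P = ENNReal.ofReal ‖φ‖ * eLpNorm id p (gaussianReal 0 1) := by
  refine eLpNorm_gaussian (hW.gaussian.hasGaussianLaw_eval (j, φ)) (hW.centred j φ)
    (norm_nonneg _) ?_ p
  have := hW.covariance j j φ φ
  rw [if_pos rfl, real_inner_self_eq_norm_sq] at this
  rw [← this]
  exact integral_congr_ae (Filter.Eventually.of_forall fun ω => sq _)

lemma IsWhiteNoise.eLpNorm_sub {Ω : Type*} [MeasurableSpace Ω] {P : Measure Ω} {k d : ℕ}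
    {W : Fin d → Lp ℝ 2 (volume : Measure (Euc k)) → Ω → ℝ} (hW : IsWhiteNoise P k d W)
    (j : Fin d) (φ ψ : Lp ℝ 2 (volume : Measure (Euc k))) (p : ℝ≥0) :
    eLpNorm (W j φ - W j ψ) p P =
      ENNReal.ofReal ‖φ - ψ‖ * eLpNorm id p (gaussianReal 0 1) := by
  have m1 : ∀ φ, MemLp (W j φ) 2 P := fun φ =>
    (hW.gaussian.hasGaussianLaw_eval (j, φ)).memLp_two
  have := hW.gaussian.isProbabilityMeasure
  have i1 : ∀ φ, Integrable (W j φ) P := fun φ => (m1 φ).integrable one_le_two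
  have i2 : ∀ φ ψ, Integrable (fun ω => W j φ ω * W j ψ ω) P := fun φ ψ =>
    (m1 φ).integrable_mul (m1 ψ)
  refine eLpNorm_gaussian (hW.gaussian.hasGaussianLaw_sub (s := (j, φ)) (t := (j, ψ))) ?_
    (norm_nonneg _) ?_ p
  · simp only [Pi.sub_apply]
    rw [integral_sub (i1 φ) (i1 ψ), hW.centred, hW.centred, sub_zero]
  · have hexp : ∀ ω, (W j φ - W j ψ) ω ^ 2 =
        (W j φ ω * W j φ ω - 2 * (W j φ ω * W j ψ ω)) + W j ψ ω * W j ψ ω := by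
      intro ω; simp only [Pi.sub_apply]; ring
    have i3 : Integrable (fun ω => W j φ ω * W j φ ω - 2 * (W j φ ω * W j ψ ω)) P :=
      (i2 φ φ).sub ((i2 φ ψ).const_mul 2)
    simp only [] at hexp ⊢
    rw [integral_congr_ae (Filter.Eventually.of_forall hexp),
      integral_add i3 (i2 ψ ψ),
      integral_sub (i2 φ φ) ((i2 φ ψ).const_mul 2), integral_const_mul, hW.covariance,
      hW.covariance, hW.covariance, if_pos rfl, if_pos rfl, if_pos rfl, norm_sub_sq_real,
      real_inner_self_eq_norm_sq, real_inner_self_eq_norm_sq]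

/-- Square integrability on D selects the branch of `wienerIntegral` that is not the default value
0. -/
lemma wienerIntegral_eq {Ω : Type*} {k : ℕ} (W : Lp ℝ 2 (volume : Measure (Euc k)) → Ω → ℝ)
    {D : Set (Euc k)} (hD : MeasurableSet D) {h : Euc k → ℝ}
    (hh : MemLp h 2 (volume.restrict D)) :
    wienerIntegral W D h = W (((memLp_indicator_iff_restrict hD).2 hh).toLp _) := by
  rw [wienerIntegral, dif_pos]

/-- The stochastic convolution `(∑ⱼ σᵢⱼ ∫_D G(x, y) Wʲ(dy))ᵢ`. -/
def noise {Ω : Type*} {k d : ℕ} (D : Set (Euc k)) (G : Euc k → Euc k → ℝ)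
    (σ : Matrix (Fin d) (Fin d) ℝ) (W : Fin d → Lp ℝ 2 (volume : Measure (Euc k)) → Ω → ℝ)
    (x : Euc k) (ω : Ω) : Euc d :=
  WithLp.toLp 2 fun i => ∑ j, σ i j * wienerIntegral (W j) D (G x) ω

lemma noise_eq {Ω : Type*} {k d : ℕ} (D : Set (Euc k)) (G : Euc k → Euc k → ℝ)
    (σ : Matrix (Fin d) (Fin d) ℝ) (W : Fin d → Lp ℝ 2 (volume : Measure (Euc k)) → Ω → ℝ)
    (x : Euc k) (ω : Ω) : noise D G σ W x ω = Matrix.toEuclideanCLM (𝕜 := ℝ) σ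
      (∑ j, EuclideanSpace.single j (wienerIntegral (W j) D (G x) ω)) := by
  have : (∑ j, EuclideanSpace.single j (wienerIntegral (W j) D (G x) ω) : Euc d) =
      WithLp.toLp 2 fun j => wienerIntegral (W j) D (G x) ω := by
    ext i; simp
  rw [this, Matrix.toEuclideanCLM_toLp]
  rfl

lemma continuous_single {d : ℕ} (j : Fin d) :
    Continuous fun t : ℝ => (EuclideanSpace.single j t : Euc d) := by
  have : (fun t : ℝ => (EuclideanSpace.single j t : Euc d)) =
      fun t => t • EuclideanSpace.single j (1 : ℝ) := by
    ext t i; simp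
  rw [this]
  fun_prop

lemma eLpNorm_sum_single_le {Ω : Type*} [MeasurableSpace Ω] {P : Measure Ω} {d : ℕ}
    {w : Fin d → Ω → ℝ} (hw : ∀ j, AEStronglyMeasurable (w j) P) {p : ℝ≥0∞} (hp : 1 ≤ p) :
    eLpNorm (fun ω => ∑ j, EuclideanSpace.single j (w j ω) : Ω → Euc d) p P ≤
      ∑ j, eLpNorm (w j) p P := by
  have h1 : (fun ω => ∑ j, EuclideanSpace.single j (w j ω) : Ω → Euc d) =
      ∑ j, fun ω => EuclideanSpace.single j (w j ω) := by ext; simp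
  rw [h1]
  refine (eLpNorm_sum_le (fun j _ => ?_) hp).trans (Finset.sum_le_sum fun j _ => ?_)
  · exact (continuous_single j).comp_aestronglyMeasurable (hw j)
  · exact (eLpNorm_congr_norm_ae (Filter.Eventually.of_forall fun ω => by simp)).le

/-- The isometry of the white noise and the Gaussian scaling reduce all moments to L² norms of the
kernel. The same constant serves the noise and its increments: the norm of σ, times d, times the
p-norm of a standard Gaussian. -/
lemma exists_eLpNorm_noise_le {Ω : Type*} [MeasurableSpace Ω] {P : Measure Ω} {k d : ℕ}
    {D : Set (Euc k)} (hD : MeasurableSet D) {G : Euc k → Euc k → ℝ}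
    (hG : ∀ x ∈ D, MemLp (G x) 2 (volume.restrict D)) (σ : Matrix (Fin d) (Fin d) ℝ)
    {W : Fin d → Lp ℝ 2 (volume : Measure (Euc k)) → Ω → ℝ} (hW : IsWhiteNoise P k d W)
    {p : ℝ≥0} (hp : 1 ≤ p) : ∃ C : ℝ≥0,
      (∀ x ∈ D, AEStronglyMeasurable (noise D G σ W x) P) ∧
      (∀ x ∈ D, eLpNorm (noise D G σ W x) p P ≤ C * eLpNorm (G x) 2 (volume.restrict D)) ∧
      ∀ x₁ ∈ D, ∀ x₂ ∈ D, eLpNorm (noise D G σ W x₁ - noise D G σ W x₂) p P ≤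
        C * eLpNorm (G x₁ - G x₂) 2 (volume.restrict D) := by
  set A := Matrix.toEuclideanCLM (𝕜 := ℝ) σ with hA
  obtain ⟨c, hc⟩ : ∃ c : ℝ≥0, eLpNorm id p (gaussianReal 0 1) = c :=
    ⟨_, (ENNReal.coe_toNNReal (memLp_id_gaussianReal p).eLpNorm_ne_top).symm⟩
  have hp' : (1 : ℝ≥0∞) ≤ p := by exact_mod_cast hp
  have hwm : ∀ x ∈ D, ∀ j, AEStronglyMeasurable (wienerIntegral (W j) D (G x)) P := by
    intro x hx j
    rw [wienerIntegral_eq _ hD (hG x hx)]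
    exact (hW.gaussian.aemeasurable (j, _)).aestronglyMeasurable
  have hw1 : ∀ x ∈ D, ∀ j, eLpNorm (wienerIntegral (W j) D (G x)) p P =
      eLpNorm (G x) 2 (volume.restrict D) * c := by
    intro x hx j
    rw [wienerIntegral_eq _ hD (hG x hx), hW.eLpNorm_eval, hc, Lp.norm_toLp,
      eLpNorm_indicator_eq_eLpNorm_restrict hD, ENNReal.ofReal_toReal (hG x hx).eLpNorm_ne_top]
  have hw2 : ∀ x₁ ∈ D, ∀ x₂ ∈ D, ∀ j,
      eLpNorm (wienerIntegral (W j) D (G x₁) - wienerIntegral (W j) D (G x₂)) p P =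
      eLpNorm (G x₁ - G x₂) 2 (volume.restrict D) * c := by
    intro x₁ hx₁ x₂ hx₂ j
    rw [wienerIntegral_eq _ hD (hG x₁ hx₁), wienerIntegral_eq _ hD (hG x₂ hx₂), hW.eLpNorm_sub, hc,
      ← MemLp.toLp_sub, Lp.norm_toLp, ← indicator_sub', eLpNorm_indicator_eq_eLpNorm_restrict hD,
      ENNReal.ofReal_toReal ((hG x₁ hx₁).sub (hG x₂ hx₂)).eLpNorm_ne_top]
  have hvec : ∀ w : Fin d → Ω → ℝ, (∀ j, AEStronglyMeasurable (w j) P) →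
      ∀ N : ℝ≥0∞, (∀ j, eLpNorm (w j) p P = N * c) →
      eLpNorm (fun ω => A (∑ j, EuclideanSpace.single j (w j ω))) p P ≤
        ((‖A‖₊ * (d * c) : ℝ≥0) : ℝ≥0∞) * N := by
    intro w hw N hN
    have h1 : eLpNorm (fun ω => A (∑ j, EuclideanSpace.single j (w j ω))) p P ≤
        ‖A‖₊ * eLpNorm (fun ω => ∑ j, EuclideanSpace.single j (w j ω) : Ω → Euc d) p P :=
      eLpNorm_le_nnreal_smul_eLpNorm_of_ae_le_mul
        (Filter.Eventually.of_forall fun ω => A.le_opNNNorm _) _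
    refine h1.trans ?_
    refine (mul_le_mul_right (eLpNorm_sum_single_le hw hp') _).trans (le_of_eq ?_)
    simp_rw [hN]
    simp
    ring
  refine ⟨‖A‖₊ * (d * c), fun x hx => ?_, fun x hx => ?_, fun x₁ hx₁ x₂ hx₂ => ?_⟩
  · have : noise D G σ W x = fun ω => A (∑ j,
        EuclideanSpace.single j (wienerIntegral (W j) D (G x) ω)) := by
      ext1 ω; exact noise_eq D G σ W x ω
    rw [this]
    refine A.continuous.comp_aestronglyMeasurable
      (Finset.aestronglyMeasurable_fun_sum _ fun j _ => ?_)
    exact (continuous_single j).comp_aestronglyMeasurable (hwm x hx j)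
  · have : noise D G σ W x = fun ω => A (∑ j,
        EuclideanSpace.single j (wienerIntegral (W j) D (G x) ω)) := by
      ext1 ω; exact noise_eq D G σ W x ω
    rw [this]
    exact hvec _ (hwm x hx) _ (hw1 x hx)
  · have : noise D G σ W x₁ - noise D G σ W x₂ = fun ω => A (∑ j, EuclideanSpace.single j
        ((wienerIntegral (W j) D (G x₁) - wienerIntegral (W j) D (G x₂)) ω)) := by
      ext1 ω
      rw [Pi.sub_apply, noise_eq, noise_eq, ← map_sub, ← Finset.sum_sub_distrib]
      congr 1
      refine Finset.sum_congr rfl fun j _ => ?_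
      ext i
      simp
      split_ifs <;> simp
    rw [this]
    exact hvec _ (fun j => (hwm x₁ hx₁ j).sub (hwm x₂ hx₂ j)) _ (hw2 x₁ hx₁ x₂ hx₂)

/-! ### Moment estimates for the solution -/

lemma integrable_smul_of_memLp {k d : ℕ} {μ : Measure (Euc k)} {h : Euc k → ℝ} {φ : Euc k → Euc d}
    (hh : MemLp h 2 μ) (hφ : MemLp φ 2 μ) : Integrable (fun y => h y • φ y) μ :=
  memLp_one_iff_integrable.1 (hφ.smul (r := 1) hh)

lemma norm_integral_smul_le {k d : ℕ} {μ : Measure (Euc k)} {h : Euc k → ℝ} {φ : Euc k → Euc d}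
    (hh : MemLp h 2 μ) (hφ : MemLp φ 2 μ) :
    ‖∫ y, h y • φ y ∂μ‖ ≤ (eLpNorm h 2 μ).toReal * (eLpNorm φ 2 μ).toReal := by
  have h1 : ‖∫ y, h y • φ y ∂μ‖ₑ ≤ eLpNorm h 2 μ * eLpNorm φ 2 μ := by
    refine (enorm_integral_le_lintegral_enorm _).trans ?_
    have := eLpNorm_smul_le_mul_eLpNorm (p := 2) (q := 2) (r := 1) hφ.aestronglyMeasurable
      hh.aestronglyMeasurable
    rwa [eLpNorm_one_eq_lintegral_enorm] at this
  rw [← ENNReal.toReal_mul, ← toReal_enorm]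
  exact ENNReal.toReal_mono (ENNReal.mul_ne_top hh.eLpNorm_ne_top hφ.eLpNorm_ne_top) h1

lemma momentExponent_pos (k : ℕ) {γ : ℝ} (hγ : γ < 1) : 0 < momentExponent k γ := by
  unfold momentExponent
  split_ifs
  · norm_num
  · linarith
  · norm_num

lemma GreenProps.norm_conv_sub_le {k d : ℕ} {D : Set (Euc k)} {G : Euc k → Euc k → ℝ}
    (hG : GreenProps D G) {φ : Euc k → Euc d} (hφ : MemLp φ 2 (volume.restrict D)) {x₁ x₂ : Euc k}
    (hx₁ : x₁ ∈ D) (hx₂ : x₂ ∈ D) :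
    ‖(∫ y in D, G x₁ y • φ y) - ∫ y in D, G x₂ y • φ y‖ ≤
      (eLpNorm (G x₁ - G x₂) 2 (volume.restrict D)).toReal *
        (eLpNorm φ 2 (volume.restrict D)).toReal := by
  rw [← integral_sub (integrable_smul_of_memLp (hG.memLp x₁ hx₁) hφ)
    (integrable_smul_of_memLp (hG.memLp x₂ hx₂) hφ)]
  simp_rw [← sub_smul]
  exact norm_integral_smul_le ((hG.memLp x₁ hx₁).sub (hG.memLp x₂ hx₂)) hφ

/-- Continuity in x is what gives joint measurability of the linear part of the solution, and hence
access to Fubini. -/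
lemma GreenProps.continuousOn_conv {k d : ℕ} {D : Set (Euc k)} {G : Euc k → Euc k → ℝ}
    (hG : GreenProps D G) {φ : Euc k → Euc d} (hφ : MemLp φ 2 (volume.restrict D)) :
    ContinuousOn (fun x => ∫ y in D, G x y • φ y) D := by
  intro x hx
  refine ContinuousAt.continuousWithinAt ?_
  obtain ⟨r, hr, hball⟩ := Metric.nhds_basis_closedBall.mem_iff.1 (hG.isOpen.mem_nhds hx)
  obtain ⟨C, hC0, hC⟩ := hG.holder (ball x r) (Or.inr ⟨x, r, hr, hball, rfl⟩) (1 / 2)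
    (by norm_num) (by norm_num)
  have hξ := momentExponent_pos k (by norm_num : (1 / 2 : ℝ) < 1)
  set ξ := momentExponent k (1 / 2)
  set N := (eLpNorm φ 2 (volume.restrict D)).toReal
  rw [ContinuousAt, tendsto_iff_norm_sub_tendsto_zero]
  have hlim : Filter.Tendsto (fun z : Euc k => C * ‖z - x‖ ^ ξ * N) (nhds x) (nhds 0) := by
    have hc : Continuous fun z : Euc k => C * ‖z - x‖ ^ ξ * N :=
      (continuous_const.mul ((by fun_prop : Continuous fun z : Euc k => ‖z - x‖).rpow_const
        fun _ => Or.inr hξ.le)).mul continuous_const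
    have := hc.tendsto x
    simpa [Real.zero_rpow hξ.ne'] using this
  refine squeeze_zero' (Filter.Eventually.of_forall fun z => norm_nonneg _) ?_ hlim
  filter_upwards [ball_mem_nhds x hr] with z hz
  refine (hG.norm_conv_sub_le hφ (hball (ball_subset_closedBall hz)) hx).trans ?_
  refine mul_le_mul_of_nonneg_right ?_ ENNReal.toReal_nonneg
  exact ENNReal.toReal_le_of_le_ofReal (by positivity) (hC z hz x (mem_ball_self hr))

/-! ### Measurability and spatial norms of random fields -/

/-- A field that is continuous in the space variable on an open set is jointly measurable. -/
lemma measurable_indicator_uncurry {Ω : Type*} [MeasurableSpace Ω] {k d : ℕ} {D : Set (Euc k)}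
    (hD : MeasurableSet D) {v : Euc k → Ω → Euc d} (hm : ∀ x ∈ D, Measurable (v x))
    (hc : ∀ ω, ContinuousOn (fun x => v x ω) D) :
    Measurable fun q : Euc k × Ω => D.indicator (fun x => v x q.2) q.1 := by
  have h1 : Measurable (Function.uncurry fun (x : D) (ω : Ω) => v x ω) :=
    measurable_uncurry_of_continuous_of_measurable
      (fun ω => continuousOn_iff_continuous_domRestrict.1 (hc ω)) fun x => hm x x.2
  have hs : MeasurableSet {q : Euc k × Ω | q.1 ∈ D} := measurable_fst hD
  refine measurable_of_restrict_of_restrict_compl hs ?_ ?_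
  · have h2 : Measurable fun q : {q : Euc k × Ω | q.1 ∈ D} => ((⟨q.1.1, q.2⟩ : D), q.1.2) :=
      ((measurable_fst.comp measurable_subtype_coe).subtype_mk).prodMk
        (measurable_snd.comp measurable_subtype_coe)
    convert h1.comp h2 using 1
    ext1 q
    have hq : q.1.1 ∈ D := q.2
    simp [hq]
  · convert measurable_const (a := (0 : Euc d)) using 1
    ext1 q
    have hq : q.1.1 ∉ D := q.2
    simp [hq]

/-- If the moments of a field are bounded uniformly in space, then its spatial `Lᵖ` norm has finite
moments. -/
lemma memLp_eLpNorm_field {Ω : Type*} [MeasurableSpace Ω] {P : Measure Ω} [SFinite P] {k d : ℕ}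
    {D : Set (Euc k)} (hDm : MeasurableSet D) (hDtop : volume D ≠ ∞) {p : ℝ≥0} (hp0 : p ≠ 0)
    {z : Euc k → Ω → Euc d} (hzm : ∀ x ∈ D, Measurable (z x))
    (hzc : ∀ ω, ContinuousOn (fun x => z x ω) D)
    (hzL : ∀ ω, MemLp (fun x => z x ω) p (volume.restrict D)) {Q : ℝ≥0∞} (hQtop : Q ≠ ∞)
    (hzQ : ∀ x ∈ D, eLpNorm (z x) p P ≤ Q) :
    MemLp (fun ω => (eLpNorm (fun x => z x ω) p (volume.restrict D)).toReal) p P := by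
  have hjoint := measurable_indicator_uncurry hDm hzm hzc
  set E : Ω → ℝ≥0∞ := fun ω => eLpNorm (fun x => z x ω) p (volume.restrict D) with hE
  have hEpow : ∀ ω, E ω ^ (p : ℝ) =
      ∫⁻ x in D, ‖D.indicator (fun x => z x ω) x‖ₑ ^ (p : ℝ) := by
    intro ω
    rw [hE]
    simp only
    rw [eLpNorm_nnreal_pow_eq_lintegral hp0]
    refine setLIntegral_congr_fun hDm fun x hx => ?_
    simp only [indicator_of_mem hx]
  have hpowm : Measurable fun q : Euc k × Ω =>
      ‖D.indicator (fun x => z x q.2) q.1‖ₑ ^ (p : ℝ) := hjoint.enorm.pow_const _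
  have hEm : Measurable E := by
    have h1 : Measurable fun ω => E ω ^ (p : ℝ) := by
      simp_rw [hEpow]
      exact hpowm.lintegral_prod_left'
    have h2 : E = fun ω => (E ω ^ (p : ℝ)) ^ (p : ℝ)⁻¹ := by
      ext1 ω
      rw [← ENNReal.rpow_mul, mul_inv_cancel₀ (by exact_mod_cast hp0), ENNReal.rpow_one]
    rw [h2]
    exact h1.pow_const _
  -- Tonelli: the p-th moment of the spatial p-norm is the integral over D of the p-th moments at
  -- single points.
  have hEint : ∫⁻ ω, E ω ^ (p : ℝ) ∂P ≤ Q ^ (p : ℝ) * volume D := by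
    simp_rw [hEpow]
    rw [lintegral_lintegral_swap (f := fun ω x => ‖D.indicator (fun x => z x ω) x‖ₑ ^ (p : ℝ))
      (hpowm.comp measurable_swap).aemeasurable]
    calc ∫⁻ x in D, ∫⁻ ω, ‖D.indicator (fun x => z x ω) x‖ₑ ^ (p : ℝ) ∂P
        ≤ ∫⁻ _ in D, Q ^ (p : ℝ) := by
          refine setLIntegral_mono' hDm fun x hx => ?_
          simp only [indicator_of_mem hx]
          have := eLpNorm_nnreal_pow_eq_lintegral (f := z x) (μ := P) hp0
          rw [← this]
          exact ENNReal.rpow_le_rpow (hzQ x hx) p.2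
      _ = Q ^ (p : ℝ) * volume D := by rw [setLIntegral_const]
  have hEtop : ∀ ω, E ω ≠ ∞ := fun ω => (hzL ω).eLpNorm_ne_top
  change MemLp (fun ω => (E ω).toReal) p P
  refine ⟨hEm.ennreal_toReal.aestronglyMeasurable, ?_⟩
  rw [eLpNorm_lt_top_iff_lintegral_rpow_enorm_lt_top (by exact_mod_cast hp0) ENNReal.coe_ne_top]
  have : ∀ ω, ‖(E ω).toReal‖ₑ = E ω := fun ω => by
    rw [← ofReal_norm, Real.norm_of_nonneg ENNReal.toReal_nonneg, ENNReal.ofReal_toReal (hEtop ω)]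
  simp_rw [this, ENNReal.coe_toReal]
  exact hEint.trans_lt (ENNReal.mul_lt_top (ENNReal.rpow_lt_top_of_nonneg p.2 hQtop)
    hDtop.lt_top)

/-! ### A continuous version of the solution and its increments -/

/-- A version of the solution all of whose paths are continuous, with the equation in vector
form. -/
structure IsGoodVersion {Ω : Type*} [MeasurableSpace Ω] (P : Measure Ω) {k d : ℕ}
    (D : Set (Euc k)) (G : Euc k → Euc k → ℝ) (f : Euc d → Euc d) (g : Euc k → Euc d)
    (σ : Matrix (Fin d) (Fin d) ℝ) (W : Fin d → Lp ℝ 2 (volume : Measure (Euc k)) → Ω → ℝ)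
    (v : Euc k → Ω → Euc d) : Prop where
  measurable : ∀ x ∈ D, Measurable (v x)
  continuousOn : ∀ ω, ContinuousOn (fun x => v x ω) (closure D)
  equation : ∀ x ∈ D, ∀ᵐ ω ∂P, v x ω + ∫ y in D, G x y • f (v y ω) =
    (∫ y in D, G x y • g y) + noise D G σ W x ω

lemma memLp_of_continuousOn_closure {k d : ℕ} {D : Set (Euc k)} (hD : IsOpen D)
    (hb : Bornology.IsBounded D) {φ : Euc k → Euc d} (hφ : ContinuousOn φ (closure D)) :
    MemLp φ 2 (volume.restrict D) := by
  have := isFiniteMeasure_restrict hb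
  obtain ⟨C, hC⟩ := hb.isCompact_closure.exists_bound_of_continuousOn hφ
  refine MemLp.of_bound ((hφ.mono subset_closure).aestronglyMeasurable hD.measurableSet) C ?_
  filter_upwards [ae_restrict_mem hD.measurableSet] with x hx
  exact hC x (subset_closure hx)

lemma integral_smul_apply {k d : ℕ} {μ : Measure (Euc k)} {h : Euc k → ℝ} {φ : Euc k → Euc d}
    (hh : MemLp h 2 μ) (hφ : MemLp φ 2 μ) (i : Fin d) :
    (∫ y, h y • φ y ∂μ) i = ∫ y, h y * φ y i ∂μ := by
  have := (EuclideanSpace.proj (𝕜 := ℝ) i : Euc d →L[ℝ] ℝ).integral_comp_comm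
    (integrable_smul_of_memLp hh hφ)
  simpa using this.symm

/-- Setting the whole field to 0 on a measurable null set that contains all irregular paths keeps
each u(x) measurable. The null set does not depend on x, so the integral of f(u) over D is unchanged
off it. -/
lemma exists_goodVersion {Ω : Type*} [MeasurableSpace Ω] {P : Measure Ω} {k d : ℕ}
    {D : Set (Euc k)} {G : Euc k → Euc k → ℝ} (hG : GreenProps D G) {f : Euc d → Euc d}
    (hf : Continuous f) {g : Euc k → Euc d} (hg : MemLp g 2 (volume.restrict D))
    {σ : Matrix (Fin d) (Fin d) ℝ} {W : Fin d → Lp ℝ 2 (volume : Measure (Euc k)) → Ω → ℝ}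
    {u : Euc k → Ω → Euc d} (hu : IsMildSolution P D G f g σ W u) :
    ∃ v : Euc k → Ω → Euc d, IsGoodVersion P D G f g σ W v ∧ ∀ᵐ ω ∂P, ∀ x, v x ω = u x ω := by
  obtain ⟨t, hsub, htm, ht0⟩ := exists_measurable_superset_of_null (ae_iff.1 hu.paths)
  have hae : ∀ᵐ ω ∂P, ∀ x, tᶜ.indicator (u x) ω = u x ω := by
    have : ∀ᵐ ω ∂P, ω ∉ t := measure_eq_zero_iff_ae_notMem.1 ht0
    filter_upwards [this] with ω hω x
    rw [indicator_of_mem (mem_compl hω)]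
  have hcont : ∀ ω, ContinuousOn (fun x => tᶜ.indicator (u x) ω) (closure D) := by
    intro ω
    by_cases hω : ω ∈ t
    · have : (fun x => tᶜ.indicator (u x) ω) = fun _ => 0 := by
        ext1 x; exact indicator_of_notMem (notMem_compl_iff.2 hω) _
      rw [this]; exact continuousOn_const
    · have : (fun x => tᶜ.indicator (u x) ω) = fun x => u x ω := by
        ext1 x; exact indicator_of_mem (mem_compl hω) _
      rw [this]
      by_contra hcon
      exact hω (hsub fun h => hcon h.1)
  refine ⟨fun x => tᶜ.indicator (u x), ⟨fun x hx => (hu.measurable x hx).indicator htm.compl,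
    hcont, fun x hx => ?_⟩, hae⟩
  filter_upwards [hu.equation x hx, hae] with ω h1 h2
  have hfu : MemLp (fun y => f (u y ω)) 2 (volume.restrict D) := by
    have := hf.comp_continuousOn (hcont ω)
    simp only [h2] at this
    exact memLp_of_continuousOn_closure hG.isOpen hG.bounded this
  simp only [h2]
  ext i
  rw [PiLp.add_apply, PiLp.add_apply, integral_smul_apply (hG.memLp x hx) hfu,
    integral_smul_apply (hG.memLp x hx) hg, h1 i]
  rfl

section Moments

variable {Ω : Type*} [MeasurableSpace Ω] {P : Measure Ω} {k d : ℕ} {D : Set (Euc k)}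
  {G : Euc k → Euc k → ℝ} {f : Euc d → Euc d} {g : Euc k → Euc d}
  {σ : Matrix (Fin d) (Fin d) ℝ} {W : Fin d → Lp ℝ 2 (volume : Measure (Euc k)) → Ω → ℝ}
  {v : Euc k → Ω → Euc d}

lemma IsGoodVersion.memLp_comp (hv : IsGoodVersion P D G f g σ W v) (hG : GreenProps D G)
    (hf : Continuous f) (ω : Ω) : MemLp (fun y => f (v y ω)) 2 (volume.restrict D) :=
  memLp_of_continuousOn_closure hG.isOpen hG.bounded (hf.comp_continuousOn (hv.continuousOn ω))

lemma IsGoodVersion.measurable_conv (hv : IsGoodVersion P D G f g σ W v) (hG : GreenProps D G)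
    (hf : Continuous f) {x : Euc k} (hx : x ∈ D) :
    Measurable fun ω => ∫ y in D, G x y • f (v y ω) := by
  have hm := measurable_indicator_uncurry hG.isOpen.measurableSet hv.measurable
    (fun ω => (hv.continuousOn ω).mono subset_closure)
  have hGm := (hG.memLp x hx).aestronglyMeasurable
  have h1 : Measurable fun q : Ω × Euc k =>
      -- Two replacements that are harmless under the integral give joint measurability: a
      -- measurable representative of G(x,·), and v extended by 0 outside D.
      hGm.mk (G x) q.2 • f (D.indicator (fun y => v y q.1) q.2) :=
    (hGm.stronglyMeasurable_mk.measurable.comp measurable_snd).smul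
      (hf.measurable.comp (hm.comp measurable_swap))
  have h2 := (h1.stronglyMeasurable.integral_prod_right' (ν := volume.restrict D)).measurable
  convert h2 using 1
  ext1 ω
  refine integral_congr_ae ?_
  filter_upwards [hGm.ae_eq_mk, ae_restrict_mem hG.isOpen.measurableSet] with y hy hyD
  rw [indicator_of_mem hyD, hy]

/-- The linear part `u + ∫_D G(·, y) f(u(y)) dy` of the solution. -/
def linearPart (D : Set (Euc k)) (G : Euc k → Euc k → ℝ) (f : Euc d → Euc d)
    (v : Euc k → Ω → Euc d) (x : Euc k) (ω : Ω) : Euc d :=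
  v x ω + ∫ y in D, G x y • f (v y ω)

lemma IsGoodVersion.measurable_linearPart (hv : IsGoodVersion P D G f g σ W v)
    (hG : GreenProps D G) (hf : Continuous f) {x : Euc k} (hx : x ∈ D) :
    Measurable (linearPart D G f v x) :=
  (hv.measurable x hx).add (hv.measurable_conv hG hf hx)

lemma IsGoodVersion.continuousOn_linearPart (hv : IsGoodVersion P D G f g σ W v)
    (hG : GreenProps D G) (hf : Continuous f) (ω : Ω) :
    ContinuousOn (fun x => linearPart D G f v x ω) D :=
  ((hv.continuousOn ω).mono subset_closure).add (hG.continuousOn_conv (hv.memLp_comp hG hf ω))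

lemma eLpNorm_le_greenSup {x : Euc k} (hx : x ∈ D) :
    eLpNorm (G x) 2 (volume.restrict D) ≤ greenSup D G :=
  le_iSup₂ (f := fun x _ => eLpNorm (G x) 2 (volume.restrict D)) x hx

lemma IsGoodVersion.memLp_linearPart (hv : IsGoodVersion P D G f g σ W v)
    (hG : GreenProps D G) (hK : greenSup D G ≠ ∞) (hf : Continuous f) (ω : Ω) (q : ℝ≥0∞) :
    MemLp (fun x => linearPart D G f v x ω) q (volume.restrict D) := by
  have hfin := isFiniteMeasure_restrict hG.bounded
  obtain ⟨C, hC⟩ := hG.bounded.isCompact_closure.exists_bound_of_continuousOn (hv.continuousOn ω)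
  refine MemLp.of_bound ((hv.continuousOn_linearPart hG hf ω).aestronglyMeasurable
    hG.isOpen.measurableSet) (C + (greenSup D G).toReal *
    (eLpNorm (fun y => f (v y ω)) 2 (volume.restrict D)).toReal) ?_
  filter_upwards [ae_restrict_mem hG.isOpen.measurableSet] with x hx
  refine (norm_add_le _ _).trans (add_le_add (hC x (subset_closure hx)) ?_)
  refine (norm_integral_smul_le (hG.memLp x hx) (hv.memLp_comp hG hf ω)).trans ?_
  exact mul_le_mul_of_nonneg_right (ENNReal.toReal_mono hK (eLpNorm_le_greenSup hx))
    ENNReal.toReal_nonneg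

lemma IsGoodVersion.eLpNorm_linearPart_le [IsProbabilityMeasure P]
    (hv : IsGoodVersion P D G f g σ W v) (hG : GreenProps D G)
    (hg : MemLp g 2 (volume.restrict D)) {p : ℝ≥0} (hp : 1 ≤ p) {Cn : ℝ≥0} {x : Euc k} (hx : x ∈ D)
    (hNm : AEStronglyMeasurable (noise D G σ W x) P)
    (hN : eLpNorm (noise D G σ W x) p P ≤ Cn * eLpNorm (G x) 2 (volume.restrict D)) :
    eLpNorm (linearPart D G f v x) p P ≤
      greenSup D G * eLpNorm g 2 (volume.restrict D) + Cn * greenSup D G := by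
  have h1 : eLpNorm (linearPart D G f v x) p P =
      eLpNorm ((fun _ => ∫ y in D, G x y • g y) + noise D G σ W x) p P :=
    eLpNorm_congr_ae (hv.equation x hx)
  have hp' : (1 : ℝ≥0∞) ≤ p := by exact_mod_cast hp
  rw [h1]
  refine (eLpNorm_add_le aestronglyMeasurable_const hNm hp').trans (add_le_add ?_ ?_)
  · rw [eLpNorm_const _ (one_pos.trans_le hp').ne' (NeZero.ne P), measure_univ, ENNReal.one_rpow,
      mul_one]
    refine (enorm_integral_le_lintegral_enorm _).trans ?_
    have := eLpNorm_smul_le_mul_eLpNorm (p := 2) (q := 2) (r := 1) hg.aestronglyMeasurable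
      (hG.memLp x hx).aestronglyMeasurable
    rw [eLpNorm_one_eq_lintegral_enorm] at this
    exact this.trans (mul_le_mul_left (eLpNorm_le_greenSup hx) _)
  · exact hN.trans (mul_le_mul_right (eLpNorm_le_greenSup hx) _)

/-- The a priori bound is deterministic, so it applies path by path, with z the linear part of the
solution. -/
lemma IsGoodVersion.toReal_eLpNorm_comp_le (hv : IsGoodVersion P D G f g σ W v)
    (hG : GreenProps D G) (hK : greenSup D G ≠ ∞) (hf : Continuous f) {F : L2 D d → L2 D d}
    (hF : IsNemytskii D f F) {B : ℝ} (hB : ∀ u z : L2 D d,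
      (∀ᵐ x ∂(volume.restrict D), u x + ∫ y in D, G x y • F u y = z x) →
      ‖F u‖ ≤ B * (1 + ‖z‖)) (ω : Ω) :
    (eLpNorm (fun y => f (v y ω)) 2 (volume.restrict D)).toReal ≤
      B * (1 + (eLpNorm (fun x => linearPart D G f v x ω) 2 (volume.restrict D)).toReal) := by
  have hvL : MemLp (fun x => v x ω) 2 (volume.restrict D) :=
    memLp_of_continuousOn_closure hG.isOpen hG.bounded (hv.continuousOn ω)
  have hzL := hv.memLp_linearPart hG hK hf ω 2
  have hFv : (F (hvL.toLp _) : Euc k → Euc d) =ᵐ[volume.restrict D] fun y => f (v y ω) := by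
    filter_upwards [hF (hvL.toLp _), hvL.coeFn_toLp] with y h1 h2
    rw [h1, h2]
  have hint : ∀ x, ∫ y in D, G x y • F (hvL.toLp _) y = ∫ y in D, G x y • f (v y ω) := by
    intro x
    refine integral_congr_ae ?_
    filter_upwards [hFv] with y hy
    rw [hy]
  have hap := hB (hvL.toLp _) (hzL.toLp _) (by
    filter_upwards [hvL.coeFn_toLp, hzL.coeFn_toLp] with x h1 h2
    rw [h1, h2, hint, linearPart])
  rwa [Lp.norm_def, eLpNorm_congr_ae hFv, Lp.norm_toLp] at hap

/-- The `L²(D)` norm of `f(u)` is dominated by a random variable with finite moments. -/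
lemma IsGoodVersion.exists_dominating [IsProbabilityMeasure P]
    (hv : IsGoodVersion P D G f g σ W v) (hG : GreenProps D G) (hK : greenSup D G ≠ ∞)
    (hf : Continuous f) {F : L2 D d → L2 D d} (hF : IsNemytskii D f F)
    (hg : MemLp g 2 (volume.restrict D)) (hbd : IsBoundedOperator F) {L a : ℝ}
    (hM : CondMbar D F L) (ha : IsPoincareConst D G d a) (hLa : L < a)
    (hW : IsWhiteNoise P k d W) {p : ℝ≥0} (hp : 2 ≤ p) :
    ∃ Y : Ω → ℝ, MemLp Y p P ∧
      ∀ ω, (eLpNorm (fun y => f (v y ω)) 2 (volume.restrict D)).toReal ≤ Y ω := by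
  have hfin := isFiniteMeasure_restrict hG.bounded
  have hDm := hG.isOpen.measurableSet
  have hp1 : 1 ≤ p := one_le_two.trans hp
  obtain ⟨B, hB0, hB⟩ := exists_apriori_bound hG.pos hG.isOpen hG.nonempty hG.bounded hF hbd hM ha hLa
  obtain ⟨Cn, hNm, hN1, -⟩ := exists_eLpNorm_noise_le hDm hG.memLp σ hW hp1
  have hEL := memLp_eLpNorm_field hDm hG.bounded.measure_lt_top.ne (one_pos.trans_le hp1).ne'
    (fun x hx => hv.measurable_linearPart hG hf hx) (hv.continuousOn_linearPart hG hf)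
    (fun ω => hv.memLp_linearPart hG hK hf ω p)
    (ENNReal.add_ne_top.2 ⟨ENNReal.mul_ne_top hK hg.eLpNorm_ne_top,
      ENNReal.mul_ne_top ENNReal.coe_ne_top hK⟩)
    (fun x hx => hv.eLpNorm_linearPart_le hG hg hp1 hx (hNm x hx) (hN1 x hx))
  -- The constant of the embedding of L^p(D) into L²(D); it is finite because p ≥ 2 and D has finite
  -- measure.
  obtain ⟨m, hm⟩ : ∃ m : ℝ≥0,
      volume.restrict D univ ^ (1 / (2 : ℝ≥0∞).toReal - 1 / (p : ℝ≥0∞).toReal) = m := by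
    refine ⟨_, (ENNReal.coe_toNNReal (ENNReal.rpow_ne_top_of_nonneg ?_ (measure_ne_top _ _))).symm⟩
    rw [ENNReal.toReal_ofNat, ENNReal.coe_toReal, sub_nonneg]
    exact one_div_le_one_div_of_le two_pos (by exact_mod_cast hp)
  have hYm : ∀ e : Ω → ℝ, MemLp e p P → MemLp (fun ω => B * (1 + e ω * m)) p P := by
    intro e he
    have h1 : MemLp (fun ω => 1 + e ω * m) p P :=
      MemLp.add (f := fun _ => (1 : ℝ)) (memLp_const 1) (he.mul_const (m : ℝ))
    exact h1.const_mul B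
  refine ⟨_, hYm _ hEL, fun ω => ?_⟩
  refine (hv.toReal_eLpNorm_comp_le hG hK hf hF hB ω).trans ?_
  have hle : (eLpNorm (fun x => linearPart D G f v x ω) 2 (volume.restrict D)).toReal ≤
      (eLpNorm (fun x => linearPart D G f v x ω) p (volume.restrict D)).toReal * m := by
    have h1 := eLpNorm_le_eLpNorm_mul_rpow_measure_univ (p := 2) (q := p)
      (by exact_mod_cast hp) (hv.memLp_linearPart hG hK hf ω p).aestronglyMeasurable
    rw [hm] at h1
    have h2 := ENNReal.toReal_mono (ENNReal.mul_ne_top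
      (hv.memLp_linearPart hG hK hf ω p).eLpNorm_ne_top ENNReal.coe_ne_top) h1
    rwa [ENNReal.toReal_mul, ENNReal.coe_toReal] at h2
  exact mul_le_mul_of_nonneg_left (add_le_add le_rfl hle) hB0

/-- Every term of the increment carries the factor ‖G(x₁,·) - G(x₂,·)‖: the two integrals by
Cauchy–Schwarz, the noise by its Gaussian law. The random factor ‖f(v)‖ is replaced by the
dominating variable Y. -/
lemma IsGoodVersion.exists_eLpNorm_sub_le [IsProbabilityMeasure P]
    (hv : IsGoodVersion P D G f g σ W v) (hG : GreenProps D G) (hK : greenSup D G ≠ ∞)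
    (hf : Continuous f) {F : L2 D d → L2 D d} (hF : IsNemytskii D f F)
    (hg : MemLp g 2 (volume.restrict D)) (hbd : IsBoundedOperator F) {L a : ℝ}
    (hM : CondMbar D F L) (ha : IsPoincareConst D G d a) (hLa : L < a)
    (hW : IsWhiteNoise P k d W) {p : ℝ≥0} (hp : 2 ≤ p) :
    ∃ C : ℝ≥0, ∀ x₁ ∈ D, ∀ x₂ ∈ D, eLpNorm (v x₁ - v x₂) p P ≤
      C * eLpNorm (G x₁ - G x₂) 2 (volume.restrict D) := by
  obtain ⟨Y, hY, hYle⟩ := hv.exists_dominating hG hK hf hF hg hbd hM ha hLa hW hp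
  obtain ⟨Cn, hNm, -, hN2⟩ := exists_eLpNorm_noise_le hG.isOpen.measurableSet hG.memLp σ hW
    (one_le_two.trans hp)
  set gn := (eLpNorm g 2 (volume.restrict D)).toReal with hgn
  have hYg : MemLp (fun ω => Y ω + gn) p P := hY.add (memLp_const gn)
  refine ⟨(eLpNorm (fun ω => Y ω + gn) p P).toNNReal + Cn, fun x₁ hx₁ x₂ hx₂ => ?_⟩
  have hΔL := (hG.memLp x₁ hx₁).sub (hG.memLp x₂ hx₂)
  set Δ := (eLpNorm (G x₁ - G x₂) 2 (volume.restrict D)).toReal with hΔ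
  have hpt : ∀ᵐ ω ∂P, ‖(v x₁ - v x₂) ω‖ ≤
      (Δ • fun ω => Y ω + gn) ω + ‖(noise D G σ W x₁ - noise D G σ W x₂) ω‖ := by
    filter_upwards [hv.equation x₁ hx₁, hv.equation x₂ hx₂] with ω h1 h2
    have e1 : v x₁ ω - v x₂ ω =
        -((∫ y in D, G x₁ y • f (v y ω)) - ∫ y in D, G x₂ y • f (v y ω)) +
        ((∫ y in D, G x₁ y • g y) - ∫ y in D, G x₂ y • g y) +
        (noise D G σ W x₁ ω - noise D G σ W x₂ ω) := by
      rw [eq_sub_of_add_eq h1, eq_sub_of_add_eq h2]; abel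
    rw [Pi.sub_apply, e1]
    refine (norm_add_le _ _).trans (add_le_add ((norm_add_le _ _).trans ?_) le_rfl)
    rw [norm_neg, Pi.smul_apply, smul_eq_mul, mul_add]
    refine add_le_add ?_ (hG.norm_conv_sub_le hg hx₁ hx₂)
    refine (hG.norm_conv_sub_le (hv.memLp_comp hG hf ω) hx₁ hx₂).trans ?_
    exact mul_le_mul_of_nonneg_left (hYle ω) ENNReal.toReal_nonneg
  refine (eLpNorm_mono_ae_real hpt).trans ?_
  refine (eLpNorm_add_le (f := Δ • fun ω => Y ω + gn)
    (g := fun ω => ‖(noise D G σ W x₁ - noise D G σ W x₂) ω‖)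
    (hYg.aestronglyMeasurable.const_smul Δ) ((hNm x₁ hx₁).sub (hNm x₂ hx₂)).norm
    (by exact_mod_cast one_le_two.trans hp)).trans ?_
  rw [eLpNorm_norm, eLpNorm_const_smul, ENNReal.coe_add, add_mul,
    ENNReal.coe_toNNReal hYg.eLpNorm_ne_top]
  refine add_le_add (le_of_eq ?_) (hN2 x₁ hx₁ x₂ hx₂)
  rw [← ofReal_norm, Real.norm_of_nonneg ENNReal.toReal_nonneg,
    ENNReal.ofReal_toReal hΔL.eLpNorm_ne_top, mul_comm]

end Moments

/-! ### Hölder continuity of paths from moment bounds -/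

/-- The homothety of ratio `s` centred at `x`. -/
def shrink {k : ℕ} (x : Euc k) (s : ℝ) (a : Euc k) : Euc k := x + s • (a - x)

lemma continuous_shrink {k : ℕ} (x : Euc k) (s : ℝ) : Continuous (shrink x s) := by
  unfold shrink; fun_prop

lemma shrink_mem {k : ℕ} {A : Set (Euc k)} (hA : Convex ℝ A) {x a : Euc k} (hx : x ∈ A)
    (ha : a ∈ A) {s : ℝ} (hs0 : 0 ≤ s) (hs1 : s ≤ 1) : shrink x s a ∈ A :=
  hA.add_smul_sub_mem hx ha ⟨hs0, hs1⟩

lemma norm_shrink_sub {k : ℕ} (x a : Euc k) {s : ℝ} (hs0 : 0 ≤ s) :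
    ‖shrink x s a - x‖ = s * ‖a - x‖ := by
  rw [shrink, add_sub_cancel_left, norm_smul, Real.norm_of_nonneg hs0]

/-- Dilation is a homeomorphism, so H need not be measurable; this matters because w below is
controlled only on A. -/
lemma lintegral_comp_smul {k : ℕ} (H : Euc k → ℝ≥0∞) {s : ℝ} (hs : 0 < s) :
    ∫⁻ a, H (s • a) = ENNReal.ofReal (s ^ k)⁻¹ * ∫⁻ a, H a := by
  have he := (Homeomorph.smulOfNeZero s hs.ne' : Euc k ≃ₜ Euc k).measurableEmbedding
  have h1 := he.lintegral_map (μ := volume) H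
  have h2 : Measure.map (Homeomorph.smulOfNeZero s hs.ne' : Euc k ≃ₜ Euc k) volume =
      ENNReal.ofReal |(s ^ Module.finrank ℝ (Euc k))⁻¹| • (volume : Measure (Euc k)) :=
    Measure.map_addHaar_smul volume hs.ne'
  rw [h2, lintegral_smul_measure, finrank_euclideanSpace_fin, abs_of_pos (by positivity)] at h1
  exact h1.symm

/-- Convexity keeps the shrunken copy of A inside A, and the change of variables costs s⁻ᵏ. -/
lemma lintegral_shrink_le {k : ℕ} {A : Set (Euc k)} (hAm : MeasurableSet A) (hA : Convex ℝ A)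
    {x : Euc k} (hx : x ∈ A) {s : ℝ} (hs0 : 0 < s) (hs1 : s ≤ 1) (H : Euc k → ℝ≥0∞) :
    ∫⁻ a in A, H (shrink x s a) ≤ ENNReal.ofReal (s ^ k)⁻¹ * ∫⁻ a in A, H a := by
  rw [← lintegral_indicator hAm, ← lintegral_indicator hAm,
    ← lintegral_add_left_eq_self (A.indicator H) (x - s • x),
    ← lintegral_comp_smul (fun a => A.indicator H (x - s • x + a)) hs0]
  refine lintegral_mono fun a => ?_
  have he : x - s • x + s • a = shrink x s a := by rw [shrink, smul_sub]; abel
  rw [he]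
  by_cases ha : a ∈ A
  · rw [indicator_of_mem ha, indicator_of_mem (shrink_mem hA hx ha hs0.le hs1)]
  · rw [indicator_of_notMem ha]; exact zero_le

section Chaining

variable {k d : ℕ} {A : Set (Euc k)} {w : Euc k → Euc d} {p : ℝ≥0} {θ Λ : ℝ}

lemma continuousOn_comp_shrink (hA : Convex ℝ A) (hw : ContinuousOn w A) {x : Euc k} (hx : x ∈ A)
    {s : ℝ} (hs0 : 0 ≤ s) (hs1 : s ≤ 1) : ContinuousOn (fun a => w (shrink x s a)) A :=
  hw.comp (continuous_shrink x s).continuousOn fun _ ha => shrink_mem hA hx ha hs0 hs1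

/-- The basic comparison of the chaining: for points of A shrunk towards x and y, all distances are
O(s), so |w(a) - w(b)|^p is at most a multiple of s^θ times the quotient. The two changes of
variables cost s⁻ᵏ and t⁻ᵏ, whence the exponent θ - 2k. -/
lemma eLpNorm_shrink_sub_shrink_le (hAm : MeasurableSet A) (hA : Convex ℝ A)
    (hw : ContinuousOn w A) (hp : 1 ≤ p) (hθ : 0 < θ) (hΛ0 : 0 < Λ)
    (hΛ : ∀ a ∈ A, ∀ b ∈ A, ‖a - b‖ ≤ Λ) {x y : Euc k} (hx : x ∈ A) (hy : y ∈ A) {s t : ℝ}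
    (ht0 : 0 < t) (hst : s / 2 ≤ t) (hts : t ≤ s) (hs1 : s ≤ 1) (hxy : ‖x - y‖ ≤ s * Λ) :
    eLpNorm (fun q : Euc k × Euc k => w (shrink x s q.1) - w (shrink y t q.2)) p
      ((volume.restrict A).prod (volume.restrict A)) ≤
    (ENNReal.ofReal (2 ^ k * (3 * Λ) ^ θ) * ∫⁻ a in A, ∫⁻ b in A,
      ‖w a - w b‖ₑ ^ (p : ℝ) / ‖a - b‖ₑ ^ θ) ^ (p : ℝ)⁻¹ *
      ENNReal.ofReal (s ^ ((θ - 2 * k) / p)) := by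
  have hs0 : 0 < s := ht0.trans_le hts
  have ht1 : t ≤ 1 := hts.trans hs1
  have hp0 : p ≠ 0 := (one_pos.trans_le hp).ne'
  have hpr : (0 : ℝ) < p := by exact_mod_cast one_pos.trans_le hp
  obtain ⟨I, hI⟩ : ∃ I : ℝ≥0∞, I = ∫⁻ a in A, ∫⁻ b in A,
    ‖w a - w b‖ₑ ^ (p : ℝ) / ‖a - b‖ₑ ^ θ := ⟨_, rfl⟩
  rw [← hI]
  -- Three segments of length at most sΛ: from the first shrunken point to x, from x to y, and from
  -- y to the second shrunken point.
  set ℓ := 3 * (s * Λ) with hℓ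
  have hℓ0 : 0 < ℓ := by positivity
  have hdist : ∀ a ∈ A, ∀ b ∈ A, ‖shrink x s a - shrink y t b‖ ≤ ℓ := by
    intro a ha b hb
    have h1 : ‖shrink x s a - x‖ ≤ s * Λ := by
      rw [norm_shrink_sub x a hs0.le]; gcongr; exact hΛ a ha x hx
    have h2 : ‖shrink y t b - y‖ ≤ s * Λ := by
      rw [norm_shrink_sub y b ht0.le]; gcongr; exact hΛ b hb y hy
    have h3 : shrink x s a - shrink y t b =
        (shrink x s a - x) + (x - y) - (shrink y t b - y) := by abel
    rw [h3]
    refine (norm_sub_le _ _).trans ?_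
    have h4 := norm_add_le (shrink x s a - x) (x - y)
    linarith
  have hpt : ∀ a b : Euc k, ‖a - b‖ ≤ ℓ → ‖w a - w b‖ₑ ^ (p : ℝ) ≤
      ENNReal.ofReal (ℓ ^ θ) * (‖w a - w b‖ₑ ^ (p : ℝ) / ‖a - b‖ₑ ^ θ) := by
    intro a b hab
    rcases eq_or_ne a b with rfl | hne
    · simp [hpr]
    · have hn : 0 < ‖a - b‖ := norm_pos_iff.2 (sub_ne_zero.2 hne)
      have e1 : ‖a - b‖ₑ ^ θ = ENNReal.ofReal (‖a - b‖ ^ θ) := by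
        rw [← ofReal_norm, ENNReal.ofReal_rpow_of_pos hn]
      have h0 : ‖a - b‖ₑ ^ θ ≠ 0 := by
        rw [e1]; exact (ENNReal.ofReal_pos.2 (Real.rpow_pos_of_pos hn _)).ne'
      have htop : ‖a - b‖ₑ ^ θ ≠ ∞ := by rw [e1]; exact ENNReal.ofReal_ne_top
      calc ‖w a - w b‖ₑ ^ (p : ℝ) = ‖a - b‖ₑ ^ θ * (‖w a - w b‖ₑ ^ (p : ℝ) / ‖a - b‖ₑ ^ θ) :=
            (ENNReal.mul_div_cancel h0 htop).symm
        _ ≤ _ := by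
            gcongr
            rw [e1]
            exact ENNReal.ofReal_le_ofReal (Real.rpow_le_rpow hn.le hab hθ.le)
  have hmeas : AEStronglyMeasurable
      (fun q : Euc k × Euc k => w (shrink x s q.1) - w (shrink y t q.2))
      ((volume.restrict A).prod (volume.restrict A)) :=
    (((continuousOn_comp_shrink hA hw hx hs0.le hs1).aestronglyMeasurable hAm).comp_fst).sub
      (((continuousOn_comp_shrink hA hw hy ht0.le ht1).aestronglyMeasurable hAm).comp_snd)
  have hmain : eLpNorm (fun q : Euc k × Euc k => w (shrink x s q.1) - w (shrink y t q.2)) p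
      ((volume.restrict A).prod (volume.restrict A)) ^ (p : ℝ) ≤
      ENNReal.ofReal (2 ^ k * (3 * Λ) ^ θ) * I * ENNReal.ofReal (s ^ (θ - 2 * k)) := by
    rw [eLpNorm_nnreal_pow_eq_lintegral hp0, lintegral_prod _ (hmeas.enorm.pow_const _)]
    calc ∫⁻ a in A, ∫⁻ b in A, ‖w (shrink x s a) - w (shrink y t b)‖ₑ ^ (p : ℝ)
        ≤ ∫⁻ a in A, ∫⁻ b in A, ENNReal.ofReal (ℓ ^ θ) *
          (‖w (shrink x s a) - w (shrink y t b)‖ₑ ^ (p : ℝ) /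
            ‖shrink x s a - shrink y t b‖ₑ ^ θ) := by
          refine setLIntegral_mono' hAm fun a ha => setLIntegral_mono' hAm fun b hb => ?_
          exact hpt _ _ (hdist a ha b hb)
      _ = ENNReal.ofReal (ℓ ^ θ) * ∫⁻ a in A, ∫⁻ b in A,
          ‖w (shrink x s a) - w (shrink y t b)‖ₑ ^ (p : ℝ) /
            ‖shrink x s a - shrink y t b‖ₑ ^ θ := by
          simp_rw [lintegral_const_mul' _ _ ENNReal.ofReal_ne_top]
      _ ≤ ENNReal.ofReal (ℓ ^ θ) * ∫⁻ a in A, ENNReal.ofReal (t ^ k)⁻¹ * ∫⁻ b in A,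
          ‖w (shrink x s a) - w b‖ₑ ^ (p : ℝ) / ‖shrink x s a - b‖ₑ ^ θ := by
          gcongr with a
          exact lintegral_shrink_le hAm hA hy ht0 ht1
            (fun b => ‖w (shrink x s a) - w b‖ₑ ^ (p : ℝ) / ‖shrink x s a - b‖ₑ ^ θ)
      _ = ENNReal.ofReal (ℓ ^ θ) * (ENNReal.ofReal (t ^ k)⁻¹ * ∫⁻ a in A, ∫⁻ b in A,
          ‖w (shrink x s a) - w b‖ₑ ^ (p : ℝ) / ‖shrink x s a - b‖ₑ ^ θ) := by
          rw [lintegral_const_mul' _ _ ENNReal.ofReal_ne_top]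
      _ ≤ ENNReal.ofReal (ℓ ^ θ) * (ENNReal.ofReal (t ^ k)⁻¹ *
          (ENNReal.ofReal (s ^ k)⁻¹ * I)) := by
          rw [hI]
          gcongr
          exact lintegral_shrink_le hAm hA hx hs0 hs1
            (fun a => ∫⁻ b in A, ‖w a - w b‖ₑ ^ (p : ℝ) / ‖a - b‖ₑ ^ θ)
      _ = ENNReal.ofReal (ℓ ^ θ * ((t ^ k)⁻¹ * (s ^ k)⁻¹)) * I := by
          rw [ENNReal.ofReal_mul (by positivity), ENNReal.ofReal_mul (by positivity)]
          ring
      _ ≤ ENNReal.ofReal (2 ^ k * (3 * Λ) ^ θ * s ^ (θ - 2 * k)) * I := by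
          refine mul_le_mul_left (ENNReal.ofReal_le_ofReal ?_) I
          -- The factor 2ᵏ pays for replacing t by s, since t ≥ s/2.
          have h1 : (t ^ k)⁻¹ ≤ 2 ^ k * (s ^ k)⁻¹ := by
            rw [← inv_pow, ← inv_pow, ← mul_pow]
            gcongr
            rw [← div_eq_mul_inv, inv_le_comm₀ ht0 (by positivity), inv_div]
            exact hst
          have h2 : s ^ (θ - 2 * k) = s ^ θ * ((s ^ k)⁻¹ * (s ^ k)⁻¹) := by
            rw [Real.rpow_sub hs0, two_mul, Real.rpow_add hs0, Real.rpow_natCast, div_eq_mul_inv,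
              mul_inv]
          have h3 : ℓ ^ θ = (3 * Λ) ^ θ * s ^ θ := by
            rw [hℓ, show 3 * (s * Λ) = (3 * Λ) * s by ring,
              Real.mul_rpow (by positivity) hs0.le]
          rw [h2, h3]
          calc (3 * Λ) ^ θ * s ^ θ * ((t ^ k)⁻¹ * (s ^ k)⁻¹)
              ≤ (3 * Λ) ^ θ * s ^ θ * (2 ^ k * (s ^ k)⁻¹ * (s ^ k)⁻¹) := by gcongr
            _ = _ := by ring
      _ = ENNReal.ofReal (2 ^ k * (3 * Λ) ^ θ) * I * ENNReal.ofReal (s ^ (θ - 2 * k)) := by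
          rw [ENNReal.ofReal_mul (by positivity)]; ring
  have h5 := ENNReal.rpow_le_rpow hmain (inv_nonneg.2 hpr.le)
  rw [← ENNReal.rpow_mul, mul_inv_cancel₀ hpr.ne', ENNReal.rpow_one,
    ENNReal.mul_rpow_of_nonneg _ _ (inv_nonneg.2 hpr.le),
    ENNReal.ofReal_rpow_of_nonneg (by positivity) (inv_nonneg.2 hpr.le),
    ← Real.rpow_mul hs0.le, ← div_eq_mul_inv] at h5
  exact h5

/-- Continuity at x is uniform over the shrunken copies of A, so the remainder of the telescoping
disappears in the limit. -/
lemma tendsto_eLpNorm_sub_shrink (hAm : MeasurableSet A) (hA : Convex ℝ A)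
    (hAtop : volume A ≠ ∞) (hw : ContinuousOn w A) (hΛ : ∀ a ∈ A, ∀ b ∈ A, ‖a - b‖ ≤ Λ)
    {x : Euc k} (hx : x ∈ A) {s : ℝ} (hs0 : 0 ≤ s) (hs1 : s ≤ 1) :
    Filter.Tendsto (fun n : ℕ => eLpNorm (fun q : Euc k × Euc k => w x - w (shrink x (s / 2 ^ n) q.1))
      p ((volume.restrict A).prod (volume.restrict A))) Filter.atTop (nhds 0) := by
  have hfin : IsFiniteMeasure (volume.restrict A) := ⟨by
    rw [Measure.restrict_apply_univ]; exact hAtop.lt_top⟩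
  set M := (volume.restrict A).prod (volume.restrict A) with hM
  rw [ENNReal.tendsto_nhds_zero]
  intro ε hε
  have hKtop : M univ ^ (p : ℝ≥0∞).toReal⁻¹ ≠ ∞ :=
    ENNReal.rpow_ne_top_of_nonneg (inv_nonneg.2 ENNReal.toReal_nonneg) (measure_ne_top _ _)
  obtain ⟨η, hη0, hη⟩ := ENNReal.exists_nnreal_pos_mul_lt hKtop hε.ne'
  obtain ⟨δ, hδ0, hδ⟩ := Metric.continuousWithinAt_iff.1 (hw x hx) η (by exact_mod_cast hη0)
  have hlim : Filter.Tendsto (fun n : ℕ => s / 2 ^ n * Λ) Filter.atTop (nhds 0) := by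
    have := ((tendsto_pow_atTop_nhds_zero_of_lt_one (by norm_num : (0 : ℝ) ≤ 1 / 2)
      (by norm_num)).const_mul s).mul_const Λ
    simpa [div_eq_mul_inv] using this
  filter_upwards [hlim.eventually (gt_mem_nhds hδ0)] with n hn
  have hsn0 : 0 ≤ s / 2 ^ n := by positivity
  have hsn1 : s / 2 ^ n ≤ 1 := div_le_one_of_le₀ (hs1.trans (one_le_pow₀ one_le_two)) (by positivity)
  refine le_trans ?_ hη.le
  have hb := eLpNorm_le_of_ae_bound (p := p) (μ := M) (C := η)
    (f := fun q : Euc k × Euc k => w x - w (shrink x (s / 2 ^ n) q.1)) ?_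
  · rw [ENNReal.ofReal_coe_nnreal, mul_comm] at hb
    exact hb
  · have hmem : ∀ᵐ q ∂M, q.1 ∈ A :=
      Measure.quasiMeasurePreserving_fst.ae (ae_restrict_mem hAm)
    filter_upwards [hmem] with q hq
    rw [← dist_eq_norm, dist_comm]
    refine (hδ (shrink_mem hA hx hq hsn0 hsn1) ?_).le
    rw [dist_eq_norm, norm_shrink_sub x q.1 hsn0]
    exact (mul_le_mul_of_nonneg_left (hΛ q.1 hq x hx) hsn0).trans_lt hn

/-- A continuous function with a finite double integral of its difference quotients is Hölder
continuous. -/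
theorem exists_holder_of_lintegral (hAo : IsOpen A) (hne : A.Nonempty) (hA : Convex ℝ A)
    (hAb : Bornology.IsBounded A) (hw : ContinuousOn w A) (hp : 1 ≤ p) (hθ : 2 * k < θ)
    (hI : ∫⁻ a in A, ∫⁻ b in A, ‖w a - w b‖ₑ ^ (p : ℝ) / ‖a - b‖ₑ ^ θ ≠ ∞) :
    ∃ C : ℝ≥0, ∀ x ∈ A, ∀ y ∈ A, ‖w x - w y‖ ≤ C * ‖x - y‖ ^ ((θ - 2 * k) / p) := by
  have hAm := hAo.measurableSet
  have hfin : IsFiniteMeasure (volume.restrict A) := isFiniteMeasure_restrict hAb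
  obtain ⟨Λ, hΛ0, hΛ'⟩ := exists_forall_norm_sub_lt hAb
  have hΛ : ∀ a ∈ A, ∀ b ∈ A, ‖a - b‖ ≤ Λ := fun a ha b hb =>
    (hΛ' a (subset_closure ha) b (subset_closure hb)).le
  have hθ0 : 0 < θ := lt_of_le_of_lt (by positivity) hθ
  have hpr : (0 : ℝ) < p := by exact_mod_cast one_pos.trans_le hp
  have hp1 : (1 : ℝ≥0∞) ≤ p := by exact_mod_cast hp
  obtain ⟨α, hα⟩ : ∃ α : ℝ, α = (θ - 2 * k) / p := ⟨_, rfl⟩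
  have hα0 : 0 < α := by rw [hα]; exact div_pos (by linarith) hpr
  obtain ⟨R, hR⟩ : ∃ R : ℝ≥0∞, R = (ENNReal.ofReal (2 ^ k * (3 * Λ) ^ θ) * ∫⁻ a in A, ∫⁻ b in A,
      ‖w a - w b‖ₑ ^ (p : ℝ) / ‖a - b‖ₑ ^ θ) ^ (p : ℝ)⁻¹ := ⟨_, rfl⟩
  have hRtop : R ≠ ∞ := by
    rw [hR]
    exact ENNReal.rpow_ne_top_of_nonneg (inv_nonneg.2 hpr.le)
      (ENNReal.mul_ne_top ENNReal.ofReal_ne_top hI)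
  obtain ⟨M, hM⟩ : ∃ M : Measure (Euc k × Euc k),
      M = (volume.restrict A).prod (volume.restrict A) := ⟨_, rfl⟩
  have hMfin : IsFiniteMeasure M := hM ▸ inferInstance
  have hm1 : ∀ x ∈ A, ∀ s : ℝ, 0 ≤ s → s ≤ 1 →
      AEStronglyMeasurable (fun q : Euc k × Euc k => w (shrink x s q.1)) M := by
    intro x hx s hs0 hs1
    rw [hM]
    exact ((continuousOn_comp_shrink hA hw hx hs0 hs1).aestronglyMeasurable hAm).comp_fst
  have hm2 : ∀ x ∈ A, ∀ s : ℝ, 0 ≤ s → s ≤ 1 →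
      AEStronglyMeasurable (fun q : Euc k × Euc k => w (shrink x s q.2)) M := by
    intro x hx s hs0 hs1
    rw [hM]
    exact ((continuousOn_comp_shrink hA hw hx hs0 hs1).aestronglyMeasurable hAm).comp_snd
  have hJ : ∀ x ∈ A, ∀ y ∈ A, ∀ s t : ℝ, 0 < t → s / 2 ≤ t → t ≤ s → s ≤ 1 → ‖x - y‖ ≤ s * Λ →
      eLpNorm (fun q : Euc k × Euc k => w (shrink x s q.1) - w (shrink y t q.2)) p M ≤
        R * ENNReal.ofReal (s ^ α) := by
    intro x hx y hy s t ht0 hst hts hs1 hxy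
    rw [hM, hR, hα]
    exact eLpNorm_shrink_sub_shrink_le hAm hA hw hp hθ0 hΛ0 hΛ hx hy ht0 hst hts hs1 hxy
  set N : Euc k → ℝ → ℝ≥0∞ := fun x s =>
    eLpNorm (fun q : Euc k × Euc k => w x - w (shrink x s q.1)) p M with hN
  -- Consecutive scales are compared with independent averaging variables, the two coordinates of q;
  -- symmetry of the product measure lets them exchange roles at each step.
  have hNswap : ∀ x ∈ A, ∀ s : ℝ, 0 ≤ s → s ≤ 1 →
      eLpNorm (fun q : Euc k × Euc k => w x - w (shrink x s q.2)) p M = N x s := by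
    intro x hx s hs0 hs1
    have h1 := eLpNorm_comp_measurePreserving (p := p)
      (g := fun q : Euc k × Euc k => w x - w (shrink x s q.1))
      (aestronglyMeasurable_const.sub (hM ▸ hm1 x hx s hs0 hs1))
      (Measure.measurePreserving_swap (μ := volume.restrict A) (ν := volume.restrict A))
    rw [hN, hM]
    exact h1
  have hstep : ∀ x ∈ A, ∀ s : ℝ, 0 < s → s ≤ 1 →
      N x s ≤ R * ENNReal.ofReal (s ^ α) + N x (s / 2) := by
    intro x hx s hs0 hs1
    have h2 : (fun q : Euc k × Euc k => w x - w (shrink x s q.1)) =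
        (fun q => w x - w (shrink x (s / 2) q.2)) -
          fun q => w (shrink x s q.1) - w (shrink x (s / 2) q.2) := by
      ext1 q; simp only [Pi.sub_apply]; abel
    rw [add_comm, ← hNswap x hx (s / 2) (by linarith) (by linarith)]
    simp only [hN]
    rw [h2]
    refine (eLpNorm_sub_le (aestronglyMeasurable_const.sub (hm2 x hx _ (by linarith) (by linarith)))
      ((hm1 x hx s hs0.le hs1).sub (hm2 x hx _ (by linarith) (by linarith))) hp1).trans ?_
    refine add_le_add le_rfl (hJ x hx x hx s (s / 2) (by linarith) le_rfl (by linarith) hs1 ?_)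
    rw [sub_self, norm_zero]; positivity
  set ρ : ℝ≥0∞ := ENNReal.ofReal ((1 / 2) ^ α) with hρ
  have hρ1 : ρ < 1 := by
    rw [hρ, ← ENNReal.ofReal_one]
    exact (ENNReal.ofReal_lt_ofReal_iff one_pos).2
      (Real.rpow_lt_one (by norm_num) (by norm_num) hα0)
  -- Each halving of the scale multiplies the comparison bound by ρ = 2^(-α) < 1, and S is the sum
  -- of the geometric series.
  set S : ℝ≥0∞ := (1 - ρ)⁻¹ with hS
  have hStop : S ≠ ∞ := ENNReal.inv_ne_top.2 (tsub_pos_of_lt hρ1).ne'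
  have hNbound : ∀ x ∈ A, ∀ s : ℝ, 0 < s → s ≤ 1 → N x s ≤ R * ENNReal.ofReal (s ^ α) * S := by
    intro x hx s hs0 hs1
    have hiter : ∀ n : ℕ, N x s ≤
        R * ENNReal.ofReal (s ^ α) * ∑ i ∈ Finset.range n, ρ ^ i + N x (s / 2 ^ n) := by
      intro n
      induction n with
      | zero => simp
      | succ n ih =>
        have hsn0 : 0 < s / 2 ^ n := by positivity
        have hsn1 : s / 2 ^ n ≤ 1 :=
          div_le_one_of_le₀ (hs1.trans (one_le_pow₀ one_le_two)) (by positivity)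
        have h3 := hstep x hx _ hsn0 hsn1
        have h4 : ENNReal.ofReal ((s / 2 ^ n) ^ α) = ENNReal.ofReal (s ^ α) * ρ ^ n := by
          rw [hρ, ← ENNReal.ofReal_pow (by positivity), ← ENNReal.ofReal_mul (by positivity)]
          congr 1
          rw [div_eq_mul_inv, ← one_div, ← one_div_pow, Real.mul_rpow hs0.le (by positivity),
            ← Real.rpow_natCast, ← Real.rpow_natCast, ← Real.rpow_mul (by norm_num),
            ← Real.rpow_mul (by norm_num), mul_comm (n : ℝ) α]
        rw [h4, div_div, ← pow_succ] at h3
        refine ih.trans ((add_le_add le_rfl h3).trans (le_of_eq ?_))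
        rw [Finset.sum_range_succ]
        ring
    have hle : ∀ n : ℕ, N x s ≤ R * ENNReal.ofReal (s ^ α) * S + N x (s / 2 ^ n) := by
      intro n
      refine (hiter n).trans (add_le_add ?_ le_rfl)
      gcongr
      rw [hS, ← ENNReal.tsum_geometric]
      exact ENNReal.sum_le_tsum _
    have hlim : Filter.Tendsto (fun n : ℕ => R * ENNReal.ofReal (s ^ α) * S + N x (s / 2 ^ n))
        Filter.atTop (nhds (R * ENNReal.ofReal (s ^ α) * S + 0)) := by
      refine tendsto_const_nhds.add ?_
      simp only [hN, hM]
      exact tendsto_eLpNorm_sub_shrink hAm hA hAb.measure_lt_top.ne hw hΛ hx hs0.le hs1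
    rw [add_zero] at hlim
    exact ge_of_tendsto' hlim hle
  set K : ℝ≥0∞ := M univ ^ (p : ℝ)⁻¹ with hK
  have hMpos : M univ ≠ 0 := by
    rw [hM, ← univ_prod_univ, Measure.prod_prod, Measure.restrict_apply_univ]
    exact mul_ne_zero (hAo.measure_pos volume hne).ne' (hAo.measure_pos volume hne).ne'
  have hK0 : K ≠ 0 := by
    rw [hK, Ne, ENNReal.rpow_eq_zero_iff]
    rintro (h | h)
    · exact hMpos h.1
    · exact absurd h.1 (measure_ne_top _ _)
  have hKtop : K ≠ ∞ :=
    ENNReal.rpow_ne_top_of_nonneg (inv_nonneg.2 hpr.le) (measure_ne_top _ _)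
  obtain ⟨C, hC⟩ : ∃ C : ℝ≥0, K⁻¹ * (R * S + R + R * S) = C := by
    refine ⟨_, (ENNReal.coe_toNNReal (ENNReal.mul_ne_top (ENNReal.inv_ne_top.2 hK0) ?_)).symm⟩
    exact ENNReal.add_ne_top.2 ⟨ENNReal.add_ne_top.2 ⟨ENNReal.mul_ne_top hRtop hStop, hRtop⟩,
      ENNReal.mul_ne_top hRtop hStop⟩
  refine ⟨C * ((1 / Λ) ^ α).toNNReal, fun x hx y hy => ?_⟩
  rw [← hα]
  rcases eq_or_ne x y with rfl | hxy
  · simp [Real.zero_rpow hα0.ne']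
  -- The scale is matched to the distance of the two points, so a single comparison links the
  -- averages around x and y.
  obtain ⟨s, hs⟩ : ∃ s : ℝ, s = ‖x - y‖ / Λ := ⟨_, rfl⟩
  have hs0 : 0 < s := by rw [hs]; exact div_pos (norm_pos_iff.2 (sub_ne_zero.2 hxy)) hΛ0
  have hs1 : s ≤ 1 := by rw [hs]; exact (div_le_one hΛ0).2 (hΛ x hx y hy)
  have hsΛ : ‖x - y‖ ≤ s * Λ := by rw [hs, div_mul_cancel₀ _ hΛ0.ne']
  have hconst : ‖w x - w y‖ₑ * K = eLpNorm (fun _ : Euc k × Euc k => w x - w y) p M := by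
    rw [eLpNorm_const' _ (one_pos.trans_le hp1).ne' ENNReal.coe_ne_top, ENNReal.coe_toReal,
      one_div]
  -- From w(x) to an average near x, across to one near y, and back to w(y). The bounds R·S, R and
  -- R·S, divided by the norm K of the constant 1, make up C.
  have hdec : (fun _ : Euc k × Euc k => w x - w y) =
      (fun q => w x - w (shrink x s q.1)) + (fun q => w (shrink x s q.1) - w (shrink y s q.2)) -
        fun q => w y - w (shrink y s q.2) := by
    ext1 q; simp only [Pi.sub_apply, Pi.add_apply]; abel
  have hfinal : ‖w x - w y‖ₑ * K ≤ (R * S + R + R * S) * ENNReal.ofReal (s ^ α) := by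
    rw [hconst, hdec]
    have mx := hm1 x hx s hs0.le hs1
    have my := hm2 y hy s hs0.le hs1
    refine (eLpNorm_sub_le ((aestronglyMeasurable_const.sub mx).add (mx.sub my))
      (aestronglyMeasurable_const.sub my) hp1).trans ?_
    have h6 := eLpNorm_add_le (μ := M) (aestronglyMeasurable_const (b := w x) |>.sub mx)
      (mx.sub my) hp1
    have h7 := hNbound x hx s hs0 hs1
    have h8 := hJ x hx y hy s s hs0 (by linarith) le_rfl hs1 hsΛ
    have h9 := hNbound y hy s hs0 hs1
    rw [← hNswap y hy s hs0.le hs1] at h9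
    refine (add_le_add (h6.trans (add_le_add h7 h8)) h9).trans (le_of_eq ?_)
    ring
  have hdiv : ‖w x - w y‖ₑ ≤ C * ENNReal.ofReal (s ^ α) := by
    rw [← hC, mul_assoc, mul_comm K⁻¹, ← div_eq_mul_inv]
    exact (ENNReal.le_div_iff_mul_le (Or.inl hK0) (Or.inl hKtop)).2 hfinal
  have hreal := ENNReal.toReal_mono (ENNReal.mul_ne_top ENNReal.coe_ne_top ENNReal.ofReal_ne_top) hdiv
  rw [toReal_enorm, ENNReal.toReal_mul, ENNReal.coe_toReal,
    ENNReal.toReal_ofReal (Real.rpow_nonneg hs0.le _)] at hreal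
  refine hreal.trans (le_of_eq ?_)
  rw [NNReal.coe_mul, Real.coe_toNNReal _ (Real.rpow_nonneg (by positivity) _), hs,
    div_eq_mul_one_div, Real.mul_rpow (norm_nonneg _) (by positivity)]
  ring

end Chaining

/-! ### From moment bounds to Hölder paths -/

lemma lintegral_lintegral_lintegral_rotate {Ω X : Type*} [MeasurableSpace Ω] [MeasurableSpace X]
    {P : Measure Ω} [SFinite P] {μ : Measure X} [SFinite μ] {H : Ω → X → X → ℝ≥0∞}
    (hH : Measurable fun q : (Ω × X) × X => H q.1.1 q.1.2 q.2) :
    ∫⁻ ω, (∫⁻ a, ∫⁻ b, H ω a b ∂μ ∂μ) ∂P = ∫⁻ a, ∫⁻ b, ∫⁻ ω, H ω a b ∂P ∂μ ∂μ := by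
  have hinner : Measurable fun q : Ω × X => ∫⁻ b, H q.1 q.2 b ∂μ := hH.lintegral_prod_right'
  rw [lintegral_lintegral_swap (f := fun ω a => ∫⁻ b, H ω a b ∂μ) hinner.aemeasurable]
  refine lintegral_congr fun a => ?_
  have : Measurable fun q : Ω × X => H q.1 a q.2 :=
    hH.comp ((measurable_fst.prodMk measurable_const).prodMk measurable_snd)
  exact lintegral_lintegral_swap (f := fun ω b => H ω a b) this.aemeasurable

/-- Almost surely finite double integrals of difference quotients, from moment bounds. -/
lemma ae_lintegral_quotient_ne_top {Ω : Type*} [MeasurableSpace Ω] {P : Measure Ω} [SFinite P]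
    {k d : ℕ} {A : Set (Euc k)} (hAm : MeasurableSet A) (hAtop : volume A ≠ ∞)
    {v : Euc k → Ω → Euc d} (hvm : ∀ x ∈ A, Measurable (v x))
    (hvc : ∀ ω, ContinuousOn (fun x => v x ω) A) {p : ℝ≥0} (hp : p ≠ 0) {θ C : ℝ}
    (hmom : ∀ x₁ ∈ A, ∀ x₂ ∈ A, ∫⁻ ω, ‖v x₁ ω - v x₂ ω‖ₑ ^ (p : ℝ) ∂P ≤
      ENNReal.ofReal (C * ‖x₁ - x₂‖ ^ θ)) :
    ∀ᵐ ω ∂P, ∫⁻ a in A, ∫⁻ b in A, ‖v a ω - v b ω‖ₑ ^ (p : ℝ) / ‖a - b‖ₑ ^ θ ≠ ∞ := by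
  have hfin : IsFiniteMeasure (volume.restrict A) := ⟨by
    rw [Measure.restrict_apply_univ]; exact hAtop.lt_top⟩
  have hpr : (0 : ℝ) < p := by exact_mod_cast pos_iff_ne_zero.2 hp
  have hj := measurable_indicator_uncurry hAm hvm hvc
  -- Extension by 0 outside A makes the field jointly measurable on the whole space and changes
  -- nothing under integrals over A.
  set vi : Euc k → Ω → Euc d := fun x ω => A.indicator (fun x => v x ω) x with hvi
  have hvi1 : ∀ x ∈ A, ∀ ω, vi x ω = v x ω := fun x hx ω => indicator_of_mem hx _
  set H : Ω → Euc k → Euc k → ℝ≥0∞ := fun ω a b =>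
    ‖vi a ω - vi b ω‖ₑ ^ (p : ℝ) / ‖a - b‖ₑ ^ θ with hH
  have hHm : Measurable fun q : (Ω × Euc k) × Euc k => H q.1.1 q.1.2 q.2 := by
    have h1 : Measurable fun q : (Ω × Euc k) × Euc k => vi q.1.2 q.1.1 :=
      hj.comp ((measurable_snd.comp measurable_fst).prodMk (measurable_fst.comp measurable_fst))
    have h2 : Measurable fun q : (Ω × Euc k) × Euc k => vi q.2 q.1.1 :=
      hj.comp (measurable_snd.prodMk (measurable_fst.comp measurable_fst))
    exact ((h1.sub h2).enorm.pow_const _).div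
      ((((measurable_snd.comp measurable_fst).sub measurable_snd).enorm).pow_const _)
  have houter : Measurable fun ω => ∫⁻ a in A, ∫⁻ b in A, H ω a b :=
    (hHm.lintegral_prod_right' (ν := volume.restrict A)).lintegral_prod_right'
  have hbound : ∫⁻ ω, (∫⁻ a in A, ∫⁻ b in A, H ω a b) ∂P ≤
      ENNReal.ofReal C * volume A * volume A := by
    rw [lintegral_lintegral_lintegral_rotate hHm]
    calc ∫⁻ a in A, ∫⁻ b in A, ∫⁻ ω, H ω a b ∂P
        ≤ ∫⁻ a in A, ∫⁻ b in A, ENNReal.ofReal C := by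
          refine setLIntegral_mono' hAm fun a ha => setLIntegral_mono' hAm fun b hb => ?_
          simp only [hH]
          simp_rw [hvi1 a ha, hvi1 b hb]
          rcases eq_or_ne a b with rfl | hne
          · simp [hpr]
          · have hn : 0 < ‖a - b‖ := norm_pos_iff.2 (sub_ne_zero.2 hne)
            have hnθ : 0 < ‖a - b‖ ^ θ := Real.rpow_pos_of_pos hn _
            have e1 : ‖a - b‖ₑ ^ θ = ENNReal.ofReal (‖a - b‖ ^ θ) := by
              rw [← ofReal_norm, ENNReal.ofReal_rpow_of_pos hn]
            simp_rw [e1, div_eq_mul_inv]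
            rw [lintegral_mul_const' _ _ (ENNReal.inv_ne_top.2 (ENNReal.ofReal_pos.2 hnθ).ne'),
              ← div_eq_mul_inv]
            refine ENNReal.div_le_of_le_mul ?_
            rw [← ENNReal.ofReal_mul' hnθ.le]
            exact hmom a ha b hb
      _ = ENNReal.ofReal C * volume A * volume A := by
          rw [setLIntegral_const, setLIntegral_const]
  have hlt := ae_lt_top houter (hbound.trans_lt (ENNReal.mul_lt_top (ENNReal.mul_lt_top
    ENNReal.ofReal_lt_top hAtop.lt_top) hAtop.lt_top)).ne
  filter_upwards [hlt] with ω hω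
  refine ne_of_lt (lt_of_le_of_lt ?_ hω)
  refine setLIntegral_mono' hAm fun a ha => setLIntegral_mono' hAm fun b hb => ?_
  simp only [hH, hvi1 a ha, hvi1 b hb]
  exact le_rfl

lemma IsRegion.props {k : ℕ} {D A : Set (Euc k)} {G : Euc k → Euc k → ℝ}
    (hG : IsDomainWithGreen k D G) (hGP : GreenProps D G) (hA : IsRegion D A) :
    IsOpen A ∧ Convex ℝ A ∧ A.Nonempty ∧ A ⊆ D := by
  rcases hA with ⟨hk, rfl⟩ | ⟨c, r, hr, hs, rfl⟩
  · refine ⟨hGP.isOpen, ?_, hGP.nonempty, subset_rfl⟩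
    cases hG with
    | dim1 b hb =>
      exact (convex_Ioo 0 b).is_linear_preimage
        (EuclideanSpace.proj (𝕜 := ℝ) (0 : Fin 1) : Euc 1 →L[ℝ] ℝ).isBoundedLinearMap.toIsLinearMap
    | dim2 => norm_num at hk
    | dim3 => norm_num at hk
  · exact ⟨isOpen_ball, convex_ball c r, ⟨c, mem_ball_self hr⟩, ball_subset_closedBall.trans hs⟩

/-- For k = 2 there is equality; for k = 1, 3 the γ is slack. One argument with γ tending to 0 then
covers all dimensions. -/
lemma pathExponent_sub_le_momentExponent {k : ℕ} {D : Set (Euc k)} {G : Euc k → Euc k → ℝ}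
    (hG : IsDomainWithGreen k D G) {γ : ℝ} (hγ : 0 ≤ γ) :
    pathExponent k - γ ≤ momentExponent k γ := by
  cases hG with
  | dim1 => simpa [pathExponent, momentExponent] using hγ
  | dim2 => simp [pathExponent, momentExponent]
  | dim3 => simpa [pathExponent, momentExponent] using hγ

lemma holderOnWith_of_norm_le {k d : ℕ} {A : Set (Euc k)} {w : Euc k → Euc d} {C : ℝ≥0} {e Λ : ℝ}
    (hΛ : ∀ a ∈ A, ∀ b ∈ A, ‖a - b‖ ≤ Λ)
    (hw : ∀ x ∈ A, ∀ y ∈ A, ‖w x - w y‖ ≤ C * ‖x - y‖ ^ e) {α : ℝ≥0} (hα : 0 < α)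
    (hαe : (α : ℝ) ≤ e) : HolderOnWith (C * (Λ ^ (e - α)).toNNReal) α w A := by
  have hα' : (0 : ℝ) < α := hα
  intro x hx y hy
  have hΛ0 : 0 ≤ Λ := (norm_nonneg _).trans (hΛ x hx y hy)
  have h1 : ‖w x - w y‖ ≤ (C * (Λ ^ (e - α)).toNNReal : ℝ≥0) * ‖x - y‖ ^ (α : ℝ) := by
    refine (hw x hx y hy).trans ?_
    rcases (norm_nonneg (x - y)).eq_or_lt with h0 | h0
    · rw [← h0, Real.zero_rpow (hα'.trans_le hαe).ne', mul_zero]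
      positivity
    · rw [NNReal.coe_mul, Real.coe_toNNReal _ (Real.rpow_nonneg hΛ0 _), mul_assoc]
      gcongr
      calc ‖x - y‖ ^ e = ‖x - y‖ ^ (e - α) * ‖x - y‖ ^ (α : ℝ) := by
            rw [← Real.rpow_add h0]; simp
        _ ≤ _ := by
            gcongr
            exact hΛ x hx y hy
  rw [edist_eq_enorm_sub, edist_eq_enorm_sub, ← ofReal_norm, ← ofReal_norm,
    ENNReal.ofReal_rpow_of_nonneg (norm_nonneg _) α.coe_nonneg, ← ENNReal.ofReal_coe_nnreal,
    ← ENNReal.ofReal_mul NNReal.zero_le_coe]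
  exact ENNReal.ofReal_le_ofReal h1

/-- If K were infinite, then, D having positive measure, the inverse on the right of the smallness
condition would be 0, and nothing lies strictly below 0. -/
lemma greenSup_ne_top {k : ℕ} {D : Set (Euc k)} {G : Euc k → Euc k → ℝ} (hD : volume D ≠ 0)
    {L : ℝ} (hLK : ENNReal.ofReal L < (greenSup D G * volume D ^ (1 / 2 : ℝ))⁻¹) : greenSup D G ≠ ∞ := by
  intro h
  have h1 : volume D ^ (1 / 2 : ℝ) ≠ 0 := by
    rw [Ne, ENNReal.rpow_eq_zero_iff]
    rintro (h | h)
    · exact hD h.1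
    · norm_num at h
  rw [h, ENNReal.top_mul h1, ENNReal.inv_top] at hLK
  exact not_lt_zero hLK

lemma IsDomainWithGreen.volume_ne_zero {k : ℕ} {D : Set (Euc k)} {G : Euc k → Euc k → ℝ}
    (hG : IsDomainWithGreen k D G) : volume D ≠ 0 := by
  cases hG with
  | dim1 b hb =>
    have h := greenProps_interval hb
    exact (h.isOpen.measure_pos volume h.nonempty).ne'
  | dim2 D hopen hconn => exact (hopen.measure_pos volume hconn.nonempty).ne'
  | dim3 D hopen hconn => exact (hopen.measure_pos volume hconn.nonempty).ne'

/-- Moment bounds for the increments, from bounds in terms of the Green function. -/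
lemma exists_moment_bound {Ω : Type*} [MeasurableSpace Ω] {P : Measure Ω} {k d : ℕ}
    {D A : Set (Euc k)} {G : Euc k → Euc k → ℝ} {v : Euc k → Ω → Euc d} (hAD : A ⊆ D) {p : ℝ≥0}
    (hp : p ≠ 0) {ξ : ℝ} {C₁ : ℝ≥0} (h₁ : ∀ x₁ ∈ D, ∀ x₂ ∈ D,
      eLpNorm (v x₁ - v x₂) p P ≤ C₁ * eLpNorm (G x₁ - G x₂) 2 (volume.restrict D))
    {C₂ : ℝ} (hC₂ : 0 ≤ C₂) (h₂ : ∀ x₁ ∈ A, ∀ x₂ ∈ A,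
      eLpNorm (G x₁ - G x₂) 2 (volume.restrict D) ≤ ENNReal.ofReal (C₂ * ‖x₁ - x₂‖ ^ ξ)) :
    ∃ C : ℝ, 0 < C ∧ ∀ x₁ ∈ A, ∀ x₂ ∈ A, ∫⁻ ω, ‖v x₁ ω - v x₂ ω‖ₑ ^ (p : ℝ) ∂P ≤
      ENNReal.ofReal (C * ‖x₁ - x₂‖ ^ (p * ξ)) := by
  -- The summand 1 only makes the constant strictly positive.
  refine ⟨(C₁ * C₂) ^ (p : ℝ) + 1, by positivity, fun x₁ hx₁ x₂ hx₂ => ?_⟩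
  have h3 := (h₁ x₁ (hAD hx₁) x₂ (hAD hx₂)).trans (mul_le_mul_right (h₂ x₁ hx₁ x₂ hx₂) _)
  have h4 := ENNReal.rpow_le_rpow h3 p.coe_nonneg
  have h5 := eLpNorm_nnreal_pow_eq_lintegral (f := v x₁ - v x₂) (μ := P) hp
  rw [h5, ← ENNReal.ofReal_coe_nnreal, ← ENNReal.ofReal_mul NNReal.zero_le_coe,
    ENNReal.ofReal_rpow_of_nonneg (by positivity) p.coe_nonneg] at h4
  refine h4.trans (ENNReal.ofReal_le_ofReal ?_)
  have hn : 0 ≤ ‖x₁ - x₂‖ := norm_nonneg _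
  rw [← mul_assoc, Real.mul_rpow (by positivity) (by positivity), ← Real.rpow_mul hn, mul_comm ξ]
  gcongr
  exact le_add_of_nonneg_right zero_le_one

/-- Hölder continuity of almost all paths, from moment bounds. -/
lemma ae_exists_holderOnWith {Ω : Type*} [MeasurableSpace Ω] {P : Measure Ω} [SFinite P]
    {k d : ℕ} {A : Set (Euc k)} (hAo : IsOpen A) (hAne : A.Nonempty) (hA : Convex ℝ A)
    (hAb : Bornology.IsBounded A) {v : Euc k → Ω → Euc d} (hvm : ∀ x ∈ A, Measurable (v x))
    (hvc : ∀ ω, ContinuousOn (fun x => v x ω) A) {e : ℝ} {ξ : ℝ → ℝ}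
    (hξ : ∀ γ, 0 ≤ γ → e - γ ≤ ξ γ)
    (hmom : ∀ γ : ℝ, 0 < γ → γ < 1 → ∀ p : ℝ≥0, 2 ≤ p → ∃ C : ℝ, 0 < C ∧ ∀ x₁ ∈ A, ∀ x₂ ∈ A,
      ∫⁻ ω, ‖v x₁ ω - v x₂ ω‖ₑ ^ (p : ℝ) ∂P ≤ ENNReal.ofReal (C * ‖x₁ - x₂‖ ^ (p * ξ γ))) :
    ∀ᵐ ω ∂P, ∀ α : ℝ≥0, 0 < α → (α : ℝ) < e →
      ∃ C : ℝ≥0, HolderOnWith C α (fun x => v x ω) A := by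
  -- Taking p = n + 2 and γ = 1/(n + 2) leaves countably many conditions, hence one null set for all
  -- orders α.
  have hfinite : ∀ᵐ ω ∂P, ∀ n : ℕ, ∫⁻ a in A, ∫⁻ b in A,
      ‖v a ω - v b ω‖ₑ ^ (((n + 2 : ℝ≥0)) : ℝ) /
        ‖a - b‖ₑ ^ (((n + 2 : ℝ≥0) : ℝ) * ξ (1 / (n + 2))) ≠ ∞ := by
    rw [ae_all_iff]
    intro n
    have hn : (0 : ℝ) ≤ n := Nat.cast_nonneg n
    obtain ⟨C, -, hC⟩ := hmom (1 / (n + 2)) (by positivity)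
      ((div_lt_one (by positivity)).2 (by linarith)) (n + 2 : ℝ≥0) (by simp)
    exact ae_lintegral_quotient_ne_top hAo.measurableSet hAb.measure_lt_top.ne hvm hvc
      (by positivity) hC
  obtain ⟨Λ, -, hΛ'⟩ := exists_forall_norm_sub_lt hAb
  have hΛ : ∀ a ∈ A, ∀ b ∈ A, ‖a - b‖ ≤ Λ := fun a ha b hb =>
    (hΛ' a (subset_closure ha) b (subset_closure hb)).le
  filter_upwards [hfinite] with ω hω α hα hαe
  -- The order obtained from n is at least e - (1 + 2k)/(n + 2): the 1 is the loss from γ, the 2k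
  -- that of the chaining. This choice of n makes it exceed α.
  obtain ⟨n, hn⟩ := exists_nat_gt ((1 + 2 * k) / (e - α))
  have hpos : 0 < e - α := sub_pos.2 hαe
  have hα' : (0 : ℝ) < α := hα
  rw [div_lt_iff₀ hpos] at hn
  have hn0 : (0 : ℝ) ≤ n := Nat.cast_nonneg n
  have hq : (0 : ℝ) < n + 2 := by positivity
  have hcast : (((n + 2 : ℝ≥0)) : ℝ) = n + 2 := by push_cast; rfl
  have hξn := hξ (1 / (n + 2)) (by positivity)
  have hexp : (α : ℝ) ≤ (((n + 2 : ℝ≥0) : ℝ) * ξ (1 / (n + 2)) - 2 * k) / ((n + 2 : ℝ≥0) : ℝ) := by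
    rw [hcast, le_div_iff₀ hq]
    have h1 : (n + 2 : ℝ) * (e - 1 / (n + 2)) ≤ (n + 2) * ξ (1 / (n + 2)) := by gcongr
    have h2 : (n + 2 : ℝ) * (e - 1 / (n + 2)) = (n + 2) * e - 1 := by field_simp
    nlinarith
  have hθ : 2 * (k : ℝ) < ((n + 2 : ℝ≥0) : ℝ) * ξ (1 / (n + 2)) := by
    have := hα'.trans_le hexp
    rw [hcast] at this ⊢
    have := (div_pos_iff_of_pos_right hq).1 this
    linarith
  obtain ⟨C, hC⟩ := exists_holder_of_lintegral hAo hAne hA hAb (hvc ω)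
    (by exact_mod_cast (by omega : 1 ≤ n + 2) : (1 : ℝ≥0) ≤ n + 2) hθ (hω n)
  exact ⟨_, holderOnWith_of_norm_le hΛ hC hα hexp⟩

end EllipticSPDE

end

/-! ### Assembly of the estimates -/

open EllipticSPDE in
theorem mainTheorem5 {Ω : Type*} [MeasurableSpace Ω] (P : Measure Ω) [IsProbabilityMeasure P]
    {k d : ℕ} (D : Set (Euc k)) (G : Euc k → Euc k → ℝ) (hG : IsDomainWithGreen k D G)
    (f : Euc d → Euc d) (F : L2 D d → L2 D d) (hF : IsNemytskii D f F)
    (g : Euc k → Euc d) (hg : MemLp g 2 (volume.restrict D))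
    (σ : Matrix (Fin d) (Fin d) ℝ) (hσ : σ.det ≠ 0)
    (hC : CondC F) (L : ℝ) (hM : CondMbar D F L)
    (a : ℝ) (ha : IsPoincareConst D G d a) (hLa : L < a)
    (hLK : ENNReal.ofReal L < (greenSup D G * volume D ^ (1 / 2 : ℝ))⁻¹)
    (W : Fin d → Lp ℝ 2 (volume : Measure (Euc k)) → Ω → ℝ) (hW : IsWhiteNoise P k d W)
    (u : Euc k → Ω → Euc d) (hu : IsMildSolution P D G f g σ W u)
    -- the region: all of `D` in dimension one, else a ball whose closure lies in `D`
    (A : Set (Euc k))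
    (hA : (k = 1 ∧ A = D) ∨ ∃ (c : Euc k) (r : ℝ), 0 < r ∧ closedBall c r ⊆ D ∧ A = ball c r) :
    (∀ γ : ℝ, 0 < γ → γ < 1 → ∀ p : ℝ, 2 ≤ p → ∃ C : ℝ, 0 < C ∧ ∀ x₁ ∈ A, ∀ x₂ ∈ A,
      ∫⁻ ω, ‖u x₁ ω - u x₂ ω‖ₑ ^ p ∂P ≤
        ENNReal.ofReal (C * ‖x₁ - x₂‖ ^ (p * momentExponent k γ))) ∧
    ∀ᵐ ω ∂P, ∀ α : ℝ≥0, 0 < α → (α : ℝ) < pathExponent k →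
      ∃ C : ℝ≥0, HolderOnWith C α (fun x => u x ω) A := by
  have hK := greenSup_ne_top hG.volume_ne_zero hLK
  have hGP := greenProps_of_isDomainWithGreen hG hK
  have hf := continuous_of_nemytskii hGP.isOpen hGP.nonempty hGP.bounded hF hC.1
  -- Almost surely v and u agree at all x simultaneously, so both the moments and the path
  -- regularity of v pass to u.
  obtain ⟨v, hv, hvu⟩ := exists_goodVersion hGP hf hg hu
  obtain ⟨hAo, hAc, hAne, hAD⟩ := IsRegion.props hG hGP hA
  have hmom : ∀ γ : ℝ, 0 < γ → γ < 1 → ∀ p : ℝ≥0, 2 ≤ p → ∃ C : ℝ, 0 < C ∧ ∀ x₁ ∈ A, ∀ x₂ ∈ A,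
      ∫⁻ ω, ‖v x₁ ω - v x₂ ω‖ₑ ^ (p : ℝ) ∂P ≤
        ENNReal.ofReal (C * ‖x₁ - x₂‖ ^ (p * momentExponent k γ)) := by
    intro γ hγ0 hγ1 p hp
    obtain ⟨C₁, hC₁⟩ := hv.exists_eLpNorm_sub_le hGP hK hf hF hg hC.2 hM ha hLa hW hp
    obtain ⟨C₂, hC₂, hH⟩ := hGP.holder A hA γ hγ0 hγ1
    exact exists_moment_bound hAD (two_pos.trans_le hp).ne' hC₁ hC₂ hH
  refine ⟨fun γ hγ0 hγ1 p hp => ?_, ?_⟩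
  · have hp' : (p.toNNReal : ℝ) = p := Real.coe_toNNReal p (by linarith)
    obtain ⟨C, hC0, hCb⟩ := hmom γ hγ0 hγ1 p.toNNReal (by
      rw [← NNReal.coe_le_coe, hp']; exact hp)
    rw [hp'] at hCb
    refine ⟨C, hC0, fun x₁ hx₁ x₂ hx₂ => le_of_eq_of_le (lintegral_congr_ae ?_)
      (hCb x₁ hx₁ x₂ hx₂)⟩
    filter_upwards [hvu] with ω hω
    rw [hω x₁, hω x₂]
  · have hpath := ae_exists_holderOnWith hAo hAne hAc (hGP.bounded.subset hAD)
      (fun x hx => hv.measurable x (hAD hx))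
      (fun ω => (hv.continuousOn ω).mono (hAD.trans subset_closure))
      (fun γ hγ => pathExponent_sub_le_momentExponent hG hγ) hmom
    filter_upwards [hpath, hvu] with ω hω hvω
    simpa only [hvω] using hω
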